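/- Let $\mathcal G$ be a second countable locally compact Hausdorff étale groupoid with unit space $\mathcal G^{(0)}$ and range and source maps $r,s$. For $x\in\mathcal G^{(0)}$ put $\mathcal G_x=s^{-1}(x)$ and $\mathcal G^x_x=r^{-1}(x)\cap s^{-1}(x)$. Let $C^*_r(\mathcal G)$ be the reduced groupoid $C^*$-algebra, i.e. the completion of the convolution $*$-algebra $C_c(\mathcal G)$ in the norm $\|f\|_r=\sup_{x\in\mathcal G^{(0)}}\|\pi_x(f)\|$, where $\pi_x(f)\xi(g)=\sum_{r(h)=r(g)}f(h)\,\xi(h^{-1}g)$ on $\ell^2(\mathcal G_x)$. Let $P:C^*_r(\mathcal G)\to C_0(\mathcal G^{(0)})$ be the canonical conditional expectation, the continuous extension of the restriction map $C_c(\mathcal G)\to C_c(\mathcal G^{(0)})$. A continuous homomorphism $c:\mathcal G\to\mathbb R$ defines a point-wise norm-continuous one-parameter group $\sigma^c=(\sigma^c_t)_{t\in\mathbb R}$ of automorphisms of $C^*_r(\mathcal G)$, determined by $\sigma^c_t(f)(g)=e^{itc(g)}f(g)$ for $f\in C_c(\mathcal G)$. A weight $\psi:A_+\to[0,\infty]$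 on a $C^*$-algebra $A$ is proper when it is non-zero, densely defined and lower semi-continuous. Put $\mathcal N_\psi=\{a\in A:\psi(a^*a)<\infty\}$ and denote also by $\psi$ the unique linear extension of $\psi$ to $\mathcal N_\psi^*\mathcal N_\psi=\operatorname{Span}\{a^*b: a,b\in\mathcal N_\psi\}$. For $\beta\in\mathbb R$, a $\beta$-KMS weight for a point-wise norm-continuous one-parameter group $\alpha=(\alpha_t)_{t\in\mathbb R}$ of automorphisms of $A$ is a proper weight $\psi$ with $\psi\circ\alpha_t=\psi$ for all $t\in\mathbb R$, such that for all $a,b\in\mathcal N_\psi\cap\mathcal N_\psi^*$ there is a bounded continuous function $F$ on the closed strip of all $z\in\mathbb C$ whose imaginary part lies between $0$ and $\beta$, holomorphic in the interior of the strip, with $F(t)=\psi(a\,\alpha_t(b))$ and $F(t+i\beta)=\psi(\alpha_t(b)\,a)$ for all $t\in\mathbb R$. **Theorem.** Let $c_0:\mathcal G\to\mathbb R$ and $c:\mathcal G\to\mathbb R$ be continuous homomorphisms and put $\ker c_0=\{g\in\mathcal G: c_0(g)=0\}$. Assume that $\mathcal G^x_x\cap\ker c_0=\{x\}$ for all $x\in\mathcal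 G^{(0)}$, and that $\ker c_0$ is open in $\mathcal G$. Let $\beta\in\mathbb R$ and let $\psi$ be a $\beta$-KMS weight for $\sigma^c$ on $C^*_r(\mathcal G)$ such that $\psi\circ\sigma^{c_0}_t=\psi$ for all $t\in\mathbb R$. Then there is a non-zero regular Borel measure $m$ on $\mathcal G^{(0)}$, finite on compact sets, such that $$\psi(a)=\int_{\mathcal G^{(0)}}P(a)\,dm\qquad\text{for all } a\in C^*_r(\mathcal G),\ a\ge 0 .$$ -/

import Mathlib

open Set Filter Topology MeasureTheory
open scoped ENNReal NNReal CompactlySupported ZeroAtInfty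

/-! ### Weights on C*-algebras and the KMS condition -/

section Weights

/-- A weight on a C*-algebra `A`: an additive and positively homogeneous map `A₊ → [0,∞]`. -/
structure CStarWeight (A : Type*) [NonUnitalCStarAlgebra A] [PartialOrder A]
    [StarOrderedRing A] where
  toFun : {a : A // 0 ≤ a} → ℝ≥0∞
  map_add' : ∀ a b : {a : A // 0 ≤ a}, toFun (a + b) = toFun a + toFun b
  map_smul' : ∀ (l : ℝ) (hl : 0 < l) (a : {a : A // 0 ≤ a}),
    toFun ⟨l • (a : A), smul_nonneg hl.le a.2⟩ = ENNReal.ofReal l * toFun a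

/-- A point-wise norm-continuous one-parameter group of automorphisms of a C*-algebra. -/
structure OneParameterGroup (A : Type*) [NonUnitalCStarAlgebra A] where
  toFun : ℝ → (A ≃⋆ₐ[ℂ] A)
  map_zero' : ∀ a, toFun 0 a = a
  map_add' : ∀ s t a, toFun (s + t) a = toFun s (toFun t a)
  continuous' : ∀ a, Continuous fun t => toFun t a

instance {A : Type*} [NonUnitalCStarAlgebra A] :
    CoeFun (OneParameterGroup A) (fun _ => ℝ → (A ≃⋆ₐ[ℂ] A)) := ⟨OneParameterGroup.toFun⟩

namespace CStarWeight

variable {A : Type*} [NonUnitalCStarAlgebra A] [PartialOrder A] [StarOrderedRing A]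

instance : CoeFun (CStarWeight A) (fun _ => {a : A // 0 ≤ a} → ℝ≥0∞) := ⟨CStarWeight.toFun⟩

/-- A weight is proper when it is non-zero, densely defined and lower semi-continuous. -/
structure IsProper (ψ : CStarWeight A) : Prop where
  ne_zero : ∃ a, ψ a ≠ 0
  dense : Dense {a : {a : A // 0 ≤ a} | ψ a < ∞}
  lowerSemicontinuous : ∀ r : ℝ≥0, IsClosed {a : {a : A // 0 ≤ a} | ψ a ≤ r}

/-- `𝒩_ψ = {a ∈ A : ψ(a⋆a) < ∞}`. -/
def leftIdeal (ψ : CStarWeight A) : Set A :=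
  {a | ψ ⟨star a * a, star_mul_self_nonneg a⟩ < ∞}

/-- `𝒩_ψ⋆ 𝒩_ψ`, the linear span of the products `a⋆b` with `a, b ∈ 𝒩_ψ`. -/
def defDomain (ψ : CStarWeight A) : Submodule ℂ A :=
  Submodule.span ℂ {x | ∃ a ∈ ψ.leftIdeal, ∃ b ∈ ψ.leftIdeal, x = star a * b}

/-- `Ψ` is a linear functional on `𝒩_ψ⋆ 𝒩_ψ` extending
`ψ : 𝒩_ψ⋆ 𝒩_ψ ∩ A₊ → [0,∞)`. -/
def IsLinearExtension (ψ : CStarWeight A) (Ψ : ψ.defDomain →ₗ[ℂ] ℂ) : Prop :=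
  ∀ x : ψ.defDomain, ∀ hx : 0 ≤ (x : A),
    ψ ⟨x, hx⟩ ≠ ∞ ∧ Ψ x = ((ψ ⟨x, hx⟩).toReal : ℂ)

theorem map_zero_of_isProper {ψ : CStarWeight A} (h : ψ.IsProper) : ψ 0 = 0 := by
  have h0 : (⟨0, le_rfl⟩ : {a : A // 0 ≤ a}) = 0 := rfl
  obtain ⟨a, ha⟩ := h.dense.nonempty
  have h1 := ψ.map_add' a 0
  rw [add_zero] at h1
  have h2 : ψ a + 0 = ψ a + ψ 0 := by rw [add_zero]; exact h1
  exact ((ENNReal.add_right_inj (ne_of_lt ha)).1 h2).symm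

theorem mono (ψ : CStarWeight A) {a b : {a : A // 0 ≤ a}} (h : (a : A) ≤ b) : ψ a ≤ ψ b := by
  have : b = a + ⟨(b : A) - a, sub_nonneg.2 h⟩ := by
    ext; simp
  rw [this, ψ.map_add']
  exact le_self_add

theorem smul_mem_leftIdeal {ψ : CStarWeight A} (h : ψ.IsProper) (c : ℂ) {a : A}
    (ha : a ∈ ψ.leftIdeal) : c • a ∈ ψ.leftIdeal := by
  rcases eq_or_ne c 0 with rfl | hc
  · have : (⟨star ((0 : ℂ) • a) * ((0 : ℂ) • a), star_mul_self_nonneg _⟩ :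
        {a : A // 0 ≤ a}) = 0 := by ext; simp
    simp only [leftIdeal, Set.mem_ofPred_eq]
    rw [this, map_zero_of_isProper h]
    exact ENNReal.zero_lt_top
  · have hc' : 0 < ‖c‖ ^ 2 := by positivity
    have : (⟨star (c • a) * (c • a), star_mul_self_nonneg _⟩ : {a : A // 0 ≤ a}) =
        ⟨(‖c‖ ^ 2) • (star a * a), smul_nonneg hc'.le (star_mul_self_nonneg a)⟩ := by
      ext
      simp only [star_smul, smul_mul_assoc, mul_smul_comm, smul_smul]
      rw [← Complex.coe_smul (‖c‖ ^ 2)]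
      congr 1
      simpa using Complex.mul_conj' c
    simp only [leftIdeal, Set.mem_ofPred_eq]
    rw [this, ψ.map_smul' _ hc' ⟨star a * a, star_mul_self_nonneg a⟩]
    exact ENNReal.mul_lt_top ENNReal.ofReal_lt_top ha

theorem add_mem_leftIdeal {ψ : CStarWeight A} {a b : A}
    (ha : a ∈ ψ.leftIdeal) (hb : b ∈ ψ.leftIdeal) : a + b ∈ ψ.leftIdeal := by
  set x : {a : A // 0 ≤ a} := ⟨star a * a, star_mul_self_nonneg a⟩
  set y : {a : A // 0 ≤ a} := ⟨star b * b, star_mul_self_nonneg b⟩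
  have : (⟨star (a + b) * (a + b), star_mul_self_nonneg _⟩ : {a : A // 0 ≤ a}) +
      ⟨star (a - b) * (a - b), star_mul_self_nonneg _⟩ = (x + y) + (x + y) := by
    ext
    simp only [x, y, Nonneg.mk_add_mk, star_add, star_sub]
    noncomm_ring
  have h2 := congrArg ψ this
  rw [ψ.map_add', ψ.map_add', ψ.map_add'] at h2
  have h3 : ψ x + ψ y + (ψ x + ψ y) < ∞ := by
    have hx : ψ x < ∞ := ha
    have hy : ψ y < ∞ := hb
    exact ENNReal.add_lt_top.2 ⟨ENNReal.add_lt_top.2 ⟨hx, hy⟩, ENNReal.add_lt_top.2 ⟨hx, hy⟩⟩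
  rw [← h2] at h3
  exact lt_of_le_of_lt le_self_add h3

theorem sum_aux {ψ : CStarWeight A} (h : ψ.IsProper) {ι : Type*} (s : Finset ι)
    (p : ι → {a : A // 0 ≤ a}) (w : ι → ℝ) (hw : ∀ i, 0 ≤ w i) :
    ∃ hn : 0 ≤ ∑ i ∈ s, w i • (p i : A),
      ψ ⟨∑ i ∈ s, w i • (p i : A), hn⟩ = ∑ i ∈ s, ENNReal.ofReal (w i) * ψ (p i) := by
  classical
  have hn : ∀ t : Finset ι, 0 ≤ ∑ i ∈ t, w i • (p i : A) := fun t =>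
    Finset.sum_nonneg fun i _ => smul_nonneg (hw i) (p i).2
  refine ⟨hn s, ?_⟩
  induction s using Finset.induction_on with
  | empty =>
    simp only [Finset.sum_empty]
    exact map_zero_of_isProper h
  | insert i t hi ih =>
    have e1 : (⟨∑ j ∈ insert i t, w j • (p j : A), hn _⟩ : {a : A // 0 ≤ a}) =
        ⟨w i • (p i : A), smul_nonneg (hw i) (p i).2⟩ + ⟨∑ j ∈ t, w j • (p j : A), hn t⟩ := by
      ext; simp [Finset.sum_insert hi]
    rw [e1, ψ.map_add', ih, Finset.sum_insert hi]
    congr 1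
    rcases (hw i).eq_or_lt with h0 | h0
    · have : (⟨w i • (p i : A), smul_nonneg (hw i) (p i).2⟩ : {a : A // 0 ≤ a}) = 0 := by
        ext; simp [← h0]
      rw [this, map_zero_of_isProper h, ← h0]; simp
    · exact ψ.map_smul' _ h0 _

/-- The elements `a⋆a` with `a ∈ 𝒩_ψ`. -/
def sq (ψ : CStarWeight A) (a : ψ.leftIdeal) : {a : A // 0 ≤ a} :=
  ⟨star (a : A) * a, star_mul_self_nonneg (a : A)⟩

theorem mem_span_sq {ψ : CStarWeight A} (h : ψ.IsProper) {x : A} (hx : x ∈ ψ.defDomain) :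
    x ∈ Submodule.span ℂ (range fun a : ψ.leftIdeal => (ψ.sq a : A)) := by
  refine Submodule.span_le.2 ?_ hx
  rintro _ ⟨a, ha, b, hb, rfl⟩
  have key : ∀ c : ℂ, star (b + c • a) * (b + c • a) ∈
      Submodule.span ℂ (range fun a : ψ.leftIdeal => (ψ.sq a : A)) := fun c =>
    Submodule.subset_span ⟨⟨_, add_mem_leftIdeal hb (smul_mem_leftIdeal h c ha)⟩, rfl⟩
  have e : star a * b = (1 / 4 : ℂ) • (star (b + (1 : ℂ) • a) * (b + (1 : ℂ) • a))
      + (-1 / 4 : ℂ) • (star (b + (-1 : ℂ) • a) * (b + (-1 : ℂ) • a))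
      + (Complex.I / 4 : ℂ) • (star (b + Complex.I • a) * (b + Complex.I • a))
      + (-Complex.I / 4 : ℂ) • (star (b + (-Complex.I) • a) * (b + (-Complex.I) • a)) := by
    simp only [star_add, star_smul, add_mul, mul_add, smul_mul_assoc, mul_smul_comm, smul_add,
      smul_smul]
    simp only [Complex.star_def, map_one, map_neg, Complex.conj_I]
    match_scalars <;> ring_nf <;> norm_num [Complex.I_sq]
  rw [SetLike.mem_coe, e]
  exact Submodule.add_mem _ (Submodule.add_mem _ (Submodule.add_mem _
    (Submodule.smul_mem _ _ (key _)) (Submodule.smul_mem _ _ (key _)))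
    (Submodule.smul_mem _ _ (key _))) (Submodule.smul_mem _ _ (key _))

theorem span_sq_eq {ψ : CStarWeight A} (h : ψ.IsProper) :
    Submodule.span ℂ (range fun a : ψ.leftIdeal => (ψ.sq a : A)) = ψ.defDomain := by
  refine le_antisymm (Submodule.span_le.2 ?_) (fun x hx => mem_span_sq h hx)
  rintro _ ⟨a, rfl⟩
  exact Submodule.subset_span ⟨a, a.2, a, a.2, rfl⟩

theorem self_adjoint_aux {ψ : CStarWeight A} (h : ψ.IsProper) (v : ψ.leftIdeal →₀ ℂ) (x : A)
    (hx : ∑ a ∈ v.support, v a • (ψ.sq a : A) = x) (hx0 : 0 ≤ x) :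
    ψ ⟨x, hx0⟩ ≠ ∞ ∧
      ∑ a ∈ v.support, v a * ((ψ (ψ.sq a)).toReal : ℂ) = ((ψ ⟨x, hx0⟩).toReal : ℂ) := by
  -- decomposition of a combination with real coefficients
  have fin : ∀ a : ψ.leftIdeal, ψ (ψ.sq a) ≠ ∞ := fun a => ne_of_lt a.2
  have real_case : ∀ (w : ψ.leftIdeal → ℝ) (y : A) (hy0 : 0 ≤ y),
      ∑ a ∈ v.support, w a • (ψ.sq a : A) = y → ψ ⟨y, hy0⟩ ≠ ∞ ∧
        ∑ a ∈ v.support, w a * (ψ (ψ.sq a)).toReal = (ψ ⟨y, hy0⟩).toReal := by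
    intro w y hy0 hy
    obtain ⟨hp, hpe⟩ := sum_aux h v.support ψ.sq (fun a => max (w a) 0) (fun a => le_max_right _ _)
    obtain ⟨hq, hqe⟩ := sum_aux h v.support ψ.sq (fun a => max (-w a) 0)
      (fun a => le_max_right _ _)
    have e : (⟨_, hp⟩ : {a : A // 0 ≤ a}) = ⟨y, hy0⟩ + ⟨_, hq⟩ := by
      ext
      simp only [Nonneg.mk_add_mk]
      rw [← hy, ← Finset.sum_add_distrib]
      refine Finset.sum_congr rfl fun a _ => ?_
      rw [← add_smul]
      congr 1
      rcases le_total 0 (w a) with h1 | h1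
      · rw [max_eq_left h1, max_eq_right (by linarith)]; ring
      · rw [max_eq_right h1, max_eq_left (by linarith)]; ring
    have e2 := congrArg ψ e
    rw [ψ.map_add', hpe, hqe] at e2
    have finp : ∀ u : ψ.leftIdeal → ℝ,
        ∑ a ∈ v.support, ENNReal.ofReal (u a) * ψ (ψ.sq a) ≠ ∞ := fun u =>
      ENNReal.sum_ne_top.2 fun a _ => ENNReal.mul_ne_top ENNReal.ofReal_ne_top (fin a)
    have hyfin : ψ ⟨y, hy0⟩ ≠ ∞ := by
      intro ht
      rw [ht, top_add] at e2
      exact finp _ e2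
    refine ⟨hyfin, ?_⟩
    have e3 := congrArg ENNReal.toReal e2
    rw [ENNReal.toReal_add hyfin (finp _), ENNReal.toReal_sum, ENNReal.toReal_sum] at e3
    · simp only [ENNReal.toReal_mul] at e3
      rw [← sub_eq_iff_eq_add] at e3
      rw [← e3, ← Finset.sum_sub_distrib]
      refine Finset.sum_congr rfl fun a _ => ?_
      rw [ENNReal.toReal_ofReal (le_max_right _ _), ENNReal.toReal_ofReal (le_max_right _ _),
        ← sub_mul]
      congr 1
      rcases le_total 0 (w a) with h1 | h1
      · rw [max_eq_left h1, max_eq_right (by linarith)]; ring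
      · rw [max_eq_right h1, max_eq_left (by linarith)]; ring
    · exact fun a _ => ENNReal.mul_ne_top ENNReal.ofReal_ne_top (fin a)
    · exact fun a _ => ENNReal.mul_ne_top ENNReal.ofReal_ne_top (fin a)
  have hsa : ∀ a : ψ.leftIdeal, star (ψ.sq a : A) = ψ.sq a := fun a => by simp [sq]
  have hstar : ∑ a ∈ v.support, star (v a) • (ψ.sq a : A) = x := by
    have := congrArg star hx
    rw [star_sum, (IsSelfAdjoint.of_nonneg hx0).star_eq] at this
    simpa only [star_smul, hsa] using this
  have hre : ∑ a ∈ v.support, (v a).re • (ψ.sq a : A) = x := by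
    have e : ∀ a, (v a).re • (ψ.sq a : A) =
        (1 / 2 : ℂ) • (v a • (ψ.sq a : A) + star (v a) • (ψ.sq a : A)) := fun a => by
      rw [← Complex.coe_smul, Complex.re_eq_add_conj, ← add_smul, smul_smul]
      congr 1
      simp only [Complex.star_def]; ring
    rw [Finset.sum_congr rfl fun a _ => e a, ← Finset.smul_sum, Finset.sum_add_distrib, hx,
      hstar, ← two_smul ℂ, smul_smul]
    norm_num
  have him : ∑ a ∈ v.support, (v a).im • (ψ.sq a : A) = 0 := by
    have e : ∀ a, (v a).im • (ψ.sq a : A) =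
        (1 / (2 * Complex.I) : ℂ) • (v a • (ψ.sq a : A) - star (v a) • (ψ.sq a : A)) :=
      fun a => by
      rw [← Complex.coe_smul, Complex.im_eq_sub_conj, ← sub_smul, smul_smul]
      congr 1
      simp only [Complex.star_def]; ring
    rw [Finset.sum_congr rfl fun a _ => e a, ← Finset.smul_sum, Finset.sum_sub_distrib, hx,
      hstar, sub_self, smul_zero]
  obtain ⟨h1, h2⟩ := real_case (fun a => (v a).re) x hx0 hre
  obtain ⟨-, h3⟩ := real_case (fun a => (v a).im) 0 le_rfl him
  have h0 : ψ ⟨0, le_rfl⟩ = 0 := map_zero_of_isProper h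
  rw [h0, ENNReal.toReal_zero] at h3
  refine ⟨h1, ?_⟩
  rw [← h2]
  apply Complex.ext
  · simp [Complex.re_sum]
  · simpa [Complex.im_sum] using h3

/-- The linear extension of a proper weight to `𝒩_ψ⋆ 𝒩_ψ` exists and is unique. -/
theorem existsUnique_linearExtension {ψ : CStarWeight A} (h : ψ.IsProper) :
    ∃! Ψ : ψ.defDomain →ₗ[ℂ] ℂ, ψ.IsLinearExtension Ψ := by
  let L : (ψ.leftIdeal →₀ ℂ) →ₗ[ℂ] A :=
    Finsupp.linearCombination ℂ (fun a : ψ.leftIdeal => (ψ.sq a : A))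
  let Λ : (ψ.leftIdeal →₀ ℂ) →ₗ[ℂ] ℂ :=
    Finsupp.linearCombination ℂ (fun a : ψ.leftIdeal => ((ψ (ψ.sq a)).toReal : ℂ))
  have hLr : LinearMap.range L = ψ.defDomain := by
    rw [← span_sq_eq h, Finsupp.range_linearCombination]
  have key : ∀ v (hv : 0 ≤ L v), ψ ⟨L v, hv⟩ ≠ ∞ ∧ Λ v = ((ψ ⟨L v, hv⟩).toReal : ℂ) := by
    intro v hv
    have := self_adjoint_aux h v (L v) rfl hv
    exact this
  have hker : LinearMap.ker L ≤ LinearMap.ker Λ := by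
    intro v hv
    rw [LinearMap.mem_ker] at hv ⊢
    have := (key v hv.ge).2
    have h0 : (⟨L v, hv.ge⟩ : {a : A // 0 ≤ a}) = 0 := by ext; exact hv
    rw [this, h0, map_zero_of_isProper h]; simp
  let Φ : LinearMap.range L →ₗ[ℂ] ℂ :=
    ((LinearMap.ker L).liftQ Λ hker) ∘ₗ (L.quotKerEquivRange.symm : _ →ₗ[ℂ] _)
  have hΦ : ∀ v, Φ ⟨L v, LinearMap.mem_range_self L v⟩ = Λ v := by
    intro v
    have : L.quotKerEquivRange.symm ⟨L v, LinearMap.mem_range_self L v⟩ =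
        (LinearMap.ker L).mkQ v := by
      rw [LinearEquiv.symm_apply_eq]
      rfl
    simp only [Φ, LinearMap.comp_apply, LinearEquiv.coe_coe, this]
    simp
  refine ⟨Φ ∘ₗ (LinearEquiv.ofEq _ _ hLr.symm : ψ.defDomain →ₗ[ℂ] _), ?_, ?_⟩
  · rintro ⟨x, hxm⟩ hx
    obtain ⟨v, hv⟩ : x ∈ LinearMap.range L := hLr ▸ hxm
    subst hv
    refine ⟨(key v hx).1, ?_⟩
    rw [← (key v hx).2, ← hΦ v]
    rfl
  · intro Ψ hΨ
    ext ⟨x, hxm⟩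
    obtain ⟨v, hv⟩ : x ∈ LinearMap.range L := hLr ▸ hxm
    subst hv
    have lhs : ∀ v (hm : L v ∈ ψ.defDomain), Ψ ⟨L v, hm⟩ = Λ v := by
      have : ∀ v, L v ∈ ψ.defDomain := fun v => hLr ▸ LinearMap.mem_range_self L v
      have e : Ψ ∘ₗ L.codRestrict ψ.defDomain this = Λ := by
        ext a
        have hL1 : L (Finsupp.single a 1) = (ψ.sq a : A) := by simp [L]
        have h1 := (hΨ ⟨(ψ.sq a : A), hL1 ▸ this _⟩ (ψ.sq a).2).2
        simp only [LinearMap.comp_apply, Finsupp.lsingle_apply]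
        have : L.codRestrict ψ.defDomain this (Finsupp.single a 1) =
          ⟨(ψ.sq a : A), hL1 ▸ this _⟩ := Subtype.ext hL1
        rw [this, h1]
        simp [Λ]
      intro v hm
      exact LinearMap.congr_fun e v
    rw [lhs v hxm, ← hΦ v]
    rfl

/-- The linear functional `𝒩_ψ⋆ 𝒩_ψ → ℂ` extending a proper weight `ψ`. -/
noncomputable def linearExtension (ψ : CStarWeight A) (h : ψ.IsProper) : ψ.defDomain →ₗ[ℂ] ℂ :=
  (existsUnique_linearExtension h).choose

theorem linearExtension_spec (ψ : CStarWeight A) (h : ψ.IsProper) :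
    ψ.IsLinearExtension (ψ.linearExtension h) :=
  (existsUnique_linearExtension h).choose_spec.1

/-- `ψ ∘ φ = ψ` on the positive cone, for an automorphism `φ` of `A`. -/
def IsInvariantUnder (ψ : CStarWeight A) (φ : A ≃⋆ₐ[ℂ] A) : Prop :=
  ∀ a : {a : A // 0 ≤ a}, ψ ⟨φ a, map_nonneg φ a.2⟩ = ψ a

theorem IsInvariantUnder.mem_leftIdeal {ψ : CStarWeight A} {φ : A ≃⋆ₐ[ℂ] A}
    (h : ψ.IsInvariantUnder φ) {b : A} (hb : b ∈ ψ.leftIdeal) : φ b ∈ ψ.leftIdeal := by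
  have := h ⟨star b * b, star_mul_self_nonneg b⟩
  have e : (⟨star (φ b) * φ b, star_mul_self_nonneg _⟩ : {a : A // 0 ≤ a}) =
      ⟨φ (star b * b), map_nonneg φ (star_mul_self_nonneg b)⟩ := by
    ext; simp [map_mul, map_star]
  simp only [leftIdeal, Set.mem_ofPred_eq]
  rw [e, this]
  exact hb

theorem mul_mem_defDomain {ψ : CStarWeight A} {a b : A} (ha : star a ∈ ψ.leftIdeal)
    (hb : b ∈ ψ.leftIdeal) : a * b ∈ ψ.defDomain :=
  Submodule.subset_span ⟨star a, ha, b, hb, by rw [star_star]⟩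

/-- The closed strip of complex numbers whose imaginary part lies between `0` and `β`
(`β` may be negative or zero). -/
def kmsStrip (β : ℝ) : Set ℂ := {z | z.im ∈ uIcc 0 β}

/-- `ψ` is a `β`-KMS weight for the one-parameter group `α`. The set
`𝒩_ψ ∩ 𝒩_ψ⋆` consists of the `a` with `a ∈ 𝒩_ψ` and `a⋆ ∈ 𝒩_ψ`. -/
structure IsKMS (ψ : CStarWeight A) (α : OneParameterGroup A) (β : ℝ) : Prop where
  proper : ψ.IsProper
  invariant : ∀ t, ψ.IsInvariantUnder (α t)
  kms : ∀ (a b : A) (ha : a ∈ ψ.leftIdeal) (ha' : star a ∈ ψ.leftIdeal)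
    (hb : b ∈ ψ.leftIdeal) (hb' : star b ∈ ψ.leftIdeal),
    ∃ F : ℂ → ℂ, ContinuousOn F (kmsStrip β) ∧ (∃ C : ℝ, ∀ z ∈ kmsStrip β, ‖F z‖ ≤ C) ∧
      DifferentiableOn ℂ F (interior (kmsStrip β)) ∧
      ∀ t : ℝ,
        F t = ψ.linearExtension proper
          ⟨a * α t b, mul_mem_defDomain ha' ((invariant t).mem_leftIdeal hb)⟩ ∧
        F (t + Complex.I * β) = ψ.linearExtension proper
          ⟨α t b * a, mul_mem_defDomain
            (by rw [← map_star]; exact (invariant t).mem_leftIdeal hb') ha⟩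

end CStarWeight

end Weights

/-! ### Étale groupoids -/

section Groupoids

/-- An étale topological groupoid, given by its space of arrows `G`. The unit space is the set of
arrows `x` with `range x = x`. The product `mul g h` is only meaningful when
`source g = range h`. Étale means that the range map is a local homeomorphism from `G` to the unit
space, the latter with the subspace topology. -/
class EtaleGroupoid (G : Type*) [TopologicalSpace G] where
  range : G → G
  source : G → G
  mul : G → G → G
  inv : G → G
  range_range : ∀ g, range (range g) = range g
  source_range : ∀ g, source (range g) = range g
  range_source : ∀ g, range (source g) = source g
  source_source : ∀ g, source (source g) = source g
  range_mul : ∀ g h, source g = range h → range (mul g h) = range g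
  source_mul : ∀ g h, source g = range h → source (mul g h) = source h
  mul_assoc : ∀ g h k, source g = range h → source h = range k →
    mul (mul g h) k = mul g (mul h k)
  range_mul_self : ∀ g, mul (range g) g = g
  self_mul_source : ∀ g, mul g (source g) = g
  range_inv : ∀ g, range (inv g) = source g
  source_inv : ∀ g, source (inv g) = range g
  mul_inv : ∀ g, mul g (inv g) = range g
  inv_mul : ∀ g, mul (inv g) g = source g
  continuous_inv : Continuous inv
  continuousOn_mul : ContinuousOn (fun p : G × G => mul p.1 p.2) {p | source p.1 = range p.2}
  isLocalHomeomorph_range :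
    IsLocalHomeomorph (fun g : G => (⟨range g, range_range g⟩ : {x : G // range x = x}))

namespace EtaleGroupoid

/-- The unit space `G⁽⁰⁾`, as a subset of the groupoid. -/
def unitSpace (G : Type*) [TopologicalSpace G] [EtaleGroupoid G] : Set G := {x | range x = x}

/-- The isotropy group `Gˣₓ`, the set of arrows with range and source `x`. -/
def isotropy {G : Type*} [TopologicalSpace G] [EtaleGroupoid G] (x : G) : Set G :=
  {g | range g = x ∧ source g = x}

/-- A continuous homomorphism `c : G → ℝ`. -/
structure RealHom (G : Type*) [TopologicalSpace G] [EtaleGroupoid G] where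
  toFun : G → ℝ
  continuous' : Continuous toFun
  map_mul' : ∀ g h, source g = range h → toFun (mul g h) = toFun g + toFun h

instance {G : Type*} [TopologicalSpace G] [EtaleGroupoid G] :
    CoeFun (RealHom G) (fun _ => G → ℝ) := ⟨RealHom.toFun⟩

/-- The kernel `{g ∈ G : c(g) = 0}`. -/
def RealHom.ker {G : Type*} [TopologicalSpace G] [EtaleGroupoid G] (c : RealHom G) : Set G :=
  {g | c g = 0}

variable {G : Type*} [TopologicalSpace G] [EtaleGroupoid G]

theorem continuous_range : Continuous (range : G → G) :=
  continuous_subtype_val.comp isLocalHomeomorph_range.continuous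

theorem continuous_source : Continuous (source : G → G) := by
  have : (source : G → G) = range ∘ inv := by ext g; exact (range_inv g).symm
  rw [this]; exact continuous_range.comp continuous_inv

theorem source_unit {x : G} (hx : range x = x) : source x = x := by
  rw [← hx, source_range]

theorem inv_mul_cancel_left {g h : G} (e : source g = range h) : mul (inv g) (mul g h) = h := by
  rw [← mul_assoc _ _ _ (source_inv g) e, inv_mul, e, range_mul_self]

theorem mul_inv_cancel_left {g h : G} (e : range g = range h) : mul g (mul (inv g) h) = h := by
  rw [← mul_assoc _ _ _ (range_inv g).symm ((source_inv g).trans e), mul_inv, e, range_mul_self]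

theorem mul_inv_cancel_right {g h : G} (e : source g = range h) : mul (mul g h) (inv h) = g := by
  rw [mul_assoc _ _ _ e (range_inv h).symm, mul_inv, ← e, self_mul_source]

theorem inv_mul_cancel_right {g h : G} (e : source g = source h) :
    mul (mul g (inv h)) h = g := by
  rw [mul_assoc _ _ _ (e.trans (range_inv h).symm) (source_inv h), inv_mul, ← e, self_mul_source]

theorem eq_inv_of_mul {g h : G} (e : source g = range h) (hm : mul g h = range g) :
    h = inv g := by
  have := inv_mul_cancel_left e
  rw [hm, ← source_inv g, self_mul_source] at this
  exact this.symm

theorem inv_inv (g : G) : inv (inv g) = g :=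
  (eq_inv_of_mul (source_inv g) (by rw [inv_mul, range_inv])).symm

theorem mul_inv_rev {g h : G} (e : source g = range h) :
    inv (mul g h) = mul (inv h) (inv g) := by
  have e1 : source (inv h) = range (inv g) := by rw [source_inv, range_inv, e]
  refine (eq_inv_of_mul ?_ ?_).symm
  · rw [source_mul _ _ e, range_mul _ _ e1, range_inv]
  · rw [mul_assoc _ _ _ e (by rw [range_mul _ _ e1, range_inv]),
      mul_inv_cancel_left (by rw [range_inv, e]), mul_inv, range_mul _ _ e]

/-- Each arrow has an open neighbourhood on which both range and source are injective. -/
theorem exists_bisection (g : G) :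
    ∃ V : Set G, IsOpen V ∧ g ∈ V ∧ InjOn (range : G → G) V ∧ InjOn (source : G → G) V := by
  have key : ∀ g : G, ∃ V : Set G, IsOpen V ∧ g ∈ V ∧ InjOn (range : G → G) V := fun g => by
    obtain ⟨e, he, hee⟩ := isLocalHomeomorph_range (G := G) g
    refine ⟨e.source, e.open_source, he, fun a ha b hb hab => e.injOn ha hb ?_⟩
    rw [← hee]
    exact Subtype.ext hab
  obtain ⟨V, hV, hgV, hVi⟩ := key g
  obtain ⟨W, hW, hgW, hWi⟩ := key (inv g)
  refine ⟨V ∩ inv ⁻¹' W, hV.inter (hW.preimage continuous_inv), ⟨hgV, hgW⟩,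
    hVi.mono inter_subset_left, fun a ha b hb hab => ?_⟩
  have := hWi ha.2 hb.2 (by rw [range_inv, range_inv, hab])
  rw [← inv_inv a, this, inv_inv]

/-- A compact set is covered by finitely many bisections. -/
theorem exists_cover {K : Set G} (hK : IsCompact K) :
    ∃ (n : ℕ) (V : Fin n → Set G), (∀ i, IsOpen (V i)) ∧ (∀ i, InjOn (range : G → G) (V i)) ∧
      (∀ i, InjOn (source : G → G) (V i)) ∧ K ⊆ ⋃ i, V i := by
  choose V hV hgV hr hs using exists_bisection (G := G)
  obtain ⟨t, ht⟩ := hK.elim_finite_subcover V hV (fun g _ => mem_iUnion.2 ⟨g, hgV g⟩)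
  refine ⟨t.card, fun i => V (t.equivFin.symm i), fun i => hV _, fun i => hr _, fun i => hs _, ?_⟩
  intro g hg
  obtain ⟨j, hj, hgj⟩ := mem_iUnion₂.1 (ht hg)
  exact mem_iUnion.2 ⟨t.equivFin ⟨j, hj⟩, by simpa using hgj⟩

theorem exists_colouring {K : Set G} (hK : IsCompact K) :
    ∃ (n : ℕ) (c : G → Fin (n + 1)), ∀ g ∈ K, ∀ h ∈ K, c g = c h →
      (range g = range h → g = h) ∧ (source g = source h → g = h) := by
  obtain ⟨n, V, -, hr, hs, hc⟩ := exists_cover hK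
  have : ∀ g : G, ∃ i : Fin (n + 1), g ∈ K → ∃ hi : (i : ℕ) < n, g ∈ V ⟨i, hi⟩ := fun g => by
    by_cases hg : g ∈ K
    · obtain ⟨i, hi⟩ := mem_iUnion.1 (hc hg)
      exact ⟨i.castSucc, fun _ => ⟨i.2, hi⟩⟩
    · exact ⟨0, fun h => absurd h hg⟩
  choose c hcc using this
  refine ⟨n, c, fun g hg h hh hgh => ?_⟩
  obtain ⟨i1, h1⟩ := hcc g hg
  obtain ⟨i2, h2⟩ := hcc h hh
  have e : (⟨c g, i1⟩ : Fin n) = ⟨c h, i2⟩ := by ext; simp [hgh]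
  rw [← e] at h2
  exact ⟨fun e => hr _ h1 h2 e, fun e => hs _ h1 h2 e⟩

end EtaleGroupoid

/-- A Schur test for matrices with uniformly finite rows and columns. -/
theorem exists_matrix_operator {ι : Type*} (K : ι → ι → ℂ) (n : ℕ) (M : ℝ) (hM0 : 0 ≤ M)
    (hM : ∀ g k, ‖K g k‖ ≤ M) (c : ι → ι → Fin n)
    (hrow : ∀ g k k', K g k ≠ 0 → K g k' ≠ 0 → c g k = c g k' → k = k')
    (hcol : ∀ g g' k, K g k ≠ 0 → K g' k ≠ 0 → c g k = c g' k → g = g') :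
    ∃ T : lp (fun _ : ι => ℂ) 2 →L[ℂ] lp (fun _ : ι => ℂ) 2,
      (∀ ξ g, (T ξ : ι → ℂ) g = ∑' k, K g k * (ξ : ι → ℂ) k) ∧ ‖T‖ ≤ n * M := by
  classical
  have hfin : ∀ g, {k | K g k ≠ 0}.Finite := fun g =>
    Set.Finite.of_finite_image (f := c g) (Set.toFinite _) fun k hk k' hk' h => hrow g k k' hk hk' h
  have htwo : (2 : ℝ≥0∞).toReal = 2 := by norm_num
  let S : ι → Finset ι := fun g => (hfin g).toFinset
  have hS : ∀ g k, k ∈ S g ↔ K g k ≠ 0 := fun g k => by simp [S]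
  have hcard : ∀ g, (S g).card ≤ n := fun g => by
    simpa using Finset.card_le_card_of_injOn (t := Finset.univ) (c g) (fun _ _ => Finset.mem_univ _)
      (fun k hk k' hk' h => hrow g k k' ((hS g k).1 hk) ((hS g k').1 hk') h)
  have hts : ∀ (ξ : ι → ℂ) g, ∑' k, K g k * ξ k = ∑ k ∈ S g, K g k * ξ k := fun ξ g =>
    tsum_eq_sum fun k hk => by
      have : K g k = 0 := by by_contra h; exact hk ((hS g k).2 h)
      rw [this, zero_mul]
  have hsummand : ∀ (ξ : ι → ℂ) g, ‖∑' k, K g k * ξ k‖ ^ 2 ≤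
      n * M ^ 2 * ∑ k ∈ S g, ‖ξ k‖ ^ 2 := fun ξ g => by
    rw [hts]
    have h1 : ‖∑ k ∈ S g, K g k * ξ k‖ ≤ ∑ k ∈ S g, M * ‖ξ k‖ :=
      (norm_sum_le _ _).trans (Finset.sum_le_sum fun k _ => by
        rw [norm_mul]; exact mul_le_mul_of_nonneg_right (hM g k) (norm_nonneg _))
    calc ‖∑ k ∈ S g, K g k * ξ k‖ ^ 2 ≤ (∑ k ∈ S g, M * ‖ξ k‖) ^ 2 := by gcongr
      _ ≤ (S g).card * ∑ k ∈ S g, (M * ‖ξ k‖) ^ 2 := sq_sum_le_card_mul_sum_sq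
      _ ≤ n * ∑ k ∈ S g, (M * ‖ξ k‖) ^ 2 := by
          gcongr
          exact hcard g
      _ = n * M ^ 2 * ∑ k ∈ S g, ‖ξ k‖ ^ 2 := by
          simp only [mul_pow, ← Finset.mul_sum, mul_assoc]
  have hsum : ∀ (ξ : lp (fun _ : ι => ℂ) 2) (s : Finset ι),
      ∑ g ∈ s, ‖∑' k, K g k * (ξ : ι → ℂ) k‖ ^ (2 : ℝ≥0∞).toReal ≤
        (n * M * ‖ξ‖) ^ (2 : ℝ≥0∞).toReal := fun ξ s => by
    rw [htwo]
    simp only [Real.rpow_two]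
    have hξ : ∀ t : Finset ι, ∑ k ∈ t, ‖(ξ : ι → ℂ) k‖ ^ 2 ≤ ‖ξ‖ ^ 2 := fun t => by
      have := lp.sum_rpow_le_norm_rpow (p := 2) (by rw [htwo]; norm_num) ξ t
      rw [htwo] at this
      simpa only [Real.rpow_two] using this
    calc ∑ g ∈ s, ‖∑' k, K g k * (ξ : ι → ℂ) k‖ ^ 2
        ≤ ∑ g ∈ s, n * M ^ 2 * ∑ k ∈ S g, ‖(ξ : ι → ℂ) k‖ ^ 2 :=
          Finset.sum_le_sum fun g _ => hsummand _ g
      _ = n * M ^ 2 * ∑ g ∈ s, ∑ k ∈ S g, ‖(ξ : ι → ℂ) k‖ ^ 2 := by rw [Finset.mul_sum]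
      _ = n * M ^ 2 * ∑ k ∈ s.biUnion S, ∑ g ∈ s.filter (fun g => k ∈ S g),
            ‖(ξ : ι → ℂ) k‖ ^ 2 := by
          congr 1
          apply Finset.sum_comm'
          intro g k
          simp only [Finset.mem_filter, Finset.mem_biUnion]
          constructor
          · rintro ⟨h1, h2⟩; exact ⟨⟨h1, h2⟩, g, h1, h2⟩
          · rintro ⟨h, -⟩; exact h
      _ ≤ n * M ^ 2 * ∑ k ∈ s.biUnion S, n * ‖(ξ : ι → ℂ) k‖ ^ 2 := by
          gcongr with k hk
          rw [Finset.sum_const, nsmul_eq_mul]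
          gcongr
          simpa using Finset.card_le_card_of_injOn (t := Finset.univ) (fun g => c g k)
            (fun _ _ => Finset.mem_univ _) (fun g hg g' hg' h => hcol g g' k
              ((hS g k).1 (Finset.mem_filter.1 hg).2) ((hS g' k).1 (Finset.mem_filter.1 hg').2) h)
      _ = n * M ^ 2 * n * ∑ k ∈ s.biUnion S, ‖(ξ : ι → ℂ) k‖ ^ 2 := by
          rw [← Finset.mul_sum]; ring
      _ ≤ n * M ^ 2 * n * ‖ξ‖ ^ 2 := by gcongr; exact hξ _
      _ = (n * M * ‖ξ‖) ^ 2 := by ring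
  let T : lp (fun _ : ι => ℂ) 2 →ₗ[ℂ] lp (fun _ : ι => ℂ) 2 :=
    { toFun := fun ξ => ⟨fun g => ∑' k, K g k * (ξ : ι → ℂ) k, memℓp_gen' (hsum ξ)⟩
      map_add' := fun ξ η => by
        ext g
        change ∑' k, K g k * ((ξ + η : lp (fun _ : ι => ℂ) 2) : ι → ℂ) k =
          ∑' k, K g k * (ξ : ι → ℂ) k + ∑' k, K g k * (η : ι → ℂ) k
        rw [hts, hts, hts, ← Finset.sum_add_distrib]
        exact Finset.sum_congr rfl fun k _ => by rw [lp.coeFn_add, Pi.add_apply, mul_add]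
      map_smul' := fun z ξ => by
        ext g
        simp only [lp.coeFn_smul, Pi.smul_apply, hts, smul_eq_mul, RingHom.id_apply,
          Finset.mul_sum]
        exact Finset.sum_congr rfl fun k _ => by ring }
  have hb : ∀ ξ, ‖T ξ‖ ≤ n * M * ‖ξ‖ := fun ξ =>
    lp.norm_le_of_forall_sum_le (by rw [htwo]; norm_num) (by positivity) (hsum ξ)
  exact ⟨T.mkContinuous _ hb, fun ξ g => rfl, T.mkContinuous_norm_le (by positivity) _⟩

namespace EtaleGroupoid

/-! ### The convolution algebra `C_c(G)` -/

section Convolution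

variable {G : Type*} [TopologicalSpace G] [EtaleGroupoid G]

/-- For `g ∈ G` the map `k ↦ g k⁻¹` is a bijection from `G_{s(g)}` onto `G^{r(g)}`, with inverse
`h ↦ h⁻¹ g`. -/
def fiberEquiv (x : G) (g : {g : G // source g = x}) :
    {k : G // source k = x} ≃ {h : G // range h = range (g : G)} where
  toFun k := ⟨mul g (inv k), range_mul _ _ (by rw [range_inv, g.2, k.2])⟩
  invFun h := ⟨mul (inv h) g, by rw [source_mul _ _ ((source_inv _).trans h.2), g.2]⟩
  left_inv k := by
    ext
    simp only
    rw [mul_inv_rev (by rw [range_inv, g.2, k.2]), inv_inv,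
      inv_mul_cancel_right (by rw [g.2, k.2])]
  right_inv h := by
    ext
    simp only
    rw [mul_inv_rev ((source_inv _).trans h.2), inv_inv, mul_inv_cancel_left h.2.symm]

theorem finite_fiber (f : C_c(G, ℂ)) (y : G) :
    {h : {h : G // range h = y} | f h ≠ 0}.Finite := by
  obtain ⟨n, c, hc⟩ := exists_colouring f.hasCompactSupport.isCompact
  refine Set.Finite.of_finite_image (f := fun h => c (h : G)) (Set.toFinite _) ?_
  intro h hh h' hh' e
  exact Subtype.ext ((hc h (subset_tsupport _ hh) h' (subset_tsupport _ hh') e).1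
    (h.2.trans h'.2.symm))

/-- The convolution of two functions on the groupoid,
`(f₁ * f₂)(g) = ∑_{h ∈ G^{r(g)}} f₁(h) f₂(h⁻¹ g)`. -/
noncomputable def convFun (f₁ f₂ : G → ℂ) (g : G) : ℂ :=
  ∑' h : {h : G // range h = range g}, f₁ h * f₂ (mul (inv h) g)

theorem convFun_ne_zero {f₁ f₂ : G → ℂ} {g : G} (h : convFun f₁ f₂ g ≠ 0) :
    ∃ h : G, range h = range g ∧ f₁ h ≠ 0 ∧ f₂ (mul (inv h) g) ≠ 0 := by
  by_contra hcon
  push Not at hcon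
  apply h
  unfold convFun
  convert! tsum_zero with k
  by_cases hk : f₁ k = 0
  · rw [hk, zero_mul]
  · rw [hcon k k.2 hk, mul_zero]

theorem hasCompactSupport_convFun [T2Space G] (f₁ f₂ : C_c(G, ℂ)) :
    HasCompactSupport (convFun f₁ f₂) := by
  have hcl : IsClosed {p : G × G | source p.1 = range p.2} :=
    isClosed_eq (continuous_source.comp continuous_fst) (continuous_range.comp continuous_snd)
  have hK : IsCompact ((tsupport f₁ ×ˢ tsupport f₂) ∩ {p : G × G | source p.1 = range p.2}) :=
    (f₁.hasCompactSupport.isCompact.prod f₂.hasCompactSupport.isCompact).inter_right hcl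
  refine HasCompactSupport.intro
    (hK.image_of_continuousOn (continuousOn_mul.mono inter_subset_right)) fun g hg => ?_
  by_contra hne
  obtain ⟨h, hr, h1, h2⟩ := convFun_ne_zero hne
  refine hg ⟨(h, mul (inv h) g), ⟨⟨subset_tsupport _ h1, subset_tsupport _ h2⟩, ?_⟩, ?_⟩
  · change source h = range (mul (inv h) g)
    rw [range_mul _ _ ((source_inv _).trans hr), range_inv]
  · exact mul_inv_cancel_left hr

theorem continuous_convFun_of_injOn [T2Space G] (f₁ f₂ : C_c(G, ℂ)) {V : Set G} (hV : IsOpen V)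
    (hr : InjOn (range : G → G) V) (hf : tsupport f₁ ⊆ V) : Continuous (convFun f₁ f₂) := by
  rw [continuous_iff_continuousAt]
  intro g₀
  by_cases h0 : range g₀ ∈ (range : G → G) '' tsupport f₁
  · obtain ⟨h₀, hh₀, e₀⟩ := h0
    obtain ⟨e, he, hee⟩ := isLocalHomeomorph_range (G := G) h₀
    let ρ : G → {x : G // range x = x} := fun g => ⟨range g, range_range g⟩
    have hρ : Continuous ρ := isLocalHomeomorph_range.continuous
    have hee' : ∀ g, e g = ρ g := fun g => (congrFun hee g).symm
    have hρ0 : ρ g₀ = e h₀ := by rw [hee']; exact Subtype.ext e₀.symm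
    let τ : G → G := fun g => e.symm (ρ g)
    have hτ0 : τ g₀ = h₀ := by simp only [τ]; rw [hρ0]; exact e.left_inv he
    have htgt : ρ g₀ ∈ e.target := hρ0 ▸ e.map_source he
    have hτc : ContinuousAt τ g₀ :=
      ContinuousAt.comp (e.symm.continuousAt htgt) hρ.continuousAt
    have ev1 : ∀ᶠ g in 𝓝 g₀, τ g ∈ V :=
      hτc.eventually (hV.mem_nhds (by rw [hτ0]; exact hf hh₀))
    have ev2 : ∀ᶠ g in 𝓝 g₀, range (τ g) = range g := by
      filter_upwards [hρ.continuousAt.eventually (e.open_target.mem_nhds htgt)] with g hg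
      have h1 := e.right_inv hg
      rw [hee'] at h1
      exact congrArg Subtype.val h1
    have hev : (fun g => f₁ (τ g) * f₂ (mul (inv (τ g)) g)) =ᶠ[𝓝 g₀] convFun f₁ f₂ := by
      filter_upwards [ev1, ev2] with g h1 h2
      symm
      unfold convFun
      rw [tsum_eq_single (⟨τ g, h2⟩ : {h : G // range h = range g})]
      intro h hne
      by_cases hh : f₁ h = 0
      · rw [hh, zero_mul]
      · exact absurd (Subtype.ext (hr (hf (subset_tsupport _ hh)) h1 (h.2.trans h2.symm))) hne
    refine ContinuousAt.congr ?_ hev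
    have hpair : Tendsto (fun g => (inv (τ g), g)) (𝓝 g₀)
        (𝓝[{p : G × G | source p.1 = range p.2}] (inv (τ g₀), g₀)) := by
      refine tendsto_nhdsWithin_iff.2 ⟨?_, ?_⟩
      · exact (continuous_inv.continuousAt.comp hτc).prodMk continuousAt_id
      · filter_upwards [ev2] with g hg
        exact (source_inv _).trans hg
    have hm : ContinuousAt (fun g => mul (inv (τ g)) g) g₀ :=
      (continuousOn_mul (inv (τ g₀), g₀)
        ((source_inv _).trans (by rw [hτ0, e₀]))).tendsto.comp hpair
    exact (f₁.continuous.continuousAt.comp hτc).mul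
      (ContinuousAt.comp (f := fun g => mul (inv (τ g)) g) f₂.continuous.continuousAt hm)
  · have hcl : IsClosed ((range : G → G) '' tsupport f₁) :=
      (f₁.hasCompactSupport.isCompact.image continuous_range).isClosed
    have hev : (fun _ => (0 : ℂ)) =ᶠ[𝓝 g₀] convFun f₁ f₂ := by
      filter_upwards [(hcl.isOpen_compl.preimage continuous_range).mem_nhds h0] with g hg
      by_contra hne
      obtain ⟨h, h1, h2, -⟩ := convFun_ne_zero (Ne.symm hne)
      exact hg ⟨h, subset_tsupport _ h2, h1⟩
    exact continuousAt_const.congr hev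

theorem continuous_convFun [T2Space G] [LocallyCompactSpace G] (f₁ f₂ : C_c(G, ℂ)) :
    Continuous (convFun f₁ f₂) := by
  obtain ⟨n, V, hV, hr, -, hc⟩ := exists_cover (G := G) f₁.hasCompactSupport.isCompact
  obtain ⟨p, hp, hp1, -, hpc⟩ :=
    exists_continuous_sum_one_of_isOpen_isCompact hV f₁.hasCompactSupport.isCompact hc
  let q : Fin n → C_c(G, ℂ) := fun i =>
    ⟨⟨fun g => (p i g : ℂ) * f₁ g,
      (Complex.continuous_ofReal.comp (p i).continuous).mul f₁.continuous⟩,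
      f₁.hasCompactSupport.mul_left⟩
  have hq : ∀ i, tsupport (q i) ⊆ V i := fun i => by
    refine subset_trans (closure_mono fun g hg => ?_) (hp i)
    intro h
    apply hg
    change ((p i g : ℝ) : ℂ) * f₁ g = 0
    rw [h, Complex.ofReal_zero, zero_mul]
  have hsum : ∀ g, f₁ g = ∑ i, q i g := fun g => by
    change f₁ g = ∑ i, (p i g : ℂ) * f₁ g
    by_cases hg : f₁ g = 0
    · simp [hg]
    · have := hp1 (subset_tsupport _ hg)
      simp only [Finset.sum_apply, Pi.one_apply] at this
      rw [← Finset.sum_mul, ← Complex.ofReal_sum, this, Complex.ofReal_one, one_mul]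
  have hconv : convFun f₁ f₂ = fun g => ∑ i, convFun (q i) f₂ g := by
    ext g
    unfold convFun
    rw [← Summable.tsum_finsetSum]
    · exact tsum_congr fun h => by rw [hsum, Finset.sum_mul]
    · intro i _
      refine summable_of_hasFiniteSupport ((finite_fiber (q i) (range g)).subset fun h hh => ?_)
      exact left_ne_zero_of_mul hh
  rw [hconv]
  exact continuous_finsetSum _ fun i _ => continuous_convFun_of_injOn _ _ (hV i) (hr i) (hq i)

/-- The convolution product on `C_c(G)`. -/
noncomputable def conv [T2Space G] [LocallyCompactSpace G] (f₁ f₂ : C_c(G, ℂ)) : C_c(G, ℂ) :=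
  ⟨⟨convFun f₁ f₂, continuous_convFun f₁ f₂⟩, hasCompactSupport_convFun f₁ f₂⟩

/-- The inversion of the groupoid as a homeomorphism. -/
def invHomeomorph : G ≃ₜ G where
  toFun := inv
  invFun := inv
  left_inv := inv_inv
  right_inv := inv_inv
  continuous_toFun := continuous_inv
  continuous_invFun := continuous_inv

/-- The involution on `C_c(G)`: the function `g ↦ conj (f(g⁻¹))`. -/
noncomputable def invol (f : C_c(G, ℂ)) : C_c(G, ℂ) :=
  ⟨⟨fun g => star (f (inv g)), continuous_star.comp (f.continuous.comp continuous_inv)⟩,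
    (f.hasCompactSupport.comp_homeomorph (invHomeomorph (G := G))).comp_left (star_zero ℂ)⟩

/-- The function `g ↦ e^{itc(g)} f(g)`. -/
noncomputable def RealHom.twist (c : RealHom G) (t : ℝ) (f : C_c(G, ℂ)) : C_c(G, ℂ) :=
  ⟨⟨fun g => Complex.exp (Complex.I * t * c g) * f g,
    (Complex.continuous_exp.comp (continuous_const.mul
      (Complex.continuous_ofReal.comp c.continuous'))).mul f.continuous⟩,
    f.hasCompactSupport.mul_left⟩

end Convolution

/-! ### The reduced groupoid C*-algebra -/

section Reduced

variable {G : Type*} [TopologicalSpace G] [EtaleGroupoid G]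

/-- The Hilbert space `ℓ²(G_x)`, where `G_x` is the set of arrows with source `x`. -/
abbrev FiberHilbert (x : unitSpace G) : Type _ :=
  lp (fun _ : {g : G // source g = (x : G)} => ℂ) 2

theorem exists_fiberRep {K : Set G} (hK : IsCompact K) :
    ∃ n : ℕ, ∀ (f : C_c(G, ℂ)), (∀ g, f g ≠ 0 → g ∈ K) → ∀ M : ℝ, (∀ g, ‖f g‖ ≤ M) →
      ∀ x : unitSpace G, ∃ T : FiberHilbert x →L[ℂ] FiberHilbert x,
        (∀ (ξ : FiberHilbert x) (g : {g : G // source g = (x : G)}),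
          T ξ g = ∑' h : {h : G // range h = range (g : G)}, f h *
            ξ ⟨mul (inv h) g, by rw [source_mul _ _ ((source_inv _).trans h.2), g.2]⟩) ∧
        ‖T‖ ≤ n * M := by
  obtain ⟨n, c, hc⟩ := exists_colouring (G := G) hK
  refine ⟨n + 1, fun f hfK M hM x => ?_⟩
  have hM0 : 0 ≤ M := (norm_nonneg _).trans (hM x)
  obtain ⟨T, hT, hTn⟩ := exists_matrix_operator
    (ι := {g : G // source g = (x : G)}) (fun g k => f (mul g (inv k))) (n + 1) M hM0
    (fun g k => hM _) (fun g k => c (mul g (inv k)))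
    (fun g k k' h1 h2 e => by
      have e1 : source (g : G) = range (inv (k : G)) := by rw [range_inv, g.2, k.2]
      have e2 : source (g : G) = range (inv (k' : G)) := by rw [range_inv, g.2, k'.2]
      have := (hc _ (hfK _ h1) _ (hfK _ h2) e).1 (by rw [range_mul _ _ e1, range_mul _ _ e2])
      exact (fiberEquiv (x : G) g).injective (Subtype.ext this))
    (fun g g' k h1 h2 e => by
      have e1 : source (g : G) = range (inv (k : G)) := by rw [range_inv, g.2, k.2]
      have e2 : source (g' : G) = range (inv (k : G)) := by rw [range_inv, g'.2, k.2]
      have := (hc _ (hfK _ h1) _ (hfK _ h2) e).2 (by rw [source_mul _ _ e1, source_mul _ _ e2])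
      have h3 := congrArg (fun z => mul z (k : G)) this
      rw [inv_mul_cancel_right (by rw [g.2, k.2]), inv_mul_cancel_right (by rw [g'.2, k.2])] at h3
      exact Subtype.ext h3)
  refine ⟨T, fun ξ g => ?_, hTn⟩
  rw [hT, ← (fiberEquiv (x : G) g).symm.tsum_eq]
  refine tsum_congr fun h => ?_
  congr 2
  exact congrArg Subtype.val ((fiberEquiv (x : G) g).apply_symm_apply h)

theorem exists_norm_bound {G : Type*} [TopologicalSpace G] (f : C_c(G, ℂ)) : ∃ M : ℝ, ∀ g, ‖f g‖ ≤ M :=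
  f.hasCompactSupport.exists_bound_of_continuous f.continuous

theorem exists_fiberRep' (f : C_c(G, ℂ)) (x : unitSpace G) :
    ∃ T : FiberHilbert x →L[ℂ] FiberHilbert x,
        ∀ (ξ : FiberHilbert x) (g : {g : G // source g = (x : G)}),
          T ξ g = ∑' h : {h : G // range h = range (g : G)}, f h *
            ξ ⟨mul (inv h) g, by rw [source_mul _ _ ((source_inv _).trans h.2), g.2]⟩ := by
  obtain ⟨n, hn⟩ := exists_fiberRep (G := G) f.hasCompactSupport.isCompact
  obtain ⟨M, hM⟩ := exists_norm_bound f
  obtain ⟨T, hT, -⟩ := hn f (fun g hg => subset_tsupport _ hg) M hM x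
  exact ⟨T, hT⟩

/-- The operator `π_x(f)` on `ℓ²(G_x)`, determined by `fiberRep_apply` below. -/
noncomputable def fiberRep (x : unitSpace G) (f : C_c(G, ℂ)) :
    FiberHilbert x →L[ℂ] FiberHilbert x := (exists_fiberRep' f x).choose

/-- `(π_x(f) ξ)(g) = ∑_{h ∈ G^{r(g)}} f(h) ξ(h⁻¹ g)`. -/
theorem fiberRep_apply (x : unitSpace G) (f : C_c(G, ℂ)) (ξ : FiberHilbert x)
    (g : {g : G // source g = (x : G)}) :
    fiberRep x f ξ g = ∑' h : {h : G // range h = range (g : G)}, f h *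
      ξ ⟨mul (inv h) g, by rw [source_mul _ _ ((source_inv _).trans h.2), g.2]⟩ :=
  (exists_fiberRep' f x).choose_spec ξ g

theorem norm_fiberRep_le {K : Set G} (hK : IsCompact K) :
    ∃ n : ℕ, ∀ (f : C_c(G, ℂ)), (∀ g, f g ≠ 0 → g ∈ K) → ∀ M : ℝ, (∀ g, ‖f g‖ ≤ M) →
      ∀ x : unitSpace G, ‖fiberRep x f‖ ≤ n * M := by
  obtain ⟨n, hn⟩ := exists_fiberRep (G := G) hK
  refine ⟨n, fun f hf M hM x => ?_⟩
  obtain ⟨T, hT, hTn⟩ := hn f hf M hM x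
  have : fiberRep x f = T := by
    ext ξ g
    rw [fiberRep_apply, hT]
  rwa [this]

/-- `(π_x(f) ξ)(g) = ∑_{k ∈ G_x} f(g k⁻¹) ξ(k)`. -/
theorem fiberRep_apply' (x : unitSpace G) (f : C_c(G, ℂ)) (ξ : FiberHilbert x)
    (g : {g : G // source g = (x : G)}) :
    fiberRep x f ξ g = ∑' k : {g : G // source g = (x : G)}, f (mul g (inv k)) * ξ k := by
  rw [fiberRep_apply, ← (fiberEquiv (x : G) g).tsum_eq]
  refine tsum_congr fun k => ?_
  have : (⟨_, by rw [source_mul _ _ ((source_inv _).trans (fiberEquiv (x : G) g k).2), g.2]⟩ :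
      {g : G // source g = (x : G)}) = k := (fiberEquiv (x : G) g).symm_apply_apply k
  rw [this]
  rfl

theorem finite_row (x : G) (f : C_c(G, ℂ)) (g : {g : G // source g = x}) :
    {k : {g : G // source g = x} | f (mul g (inv k)) ≠ 0}.Finite :=
  ((finite_fiber f (range (g : G))).preimage (fiberEquiv x g).injective.injOn)

/-- The C*-algebra of bounded families `(T_x)` of operators `T_x` on `ℓ²(G_x)`, with norm
`sup_x ‖T_x‖` and with the entrywise operations. -/
def FiberOperators (G : Type*) [TopologicalSpace G] [EtaleGroupoid G] : Type _ :=
  lp (fun x : unitSpace G => FiberHilbert x →L[ℂ] FiberHilbert x) ∞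

noncomputable instance : NonUnitalCStarAlgebra (FiberOperators G) :=
  inferInstanceAs (NonUnitalCStarAlgebra
    (lp (fun x : unitSpace G => FiberHilbert x →L[ℂ] FiberHilbert x) ∞))

/-- The entry `T_x` of a family. -/
def FiberOperators.entry (a : FiberOperators G) (x : unitSpace G) :
    FiberHilbert x →L[ℂ] FiberHilbert x := a.1 x

namespace FiberOperators

@[ext] theorem ext {a b : FiberOperators G} (h : ∀ x, a.entry x = b.entry x) : a = b :=
  lp.ext (funext h)

theorem entry_add (a b : FiberOperators G) (x) : (a + b).entry x = a.entry x + b.entry x := rfl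

theorem entry_sub (a b : FiberOperators G) (x) : (a - b).entry x = a.entry x - b.entry x := rfl

theorem entry_smul (z : ℂ) (a : FiberOperators G) (x) : (z • a).entry x = z • a.entry x := rfl

theorem entry_mul (a b : FiberOperators G) (x) : (a * b).entry x = a.entry x * b.entry x := rfl

theorem entry_star (a : FiberOperators G) (x) : (star a).entry x = star (a.entry x) := rfl

theorem norm_eq (a : FiberOperators G) : ‖a‖ = ⨆ x, ‖a.entry x‖ := lp.norm_eq_ciSup _

theorem norm_entry_le (a : FiberOperators G) (x) : ‖a.entry x‖ ≤ ‖a‖ :=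
  lp.norm_apply_le_norm (by simp) _ x

theorem norm_le (a : FiberOperators G) {C : ℝ} (hC : 0 ≤ C) (h : ∀ x, ‖a.entry x‖ ≤ C) :
    ‖a‖ ≤ C := lp.norm_le_of_forall_le hC h

end FiberOperators

theorem memℓp_fiberRep (f : C_c(G, ℂ)) :
    Memℓp (E := fun x : unitSpace G => FiberHilbert x →L[ℂ] FiberHilbert x)
      (fun x : unitSpace G => fiberRep x f) ∞ := by
  obtain ⟨n, hn⟩ := norm_fiberRep_le (G := G) f.hasCompactSupport.isCompact
  obtain ⟨M, hM⟩ := exists_norm_bound f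
  refine memℓp_infty ⟨n * M, ?_⟩
  rintro _ ⟨x, rfl⟩
  exact hn f (fun g hg => subset_tsupport _ hg) M hM x

/-- The family `(π_x(f))_x`. Its norm is the reduced norm `‖f‖_r = sup_x ‖π_x(f)‖`. -/
noncomputable def regRep (f : C_c(G, ℂ)) : FiberOperators G := ⟨fun x => fiberRep x f,
  memℓp_fiberRep f⟩

theorem norm_regRep (f : C_c(G, ℂ)) : ‖regRep f‖ = ⨆ x : unitSpace G, ‖fiberRep x f‖ :=
  FiberOperators.norm_eq _

theorem norm_regRep_le {K : Set G} (hK : IsCompact K) :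
    ∃ n : ℕ, ∀ (f : C_c(G, ℂ)), (∀ g, f g ≠ 0 → g ∈ K) → ∀ M : ℝ, 0 ≤ M → (∀ g, ‖f g‖ ≤ M) →
      ‖regRep f‖ ≤ n * M := by
  obtain ⟨n, hn⟩ := norm_fiberRep_le (G := G) hK
  exact ⟨n, fun f hf M hM0 hM => FiberOperators.norm_le _ (by positivity)
    fun x => hn f hf M hM x⟩

theorem regRep_add (f₁ f₂ : C_c(G, ℂ)) : regRep (f₁ + f₂) = regRep f₁ + regRep f₂ := by
  refine FiberOperators.ext fun x => ?_
  ext ξ g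
  change fiberRep x (f₁ + f₂) ξ g = fiberRep x f₁ ξ g + fiberRep x f₂ ξ g
  rw [fiberRep_apply', fiberRep_apply', fiberRep_apply', ← Summable.tsum_add]
  · exact tsum_congr fun k => by simp [add_mul]
  · exact summable_of_hasFiniteSupport ((finite_row _ f₁ g).subset
      fun h hh => left_ne_zero_of_mul hh)
  · exact summable_of_hasFiniteSupport ((finite_row _ f₂ g).subset
      fun h hh => left_ne_zero_of_mul hh)

theorem regRep_smul (z : ℂ) (f : C_c(G, ℂ)) : regRep (z • f) = z • regRep f := by
  refine FiberOperators.ext fun x => ?_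
  ext ξ g
  change fiberRep x (z • f) ξ g = z * fiberRep x f ξ g
  rw [fiberRep_apply', fiberRep_apply', ← tsum_mul_left]
  exact tsum_congr fun k => by simp [_root_.mul_assoc]

theorem regRep_conv [T2Space G] [LocallyCompactSpace G] (f₁ f₂ : C_c(G, ℂ)) :
    regRep (conv f₁ f₂) = regRep f₁ * regRep f₂ := by
  refine FiberOperators.ext fun x => ?_
  ext ξ g
  change fiberRep x (conv f₁ f₂) ξ g = fiberRep x f₁ (fiberRep x f₂ ξ) g
  let S := (finite_row (x : G) f₁ g).toFinset
  have hS : ∀ j, j ∉ S → f₁ (mul g (inv j)) = 0 := fun j hj => by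
    by_contra h; exact hj ((Set.Finite.mem_toFinset _).2 h)
  have kernel : ∀ k : {g : G // source g = (x : G)}, conv f₁ f₂ (mul g (inv k)) =
      ∑ j ∈ S, f₁ (mul g (inv j)) * f₂ (mul j (inv k)) := fun k => by
    have e1 : source (g : G) = range (inv (k : G)) := by rw [range_inv, g.2, k.2]
    have e2 : range (mul (g : G) (inv k)) = range (g : G) := range_mul _ _ e1
    change ∑' h : {h : G // range h = range (mul (g : G) (inv k))},
      f₁ h * f₂ (mul (inv h) (mul g (inv k))) = _
    rw [e2, ← (fiberEquiv (x : G) g).tsum_eq, tsum_eq_sum (s := S)]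
    · refine Finset.sum_congr rfl fun j _ => ?_
      change f₁ (mul g (inv j)) * f₂ (mul (inv (mul g (inv j))) (mul g (inv k))) = _
      have e3 : source (g : G) = range (inv (j : G)) := by rw [range_inv, g.2, j.2]
      rw [← mul_assoc _ _ _ (by rw [source_inv, range_mul _ _ e3]) e1, mul_inv_rev e3, inv_inv,
        inv_mul_cancel_right (by rw [g.2, j.2])]
    · intro j hj
      change f₁ (mul g (inv j)) * _ = 0
      rw [hS j hj, zero_mul]
  have hsplit := tsum_eq_sum (L := SummationFilter.unconditional _)
    (f := fun j : {g : G // source g = (x : G)} => f₁ (mul g (inv j)) * fiberRep x f₂ ξ j) (s := S)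
    (fun j hj => by rw [hS j hj, zero_mul])
  rw [fiberRep_apply', fiberRep_apply', hsplit]
  simp_rw [kernel, fiberRep_apply', Finset.sum_mul, ← tsum_mul_left]
  rw [Summable.tsum_finsetSum]
  · exact Finset.sum_congr rfl fun j _ => tsum_congr fun k => by ring
  · intro j _
    refine summable_of_hasFiniteSupport ((finite_row _ f₂ j).subset fun k hk => ?_)
    exact right_ne_zero_of_mul (left_ne_zero_of_mul hk)

/-- The coefficients of an adjoint operator on `ℓ²`. -/
theorem adjoint_apply_eq {ι : Type*} [DecidableEq ι] (T : lp (fun _ : ι => ℂ) 2 →L[ℂ]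
    lp (fun _ : ι => ℂ) 2) (ξ : lp (fun _ : ι => ℂ) 2) (g : ι) :
    (star T ξ) g = ∑' k, star (T (lp.single 2 g 1) k) * ξ k := by
  have h1 : (star T ξ) g = inner ℂ (lp.single 2 g (1 : ℂ)) (star T ξ) := by
    rw [lp.inner_single_left]; simp
  rw [h1, ContinuousLinearMap.star_eq_adjoint, ContinuousLinearMap.adjoint_inner_right,
    lp.inner_eq_tsum]
  exact tsum_congr fun k => by rw [RCLike.inner_apply', Complex.star_def]

theorem regRep_invol (f : C_c(G, ℂ)) : regRep (invol f) = star (regRep f) := by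
  classical
  refine FiberOperators.ext fun x => ?_
  ext ξ g
  change fiberRep x (invol f) ξ g = star (fiberRep x f) ξ g
  rw [adjoint_apply_eq, fiberRep_apply']
  refine tsum_congr fun k => ?_
  congr 1
  rw [fiberRep_apply', tsum_eq_single g]
  · change star (f (inv (mul g (inv k)))) = _
    rw [mul_inv_rev (by rw [range_inv, g.2, k.2]), inv_inv]
    simp
  · intro j hj
    simp [hj]

/-! The unitaries that implement `σ^c`. -/

/-- Multiplication by `e^{itc(g)}` on `ℓ²(G_x)`. -/
theorem exists_fiberUnitary (c : RealHom G) (t : ℝ) (x : unitSpace G) :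
    ∃ T : FiberHilbert x →L[ℂ] FiberHilbert x,
      (∀ ξ g, T ξ g = Complex.exp (Complex.I * t * c g) * ξ g) ∧ ‖T‖ ≤ 1 := by
  classical
  have hn : ∀ s : ℝ, ‖Complex.exp (Complex.I * t * s)‖ = 1 := fun s => by
    have : Complex.I * t * s = ((t * s : ℝ) : ℂ) * Complex.I := by push_cast; ring
    rw [this, Complex.norm_exp_ofReal_mul_I]
  obtain ⟨T, hT, hTn⟩ := exists_matrix_operator (ι := {g : G // source g = (x : G)})
    (fun g k => if g = k then Complex.exp (Complex.I * t * c g) else 0) 1 1 zero_le_one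
    (fun g k => by
      split_ifs
      · exact (hn _).le
      · simp)
    (fun _ _ => 0)
    (fun g k k' h1 h2 _ => by
      simp only [ne_eq, ite_eq_right_iff, not_forall] at h1 h2
      exact h1.1.symm.trans h2.1)
    (fun g g' k h1 h2 _ => by
      simp only [ne_eq, ite_eq_right_iff, not_forall] at h1 h2
      exact h1.1.trans h2.1.symm)
  refine ⟨T, fun ξ g => ?_, by simpa using hTn⟩
  rw [hT, tsum_eq_single g]
  · simp
  · intro k hk
    simp [hk.symm]

/-- The unitary `u_t` on `ℓ²(G_x)`, `(u_t ξ)(g) = e^{itc(g)} ξ(g)`. -/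
noncomputable def fiberUnitary (c : RealHom G) (t : ℝ) (x : unitSpace G) :
    FiberHilbert x →L[ℂ] FiberHilbert x := (exists_fiberUnitary c t x).choose

theorem fiberUnitary_apply (c : RealHom G) (t : ℝ) (x : unitSpace G) (ξ : FiberHilbert x)
    (g : {g : G // source g = (x : G)}) :
    fiberUnitary c t x ξ g = Complex.exp (Complex.I * t * c g) * ξ g :=
  (exists_fiberUnitary c t x).choose_spec.1 ξ g

/-- The family of unitaries `(u_t)_x`. -/
noncomputable def unitaryFamily (c : RealHom G) (t : ℝ) : FiberOperators G :=
  ⟨fun x => fiberUnitary c t x, memℓp_infty ⟨1, by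
    rintro _ ⟨x, rfl⟩
    exact (exists_fiberUnitary c t x).choose_spec.2⟩⟩

theorem unitaryFamily_add (c : RealHom G) (s t : ℝ) :
    unitaryFamily c (s + t) = unitaryFamily c s * unitaryFamily c t := by
  refine FiberOperators.ext fun x => ?_
  ext ξ g
  change fiberUnitary c (s + t) x ξ g = fiberUnitary c s x (fiberUnitary c t x ξ) g
  rw [fiberUnitary_apply, fiberUnitary_apply, fiberUnitary_apply, ← _root_.mul_assoc,
    ← Complex.exp_add]
  congr 2
  push_cast
  ring

theorem unitaryFamily_zero_mul (c : RealHom G) (a : FiberOperators G) :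
    unitaryFamily c 0 * a = a := by
  refine FiberOperators.ext fun x => ?_
  ext ξ g
  change fiberUnitary c 0 x (a.entry x ξ) g = a.entry x ξ g
  simp [fiberUnitary_apply]

theorem mul_unitaryFamily_zero (c : RealHom G) (a : FiberOperators G) :
    a * unitaryFamily c 0 = a := by
  refine FiberOperators.ext fun x => ?_
  ext ξ g
  change a.entry x (fiberUnitary c 0 x ξ) g = a.entry x ξ g
  have : fiberUnitary c 0 x ξ = ξ := by
    ext g
    simp [fiberUnitary_apply]
  rw [this]

theorem star_unitaryFamily (c : RealHom G) (t : ℝ) :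
    star (unitaryFamily c t) = unitaryFamily c (-t) := by
  classical
  refine FiberOperators.ext fun x => ?_
  ext ξ g
  change star (fiberUnitary c t x) ξ g = fiberUnitary c (-t) x ξ g
  rw [adjoint_apply_eq, tsum_eq_single g]
  · rw [fiberUnitary_apply, fiberUnitary_apply]
    simp [← Complex.exp_conj]
  · intro k hk
    rw [fiberUnitary_apply]
    simp [hk]

/-- `u_t π_x(f) u_t⋆ = π_x(σ^c_t(f))`. -/
theorem unitaryFamily_conj_regRep (c : RealHom G) (t : ℝ) (f : C_c(G, ℂ)) :
    unitaryFamily c t * regRep f * star (unitaryFamily c t) = regRep (c.twist t f) := by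
  rw [star_unitaryFamily]
  refine FiberOperators.ext fun x => ?_
  ext ξ g
  change fiberUnitary c t x (fiberRep x f (fiberUnitary c (-t) x ξ)) g =
    fiberRep x (c.twist t f) ξ g
  rw [fiberUnitary_apply, fiberRep_apply, fiberRep_apply, ← tsum_mul_left]
  refine tsum_congr fun h => ?_
  rw [fiberUnitary_apply]
  have e : source (h : G) = range (mul (inv (h : G)) g) := by
    rw [range_mul _ _ ((source_inv _).trans h.2), range_inv]
  have hc : c (g : G) = c h + c (mul (inv (h : G)) g) := by
    rw [← c.map_mul' _ _ e, mul_inv_cancel_left h.2]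
  change Complex.exp (Complex.I * t * c g) * (f h *
    (Complex.exp (Complex.I * ((-t : ℝ) : ℂ) * c (mul (inv (h : G)) g)) * _)) =
    Complex.exp (Complex.I * t * c h) * f h * _
  have : Complex.exp (Complex.I * t * c h) = Complex.exp (Complex.I * t * c g) *
      Complex.exp (Complex.I * ((-t : ℝ) : ℂ) * c (mul (inv (h : G)) g)) := by
    rw [← Complex.exp_add, hc]
    congr 1
    push_cast
    ring
  rw [this]
  ring

theorem isClosed_unitSpace [T2Space G] : IsClosed (unitSpace G) :=
  isClosed_eq continuous_range continuous_id

variable [T2Space G] [LocallyCompactSpace G]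

/-! ### The reduced C*-algebra as a norm closure -/

/-- The *-algebra `C_c(G)`, with convolution and the involution, in its faithful representation
`f ↦ (π_x(f))_x`. -/
noncomputable def ccSubalgebra (G : Type*) [TopologicalSpace G] [EtaleGroupoid G] [T2Space G]
    [LocallyCompactSpace G] : NonUnitalStarSubalgebra ℂ (FiberOperators G) where
  carrier := Set.range (regRep (G := G))
  add_mem' := by
    rintro _ _ ⟨f₁, rfl⟩ ⟨f₂, rfl⟩
    exact ⟨f₁ + f₂, regRep_add _ _⟩
  zero_mem' := ⟨0, by
    have := regRep_smul (0 : ℂ) (0 : C_c(G, ℂ))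
    rwa [zero_smul, zero_smul] at this⟩
  mul_mem' := by
    rintro _ _ ⟨f₁, rfl⟩ ⟨f₂, rfl⟩
    exact ⟨conv f₁ f₂, regRep_conv _ _⟩
  smul_mem' := by
    rintro z _ ⟨f, rfl⟩
    exact ⟨z • f, regRep_smul _ _⟩
  star_mem' := by
    rintro _ ⟨f, rfl⟩
    exact ⟨invol f, regRep_invol _⟩

/-- The reduced groupoid C*-algebra `C*_r(G)`: the completion of `C_c(G)` in the norm
`‖f‖_r = sup_x ‖π_x(f)‖`, realised as a norm closure. -/
def ReducedCStarAlgebra (G : Type*) [TopologicalSpace G] [EtaleGroupoid G] [T2Space G]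
    [LocallyCompactSpace G] : Type _ := (ccSubalgebra G).topologicalClosure

noncomputable instance : NonUnitalCStarAlgebra (ReducedCStarAlgebra G) :=
  NonUnitalStarSubalgebra.nonUnitalCStarAlgebra (ccSubalgebra G).topologicalClosure
    (h_closed := (ccSubalgebra G).isClosed_topologicalClosure)

/-- The usual order of a C*-algebra: `a ≤ b` when `b - a` is positive. -/
noncomputable instance : PartialOrder (ReducedCStarAlgebra G) := CStarAlgebra.spectralOrder _

instance : StarOrderedRing (ReducedCStarAlgebra G) := CStarAlgebra.spectralOrderedRing _

namespace ReducedCStarAlgebra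

/-- The inclusion of `C*_r(G)` in the bounded families of operators. -/
def incl (a : ReducedCStarAlgebra G) : FiberOperators G := Subtype.val a

theorem incl_injective : Function.Injective (incl (G := G)) := Subtype.val_injective

theorem incl_add (a b : ReducedCStarAlgebra G) : incl (a + b) = incl a + incl b := rfl

theorem incl_sub (a b : ReducedCStarAlgebra G) : incl (a - b) = incl a - incl b := rfl

theorem incl_smul (z : ℂ) (a : ReducedCStarAlgebra G) : incl (z • a) = z • incl a := rfl

theorem incl_mul (a b : ReducedCStarAlgebra G) : incl (a * b) = incl a * incl b := rfl

theorem incl_star (a : ReducedCStarAlgebra G) : incl (star a) = star (incl a) := rfl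

theorem norm_incl (a : ReducedCStarAlgebra G) : ‖incl a‖ = ‖a‖ := rfl

theorem incl_mem (a : ReducedCStarAlgebra G) :
    incl a ∈ closure (Set.range (regRep (G := G))) := a.2

/-- The canonical map `C_c(G) → C*_r(G)`. -/
noncomputable def ofCc (f : C_c(G, ℂ)) : ReducedCStarAlgebra G :=
  ⟨regRep f, subset_closure ⟨f, rfl⟩⟩

theorem incl_ofCc (f : C_c(G, ℂ)) : incl (ofCc f) = regRep f := rfl

theorem exists_approx (a : ReducedCStarAlgebra G) {ε : ℝ} (hε : 0 < ε) :
    ∃ f : C_c(G, ℂ), ‖a - ofCc f‖ < ε := by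
  obtain ⟨_, ⟨f, rfl⟩, hf⟩ := Metric.mem_closure_iff.1 (incl_mem a) ε hε
  exact ⟨f, by rwa [dist_eq_norm] at hf⟩

end ReducedCStarAlgebra

/-! ### The one-parameter group `σ^c` -/

namespace ReducedCStarAlgebra

theorem conj_mem (c : RealHom G) (t : ℝ) (a : ReducedCStarAlgebra G) :
    unitaryFamily c t * incl a * star (unitaryFamily c t) ∈
      (ccSubalgebra G).topologicalClosure := by
  have hcont : Continuous fun b : FiberOperators G =>
      unitaryFamily c t * b * star (unitaryFamily c t) := by fun_prop
  refine map_mem_closure (f := fun b : FiberOperators G =>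
    unitaryFamily c t * b * star (unitaryFamily c t)) hcont (incl_mem a) ?_
  rintro _ ⟨f, rfl⟩
  exact ⟨c.twist t f, (unitaryFamily_conj_regRep c t f).symm⟩

/-- The map `σ^c_t` on `C*_r(G)`, `a ↦ u_t a u_t⋆`. -/
noncomputable def sigmaFun (c : RealHom G) (t : ℝ) (a : ReducedCStarAlgebra G) :
    ReducedCStarAlgebra G :=
  ⟨unitaryFamily c t * incl a * star (unitaryFamily c t), conj_mem c t a⟩

theorem incl_sigmaFun (c : RealHom G) (t : ℝ) (a : ReducedCStarAlgebra G) :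
    incl (sigmaFun c t a) = unitaryFamily c t * incl a * star (unitaryFamily c t) := rfl

theorem sigmaFun_zero (c : RealHom G) (a : ReducedCStarAlgebra G) : sigmaFun c 0 a = a := by
  apply incl_injective
  rw [incl_sigmaFun, star_unitaryFamily, neg_zero, mul_unitaryFamily_zero,
    unitaryFamily_zero_mul]

theorem sigmaFun_add (c : RealHom G) (s t : ℝ) (a : ReducedCStarAlgebra G) :
    sigmaFun c (s + t) a = sigmaFun c s (sigmaFun c t a) := by
  apply incl_injective
  simp only [incl_sigmaFun, unitaryFamily_add, star_mul, _root_.mul_assoc]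

theorem sigmaFun_sub (c : RealHom G) (t : ℝ) (a b : ReducedCStarAlgebra G) :
    sigmaFun c t (a - b) = sigmaFun c t a - sigmaFun c t b := by
  apply incl_injective
  simp only [incl_sigmaFun, incl_sub, mul_sub, sub_mul]

/-- The automorphism `σ^c_t` of `C*_r(G)`. -/
noncomputable def sigmaAut (c : RealHom G) (t : ℝ) :
    ReducedCStarAlgebra G ≃⋆ₐ[ℂ] ReducedCStarAlgebra G where
  toFun := sigmaFun c t
  invFun := sigmaFun c (-t)
  left_inv a := by rw [← sigmaFun_add, neg_add_cancel, sigmaFun_zero]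
  right_inv a := by rw [← sigmaFun_add, add_neg_cancel, sigmaFun_zero]
  map_mul' a b := by
    apply incl_injective
    simp only [incl_sigmaFun, incl_mul, _root_.mul_assoc]
    rw [← _root_.mul_assoc (star (unitaryFamily c t)) (unitaryFamily c t), star_unitaryFamily,
      ← unitaryFamily_add, neg_add_cancel, unitaryFamily_zero_mul]
  map_add' a b := by
    apply incl_injective
    simp only [incl_sigmaFun, incl_add, mul_add, add_mul]
  map_smul' z a := by
    apply incl_injective
    simp only [incl_sigmaFun, incl_smul, mul_smul_comm, smul_mul_assoc]
  map_star' a := by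
    apply incl_injective
    simp only [incl_sigmaFun, incl_star, star_mul, star_star, _root_.mul_assoc]

/-- On `C_c(G)`, `σ^c_t(f)(g) = e^{itc(g)} f(g)`. -/
theorem sigmaAut_ofCc (c : RealHom G) (t : ℝ) (f : C_c(G, ℂ)) :
    sigmaAut c t (ofCc f) = ofCc (c.twist t f) :=
  incl_injective (unitaryFamily_conj_regRep c t f)

theorem norm_sigmaAut (c : RealHom G) (t : ℝ) (a : ReducedCStarAlgebra G) :
    ‖sigmaAut c t a‖ = ‖a‖ := NonUnitalStarAlgHom.norm_map (sigmaAut c t)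
      (sigmaAut c t).injective a

theorem ofCc_sub (f₁ f₂ : C_c(G, ℂ)) : ofCc f₁ - ofCc f₂ = ofCc (f₁ - f₂) := by
  have h : f₁ - f₂ = f₁ + (-1 : ℂ) • f₂ := by ext; simp [sub_eq_add_neg]
  apply incl_injective
  rw [incl_sub, incl_ofCc, incl_ofCc, incl_ofCc, h, regRep_add, regRep_smul, neg_one_smul,
    sub_eq_add_neg]

theorem continuous_twist (c : RealHom G) (f : C_c(G, ℂ)) :
    Continuous fun t => ofCc (c.twist t f) := by
  obtain ⟨n, hn⟩ := norm_regRep_le (G := G) f.hasCompactSupport.isCompact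
  obtain ⟨M, hM⟩ := exists_norm_bound f
  have hM0 : 0 ≤ max M 0 := le_max_right _ _
  obtain ⟨B, hB⟩ := f.hasCompactSupport.isCompact.exists_bound_of_continuousOn
    c.continuous'.continuousOn
  have key : ∀ s t : ℝ, ‖ofCc (c.twist s f) - ofCc (c.twist t f)‖ ≤
      n * (|s - t| * max B 0 * max M 0) := by
    intro s t
    rw [ofCc_sub, ← norm_incl, incl_ofCc]
    have hval : ∀ g, (c.twist s f - c.twist t f) g = Complex.exp (Complex.I * t * c g) *
        (Complex.exp (Complex.I * ((s - t) * c g : ℝ)) - 1) * f g := fun g => by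
      change Complex.exp (Complex.I * s * c g) * f g - Complex.exp (Complex.I * t * c g) * f g = _
      rw [mul_sub, ← Complex.exp_add, ← sub_mul, mul_one]
      congr 4
      push_cast
      ring
    refine hn _ (fun g hg => ?_) _ (by positivity) (fun g => ?_)
    · rw [hval] at hg
      exact subset_tsupport _ (right_ne_zero_of_mul hg)
    · rw [hval]
      by_cases hg : f g = 0
      · rw [hg, mul_zero, norm_zero]; positivity
      · have e1 : Complex.I * t * c g = ((t * c g : ℝ) : ℂ) * Complex.I := by push_cast; ring
        rw [norm_mul, norm_mul, e1, Complex.norm_exp_ofReal_mul_I, one_mul]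
        refine mul_le_mul ?_ ((hM g).trans (le_max_left _ _)) (norm_nonneg _) (by positivity)
        refine (Real.norm_exp_I_mul_ofReal_sub_one_le).trans ?_
        rw [norm_mul, Real.norm_eq_abs]
        exact mul_le_mul_of_nonneg_left
          ((hB g (subset_tsupport _ hg)).trans (le_max_left _ _)) (abs_nonneg _)
  rw [continuous_iff_continuousAt]
  intro t
  rw [ContinuousAt, tendsto_iff_norm_sub_tendsto_zero]
  refine squeeze_zero (fun _ => norm_nonneg _) (fun s => key s t) ?_
  have : Continuous fun s : ℝ => (n : ℝ) * (|s - t| * max B 0 * max M 0) := by fun_prop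
  simpa using this.tendsto t

/-- The continuous one-parameter group `σ^c` of automorphisms of `C*_r(G)`. -/
noncomputable def sigma (c : RealHom G) : OneParameterGroup (ReducedCStarAlgebra G) where
  toFun := sigmaAut c
  map_zero' := sigmaFun_zero c
  map_add' := sigmaFun_add c
  continuous' a := by
    refine continuous_of_uniform_approx_of_continuous fun u hu => ?_
    obtain ⟨ε, hε, hεu⟩ := Metric.mem_uniformity_dist.1 hu
    obtain ⟨f, hf⟩ := exists_approx a hε
    refine ⟨fun t => ofCc (c.twist t f), continuous_twist c f, fun t => hεu ?_⟩
    rw [dist_eq_norm]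
    change ‖sigmaAut c t a - ofCc (c.twist t f)‖ < ε
    rw [← sigmaAut_ofCc, ← map_sub, norm_sigmaAut]
    exact hf

/-! ### The conditional expectation and the weights `φ_m` -/

/-- The unit `x`, as an element of `G_x`. -/
def unitArrow (x : unitSpace G) : {g : G // source g = (x : G)} := ⟨x, source_unit x.2⟩

open Classical in
/-- The matrix coefficient `⟨δ_x, a_x δ_x⟩` of `a ∈ C*_r(G)` at the unit `x`. -/
noncomputable def diag (a : ReducedCStarAlgebra G) (x : unitSpace G) : ℂ :=
  (incl a).entry x (lp.single 2 (unitArrow x) (1 : ℂ)) (unitArrow x)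

theorem diag_ofCc (f : C_c(G, ℂ)) (x : unitSpace G) : diag (ofCc f) x = f x := by
  classical
  change fiberRep x f (lp.single 2 (unitArrow x) (1 : ℂ)) (unitArrow x) = f x
  rw [fiberRep_apply', tsum_eq_single (unitArrow x)]
  · have h1 : mul (x : G) (inv (x : G)) = x := by rw [mul_inv]; exact x.2
    simp [unitArrow, h1]
  · intro k hk
    simp [hk]

theorem diag_add (a b : ReducedCStarAlgebra G) (x : unitSpace G) :
    diag (a + b) x = diag a x + diag b x := rfl

theorem diag_sub (a b : ReducedCStarAlgebra G) (x : unitSpace G) :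
    diag (a - b) x = diag a x - diag b x := rfl

theorem diag_smul (z : ℂ) (a : ReducedCStarAlgebra G) (x : unitSpace G) :
    diag (z • a) x = z * diag a x := rfl

theorem norm_diag_le (a : ReducedCStarAlgebra G) (x : unitSpace G) : ‖diag a x‖ ≤ ‖a‖ := by
  classical
  calc ‖diag a x‖ ≤ ‖(incl a).entry x (lp.single 2 (unitArrow x) (1 : ℂ))‖ :=
        lp.norm_apply_le_norm (by simp) _ _
    _ ≤ ‖(incl a).entry x‖ * ‖(lp.single 2 (unitArrow x) (1 : ℂ) : FiberHilbert x)‖ :=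
        ContinuousLinearMap.le_opNorm _ _
    _ = ‖(incl a).entry x‖ := by rw [lp.norm_single (by simp), norm_one, mul_one]
    _ ≤ ‖a‖ := FiberOperators.norm_entry_le _ x

/-- The canonical conditional expectation `P : C*_r(G) → C₀(G⁽⁰⁾)`, the continuous linear
extension of the restriction map `C_c(G) → C_c(G⁽⁰⁾)`; see `condExp_ofCc` and `norm_condExp_le`. -/
noncomputable def condExp : ReducedCStarAlgebra G →ₗ[ℂ] C₀(unitSpace G, ℂ) where
  toFun a :=
    { toFun := diag a
      continuous_toFun := by
        refine continuous_of_uniform_approx_of_continuous fun u hu => ?_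
        obtain ⟨ε, hε, hεu⟩ := Metric.mem_uniformity_dist.1 hu
        obtain ⟨f, hf⟩ := exists_approx a hε
        refine ⟨fun x => f x, f.continuous.comp continuous_subtype_val, fun x => hεu ?_⟩
        rw [dist_eq_norm]
        change ‖diag a x - f x‖ < ε
        rw [← diag_ofCc f x, ← diag_sub]
        exact (norm_diag_le _ _).trans_lt hf
      zero_at_infty' := by
        rw [Metric.tendsto_nhds]
        intro ε hε
        obtain ⟨f, hf⟩ := exists_approx a hε
        have hK : IsCompact ((Subtype.val : unitSpace G → G) ⁻¹' tsupport f) :=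
          isClosed_unitSpace.isClosedEmbedding_subtypeVal.isCompact_preimage
            f.hasCompactSupport.isCompact
        filter_upwards [hK.compl_mem_cocompact] with x hx
        have h0 : f x = 0 := by
          by_contra h
          exact hx (subset_tsupport _ h)
        rw [dist_zero_right]
        have : diag a x = diag (a - ofCc f) x := by rw [diag_sub, diag_ofCc, h0, sub_zero]
        rw [this]
        exact (norm_diag_le _ _).trans_lt hf }
  map_add' a b := by ext x; rfl
  map_smul' z a := by ext x; rfl

theorem condExp_ofCc (f : C_c(G, ℂ)) (x : unitSpace G) : condExp (ofCc f) x = f x :=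
  diag_ofCc f x

theorem norm_condExp_le (a : ReducedCStarAlgebra G) : ‖condExp a‖ ≤ ‖a‖ := by
  rw [← ZeroAtInftyContinuousMap.norm_toBCF_eq_norm]
  exact (BoundedContinuousFunction.norm_le (norm_nonneg a)).2 fun x => norm_diag_le a x

theorem condExp_nonneg (a : ReducedCStarAlgebra G) (ha : 0 ≤ a) (x : unitSpace G) :
    ∃ r : ℝ, 0 ≤ r ∧ condExp a x = r := by
  classical
  obtain ⟨b, rfl⟩ := CStarAlgebra.nonneg_iff_eq_star_mul_self.1 ha
  let δ : FiberHilbert x := lp.single 2 (unitArrow x) (1 : ℂ)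
  let T := (incl b).entry x
  have h : condExp (star b * b) x = inner ℂ (T δ) (T δ) := by
    change (star T * T) δ (unitArrow x) = _
    rw [← ContinuousLinearMap.adjoint_inner_right]
    have e : ∀ η : FiberHilbert x, η (unitArrow x) = inner ℂ δ η := fun η => by
      rw [lp.inner_single_left]; simp
    rw [e]
    rfl
  exact ⟨‖T δ‖ ^ 2, by positivity, by rw [h, inner_self_eq_norm_sq_to_K]; simp⟩

/-- The map `φ_m(a) = ∫ P(a) dm` on the positive elements of `C*_r(G)`, with values in `[0,∞]`.
For `a ≥ 0` the function `P(a)` is real and non-negative, see `condExp_nonneg`. -/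
noncomputable def phi [MeasurableSpace G] (m : Measure (unitSpace G))
    (a : {a : ReducedCStarAlgebra G // 0 ≤ a}) : ℝ≥0∞ :=
  ∫⁻ x, ENNReal.ofReal (condExp (a : ReducedCStarAlgebra G) x).re ∂m

end ReducedCStarAlgebra

end Reduced

end EtaleGroupoid

end Groupoids

/-! Why the theorem holds. Write `Ψ` for the linear extension of `ψ`. The aim is to prove that `Ψ`
is given on `C_c(G)` by integrating the restriction to the unit space against a measure `m`, and
then to pass to all positive elements, where `ψ` may be infinite and is only lower semi-continuous.

Finiteness on `C_c(G)` is not part of the definition of a KMS weight. It comes from Gaussian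
averaging over the one-parameter group. Moving a line integral across the strip gives `ψ(y⋆y) ≤
e^{β²} ψ(xx⋆)` for the average `y` of `x` (`IsKMS.normSq_gaussAvg_le`). Functions on the unit space
are fixed by `σ^c`, and dense finiteness then forces `ψ` to be finite on their squares
(`IsKMS.mem_leftIdeal_of_local_unit`). As every `f` in `C_c(G)` has local units of this kind,
`C_c(G)` lies in the domain of `Ψ`.

Fixed elements also lie in the centralizer of `ψ`: a bounded holomorphic function on the strip that
is constant along each edge has the same value on both (`IsKMS.functional_mul_comm`). So `Ψ(uf) =
Ψ(fu)` for `u` on the unit space, which kills every `f` supported where range and source differ: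
locally `uf = f` and `fu = 0`. Invariance under `σ^{c₀}` kills every `f` supported off the open set
`ker c₀`, because such an `f` is a difference `σ^{c₀}_t(k) - k`. An arrow of `ker c₀` with equal
range and source is a unit by assumption, so only the restriction to the unit space survives
(`eq_restrict_unitSpace`), and the Riesz theorem supplies `m`.

For positive `a` and a cut-off `u`, density of `C_c(G)` gives `ψ(uau) = ∫ u² P(a) dm`
(`functional_conj_eq_integral`). Let `u` increase to one in the sense of an approximate unit. Lower
semi-continuity gives `ψ(a) ≤ ∫ P(a) dm`. Fatou's lemma gives the reverse once `ψ(uau) ≤ ψ(a)` is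
known (`apply_conj_le`). The latter combines the centralizer property with Cauchy–Schwarz: `ψ(uau)²
= |Ψ(au²)|² ≤ ψ(a) ψ(u²au²) ≤ ψ(a) ψ(uau)`. -/

namespace CStarWeight

variable {A : Type*} [NonUnitalCStarAlgebra A] [PartialOrder A] [StarOrderedRing A]

/-! ### The left ideal of a weight and its sesquilinear form -/

/-- The value `ψ(x⋆x)`. -/
def normSq (ψ : CStarWeight A) (x : A) : ℝ≥0∞ := ψ ⟨star x * x, star_mul_self_nonneg x⟩

variable {ψ : CStarWeight A}

theorem mem_leftIdeal_iff {x : A} : x ∈ ψ.leftIdeal ↔ ψ.normSq x < ∞ := Iff.rfl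

theorem apply_congr {a b : A} (h : a = b) (ha : 0 ≤ a) (hb : 0 ≤ b) : ψ ⟨a, ha⟩ = ψ ⟨b, hb⟩ := by
  subst h; rfl

theorem apply_smul (h : ψ.IsProper) (r : ℝ) (hr : 0 ≤ r) (a : {a : A // 0 ≤ a}) :
    ψ ⟨r • (a : A), smul_nonneg hr a.2⟩ = ENNReal.ofReal r * ψ a := by
  rcases hr.eq_or_lt with rfl | hr
  · rw [ENNReal.ofReal_zero, zero_mul, ← map_zero_of_isProper h]
    exact apply_congr (zero_smul ℝ _) _ _
  · exact ψ.map_smul' r hr a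

/-- Because `x⋆(c⋆c)x ≤ ‖c‖² x⋆x`. This is the quantitative form of `𝒩_ψ` being a left ideal. -/
theorem normSq_mul_le (h : ψ.IsProper) (c x : A) :
    ψ.normSq (c * x) ≤ ENNReal.ofReal (‖c‖ ^ 2) * ψ.normSq x := by
  rw [normSq, normSq, ← apply_smul h _ (sq_nonneg _)]
  refine ψ.mono ?_
  have := CStarAlgebra.star_left_conjugate_le_norm_smul (a := x) (b := star c * c)
    (.star_mul_self c)
  rw [CStarRing.norm_star_mul_self, ← pow_two] at this
  simpa only [star_mul, mul_assoc] using this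

theorem mul_mem_leftIdeal (h : ψ.IsProper) (c : A) {x : A} (hx : x ∈ ψ.leftIdeal) :
    c * x ∈ ψ.leftIdeal :=
  (normSq_mul_le h c x).trans_lt (ENNReal.mul_lt_top ENNReal.ofReal_lt_top hx)

/-- The reason is `a² = √a a √a ≤ ‖a‖ a`. -/
theorem mem_leftIdeal_of_lt_top (h : ψ.IsProper) {a : A} (ha : 0 ≤ a) (hfin : ψ ⟨a, ha⟩ < ∞) :
    a ∈ ψ.leftIdeal := by
  refine lt_of_le_of_lt ?_ (ENNReal.mul_lt_top (ENNReal.ofReal_lt_top (r := ‖a‖)) hfin)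
  rw [← apply_smul h _ (norm_nonneg _) ⟨a, ha⟩]
  refine ψ.mono ?_
  have hs := CFC.sqrt_mul_sqrt_self a ha
  have hsa : IsSelfAdjoint (CFC.sqrt a) := .of_nonneg (CFC.sqrt_nonneg a)
  have := CStarAlgebra.star_left_conjugate_le_norm_smul (a := CFC.sqrt a) (b := a) (.of_nonneg ha)
  rw [hsa.star_eq, hs] at this
  have e : CFC.sqrt a * a * CFC.sqrt a = star a * a := by
    rw [(IsSelfAdjoint.of_nonneg ha).star_eq]
    generalize CFC.sqrt a = b at hs
    subst hs
    simp only [mul_assoc]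
  rwa [e] at this

theorem sqrt_mem_leftIdeal {a : A} (ha : 0 ≤ a) (hfin : ψ ⟨a, ha⟩ < ∞) :
    CFC.sqrt a ∈ ψ.leftIdeal := by
  rw [mem_leftIdeal_iff, normSq]
  refine lt_of_eq_of_lt (apply_congr ?_ _ _) hfin
  rw [(IsSelfAdjoint.of_nonneg (CFC.sqrt_nonneg a)).star_eq, CFC.sqrt_mul_sqrt_self a ha]

theorem mem_defDomain_of_lt_top {a : A} (ha : 0 ≤ a) (hfin : ψ ⟨a, ha⟩ < ∞) :
    a ∈ ψ.defDomain := by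
  have hs := sqrt_mem_leftIdeal ha hfin
  rw [← CFC.sqrt_mul_sqrt_self a ha]
  refine mul_mem_defDomain ?_ hs
  rwa [(IsSelfAdjoint.of_nonneg (CFC.sqrt_nonneg a)).star_eq]

/-- A purely algebraic extension, with no continuity or positivity outside `𝒩_ψ⋆ 𝒩_ψ`. It serves to
compute with `Ψ` without carrying membership proofs inside its argument. -/
theorem exists_functional (h : ψ.IsProper) : ∃ Ψ : A →ₗ[ℂ] ℂ,
    ∀ (x : A) (hx : x ∈ ψ.defDomain), Ψ x = ψ.linearExtension h ⟨x, hx⟩ := by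
  obtain ⟨Ψ, hΨ⟩ := LinearMap.exists_extend (ψ.linearExtension h)
  exact ⟨Ψ, fun x hx => LinearMap.congr_fun hΨ ⟨x, hx⟩⟩

/-- A linear functional on all of `A` which on `𝒩_ψ⋆ 𝒩_ψ` is the linear extension of `ψ`. -/
noncomputable def functional (ψ : CStarWeight A) (h : ψ.IsProper) : A →ₗ[ℂ] ℂ :=
  (exists_functional h).choose

theorem functional_eq (h : ψ.IsProper) {x : A} (hx : x ∈ ψ.defDomain) :
    ψ.functional h x = ψ.linearExtension h ⟨x, hx⟩ :=
  (exists_functional h).choose_spec x hx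

theorem functional_of_nonneg (h : ψ.IsProper) {a : A} (ha : 0 ≤ a) (hfin : ψ ⟨a, ha⟩ < ∞) :
    ψ.functional h a = ((ψ ⟨a, ha⟩).toReal : ℂ) := by
  rw [functional_eq h (mem_defDomain_of_lt_top ha hfin)]
  exact (linearExtension_spec ψ h ⟨a, mem_defDomain_of_lt_top ha hfin⟩ ha).2

theorem functional_star_mul_self (h : ψ.IsProper) {x : A} (hx : x ∈ ψ.leftIdeal) :
    ψ.functional h (star x * x) = ((ψ.normSq x).toReal : ℂ) :=
  functional_of_nonneg h (star_mul_self_nonneg x) hx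

/-- By polarization the domain is already spanned by the squares `a⋆a`, where `Ψ` is simply the
value of `ψ`. -/
theorem defDomain_induction (h : ψ.IsProper) {P : A → Prop}
    (hsq : ∀ a ∈ ψ.leftIdeal, P (star a * a)) (zero : P 0) (add : ∀ x y, P x → P y → P (x + y))
    (smul : ∀ (z : ℂ) x, P x → P (z • x)) {x : A} (hx : x ∈ ψ.defDomain) : P x := by
  replace hx := mem_span_sq h hx
  induction hx using Submodule.span_induction with
  | mem x hx => obtain ⟨a, rfl⟩ := hx; exact hsq a a.2
  | zero => exact zero
  | add x y _ _ h1 h2 => exact add x y h1 h2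
  | smul z x _ h1 => exact smul z x h1

theorem functional_star (h : ψ.IsProper) {x : A} (hx : x ∈ ψ.defDomain) :
    ψ.functional h (star x) = star (ψ.functional h x) := by
  refine defDomain_induction h (P := fun x => ψ.functional h (star x) = star (ψ.functional h x))
    (fun a ha => ?_) (by simp) (fun x y h1 h2 => ?_) (fun z x h1 => ?_) hx
  · rw [star_mul, star_star, functional_star_mul_self h ha]; simp
  · rw [star_add, map_add, map_add, star_add, h1, h2]
  · rw [star_smul, map_smul, map_smul, h1, star_smul]

theorem normSq_map {φ : A ≃⋆ₐ[ℂ] A} (hφ : ψ.IsInvariantUnder φ) (x : A) :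
    ψ.normSq (φ x) = ψ.normSq x := by
  rw [normSq, normSq, ← hφ ⟨star x * x, _⟩]
  exact apply_congr (by rw [map_mul, map_star]) _ _

theorem functional_map (h : ψ.IsProper) {φ : A ≃⋆ₐ[ℂ] A} (hφ : ψ.IsInvariantUnder φ) {x : A}
    (hx : x ∈ ψ.defDomain) : ψ.functional h (φ x) = ψ.functional h x := by
  refine defDomain_induction h (P := fun x => ψ.functional h (φ x) = ψ.functional h x)
    (fun a ha => ?_) (by simp) (fun x y h1 h2 => ?_) (fun z x h1 => ?_) hx
  · rw [functional_star_mul_self h ha, map_mul, map_star,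
      functional_star_mul_self h (hφ.mem_leftIdeal ha), normSq_map hφ]
  · rw [map_add, map_add, map_add, h1, h2]
  · rw [map_smul, map_smul, map_smul, h1]

/-- The left ideal `𝒩_ψ` as a linear subspace. -/
def leftIdealSubmodule (ψ : CStarWeight A) (h : ψ.IsProper) : Submodule ℂ A where
  carrier := ψ.leftIdeal
  add_mem' := add_mem_leftIdeal
  zero_mem' := by
    rw [mem_leftIdeal_iff, normSq, apply_congr (b := 0) (by simp) _ le_rfl]
    exact (map_zero_of_isProper h).trans_lt ENNReal.zero_lt_top
  smul_mem' z _ hx := smul_mem_leftIdeal h z hx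

theorem functional_cauchySchwarz (h : ψ.IsProper) {a b : A} (ha : a ∈ ψ.leftIdeal)
    (hb : b ∈ ψ.leftIdeal) : ‖ψ.functional h (star a * b)‖ ^ 2 ≤
      (ψ.normSq a).toReal * (ψ.normSq b).toReal := by
  have hdom : ∀ x y : ψ.leftIdealSubmodule h, star (x : A) * y ∈ ψ.defDomain := fun x y =>
    mul_mem_defDomain (by rw [star_star]; exact x.2) y.2
  have hsymm : ∀ x y : ψ.leftIdealSubmodule h,
      star (ψ.functional h (star (y : A) * x)) = ψ.functional h (star (x : A) * y) := fun x y => by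
    rw [← functional_star h (hdom y x), star_mul, star_star]
  -- The form `(x, y) ↦ Ψ(x⋆y)` is only semi-definite, as `ψ` need not be faithful; Cauchy–Schwarz
  -- needs no more.
  let core : PreInnerProductSpace.Core ℂ (ψ.leftIdealSubmodule h) :=
    { inner := fun x y => ψ.functional h (star (x : A) * y)
      conj_inner_symm := hsymm
      re_inner_nonneg := fun x => by
        rw [functional_star_mul_self h x.2]
        simp
      add_left := fun x y z => by
        simp [add_mul]
      smul_left := fun x y r => by
        simp [smul_mul_assoc] }
  have := InnerProductSpace.Core.inner_mul_inner_self_le (𝕜 := ℂ)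
    (⟨a, ha⟩ : ψ.leftIdealSubmodule h) ⟨b, hb⟩
  change ‖ψ.functional h (star a * b)‖ * ‖ψ.functional h (star b * a)‖ ≤
    (ψ.functional h (star a * a)).re * (ψ.functional h (star b * b)).re at this
  rw [functional_star_mul_self h ha, functional_star_mul_self h hb,
    ← hsymm ⟨b, hb⟩ ⟨a, ha⟩, norm_star, ← pow_two] at this
  simpa using this

theorem norm_functional_star_mul_le (h : ψ.IsProper) {a b : A} {s t : ℝ} (hs : 0 ≤ s)
    (ht : 0 ≤ t) (ha : ψ.normSq a ≤ ENNReal.ofReal (s ^ 2))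
    (hb : ψ.normSq b ≤ ENNReal.ofReal (t ^ 2)) :
    ‖ψ.functional h (star a * b)‖ ≤ s * t := by
  refine abs_le_of_sq_le_sq' ?_ (by positivity) |>.2
  refine (functional_cauchySchwarz h (ha.trans_lt ENNReal.ofReal_lt_top)
    (hb.trans_lt ENNReal.ofReal_lt_top)).trans ?_
  rw [mul_pow]
  exact mul_le_mul (ENNReal.toReal_le_of_le_ofReal (sq_nonneg _) ha)
    (ENNReal.toReal_le_of_le_ofReal (sq_nonneg _) hb) ENNReal.toReal_nonneg (sq_nonneg _)

theorem exists_normSq_le {a : A} (ha : a ∈ ψ.leftIdeal) :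
    ∃ s : ℝ, 0 ≤ s ∧ ψ.normSq a ≤ ENNReal.ofReal (s ^ 2) := by
  refine ⟨√(ψ.normSq a).toReal, Real.sqrt_nonneg _, ?_⟩
  rw [Real.sq_sqrt ENNReal.toReal_nonneg, ENNReal.ofReal_toReal (mem_leftIdeal_iff.1 ha).ne]

theorem normSq_mul_le_ofReal (h : ψ.IsProper) (c : A) {x : A} {s C : ℝ} (hc : ‖c‖ ≤ C)
    (hx : ψ.normSq x ≤ ENNReal.ofReal (s ^ 2)) :
    ψ.normSq (c * x) ≤ ENNReal.ofReal ((C * s) ^ 2) := by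
  refine (normSq_mul_le h c x).trans ?_
  rw [mul_pow, ENNReal.ofReal_mul (sq_nonneg _)]
  gcongr

/-! ### Lower semi-continuity -/

theorem apply_le_of_tendsto (h : ψ.IsProper) {ι : Type*} {l : Filter ι} [l.NeBot] {a : ι → A}
    {b : A} (hb : 0 ≤ b) (ha : ∀ i, 0 ≤ a i) (hlim : Tendsto a l (𝓝 b)) {r : ℝ≥0∞}
    (hr : ∀ᶠ i in l, ψ ⟨a i, ha i⟩ ≤ r) : ψ ⟨b, hb⟩ ≤ r := by
  rcases eq_or_ne r ∞ with rfl | hr'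
  · exact le_top
  lift r to ℝ≥0 using hr'
  exact (h.lowerSemicontinuous r).mem_of_tendsto
    (tendsto_subtype_rng.2 hlim : Tendsto (fun i => (⟨a i, ha i⟩ : {a : A // 0 ≤ a})) l
      (𝓝 ⟨b, hb⟩)) hr

theorem normSq_le_of_tendsto (h : ψ.IsProper) {ι : Type*} {l : Filter ι} [l.NeBot] {x : ι → A}
    {y : A} (hlim : Tendsto x l (𝓝 y)) {r : ℝ≥0∞} (hr : ∀ᶠ i in l, ψ.normSq (x i) ≤ r) :
    ψ.normSq y ≤ r :=
  apply_le_of_tendsto h (star_mul_self_nonneg y) (fun i => star_mul_self_nonneg (x i))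
    (hlim.star.mul hlim) hr

/-- Every bound strictly above `‖z‖` holds eventually along the net, so lower semi-continuity passes
it to `y`. The complex limit `z` lets it be applied to values of `Ψ` computed as integrals. -/
theorem normSq_le_of_tendsto_toReal (h : ψ.IsProper) {ι : Type*} {l : Filter ι} [l.NeBot]
    {x : ι → A} {y : A} (hlim : Tendsto x l (𝓝 y)) (hx : ∀ i, x i ∈ ψ.leftIdeal) {z : ℂ}
    (hz : Tendsto (fun i => ψ.functional h (star (x i) * x i)) l (𝓝 z)) :
    ψ.normSq y ≤ ENNReal.ofReal ‖z‖ := by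
  refine le_of_forall_gt fun r hr => ?_
  obtain ⟨q, hq1, hq2⟩ := exists_between hr
  refine lt_of_le_of_lt (normSq_le_of_tendsto h hlim (r := q) ?_) hq2
  have hz' : Tendsto (fun i => ENNReal.ofReal ‖ψ.functional h (star (x i) * x i)‖) l
      (𝓝 (ENNReal.ofReal ‖z‖)) := (ENNReal.continuous_ofReal.tendsto _).comp hz.norm
  filter_upwards [hz'.eventually (eventually_lt_nhds hq1)] with i hi
  rw [functional_star_mul_self h (hx i), Complex.norm_real, Real.norm_of_nonneg
    ENNReal.toReal_nonneg, ENNReal.ofReal_toReal (mem_leftIdeal_iff.1 (hx i)).ne] at hi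
  exact hi.le

end CStarWeight

namespace CStarWeight

/-! ### Bounded holomorphic functions on a strip -/

theorem norm_cexp_neg_sq (x y : ℝ) :
    ‖Complex.exp (-((x : ℂ) + y * Complex.I) ^ 2)‖ = Real.exp (y ^ 2) * Real.exp (-x ^ 2) := by
  rw [Complex.norm_exp, ← Real.exp_add]
  congr 1
  simp [pow_two, sub_eq_add_neg]

theorem mem_kmsStrip {β y : ℝ} (hy : y ∈ uIcc 0 β) (x : ℝ) :
    (x : ℂ) + y * Complex.I ∈ kmsStrip β := by
  simpa [kmsStrip] using hy

/-- Cauchy's theorem for the product of a Gaussian and a bounded function that is continuous on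
the closed strip and holomorphic in its interior: the line of integration may be moved from one
edge of the strip to the other. -/
theorem integral_gaussian_mul_strip {β : ℝ} {F : ℂ → ℂ} (hc : ContinuousOn F (kmsStrip β))
    (hb : ∃ C : ℝ, ∀ z ∈ kmsStrip β, ‖F z‖ ≤ C)
    (hd : DifferentiableOn ℂ F (interior (kmsStrip β))) (t : ℝ) :
    ∫ s : ℝ, Complex.exp (-((s : ℂ) + t) ^ 2) * F (s + Complex.I * β) =
      ∫ s : ℝ, Complex.exp (-((s : ℂ) + t - Complex.I * β) ^ 2) * F s := by
  obtain ⟨C, hC⟩ := hb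
  -- Centred so that on the edge `Im z = β` it is the real Gaussian `exp(-(s+t)²)`. Its decay is
  -- what makes the merely bounded `F` integrable along horizontal lines.
  let k : ℂ → ℂ := fun z => Complex.exp (-(z + t - Complex.I * β) ^ 2)
  let H : ℂ → ℂ := fun z => k z * F z
  have hk : ∀ x y : ℝ, ‖k (x + y * Complex.I)‖ =
      Real.exp ((y - β) ^ 2) * Real.exp (-(x + t) ^ 2) := fun x y => by
    rw [← norm_cexp_neg_sq]
    simp only [k]
    congr 3
    push_cast
    ring
  have hkd : Differentiable ℂ k := by
    simp only [k]; fun_prop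
  have hsq : ∀ y ∈ uIcc 0 β, (y - β) ^ 2 ≤ β ^ 2 := fun y hy => by
    have : |y - β| ≤ |β - 0| := by
      rw [abs_sub_comm]; exact Set.abs_sub_right_of_mem_uIcc hy
    rw [sub_zero] at this
    exact sq_le_sq.2 this
  have hH : ∀ x : ℝ, ∀ y ∈ uIcc 0 β, ‖H (x + y * Complex.I)‖ ≤
      Real.exp (β ^ 2) * Real.exp (-(x + t) ^ 2) * C := fun x y hy => by
    rw [norm_mul, hk]
    have := hsq y hy
    have := hC _ (mem_kmsStrip hy x)
    gcongr
  have hHc : ContinuousOn H (kmsStrip β) := hkd.continuous.continuousOn.mul hc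
  have hgauss : Integrable fun x : ℝ => Real.exp (-(x + t) ^ 2) := by
    have := (integrable_exp_neg_mul_sq one_pos).comp_add_right t
    simpa using this
  have hint : ∀ y ∈ uIcc 0 β, Integrable fun x : ℝ => H (x + y * Complex.I) := fun y hy => by
    refine Integrable.mono' ((hgauss.const_mul _).mul_const C) ?_
      (Eventually.of_forall fun x => hH x y hy)
    exact (hHc.comp_continuous (by fun_prop) (mem_kmsStrip hy)).aestronglyMeasurable
  -- The vertical sides of the rectangle have fixed length `|β|` and carry an integrand that decays
  -- like the Gaussian, so they disappear in the limit.
  have hside : ∀ u : ℝ → ℝ, Tendsto (fun R => Real.exp (-(u R + t) ^ 2)) atTop (𝓝 0) →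
      Tendsto (fun R => ∫ y in (0 : ℝ)..β, H (u R + y * Complex.I)) atTop (𝓝 0) := by
    intro u hu
    have h1 : Tendsto (fun R => Real.exp (β ^ 2) * Real.exp (-(u R + t) ^ 2) * C * |β - 0|) atTop
        (𝓝 0) := by
      simpa using ((hu.const_mul (Real.exp (β ^ 2))).mul_const C).mul_const |β - 0|
    refine squeeze_zero_norm (fun R => ?_) h1
    exact intervalIntegral.norm_integral_le_of_norm_le_const fun y hy =>
      hH _ y (uIoc_subset_uIcc hy)
  have hsq_top : ∀ u : ℝ → ℝ, Tendsto (fun R => |u R|) atTop atTop →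
      Tendsto (fun R => Real.exp (-(u R) ^ 2)) atTop (𝓝 0) := fun u hu => by
    refine Real.tendsto_exp_neg_atTop_nhds_zero.comp ?_
    have := (tendsto_pow_atTop (α := ℝ) two_ne_zero).comp hu
    simpa [Function.comp_def, sq_abs] using this
  have s1 := hside (fun R => R) (hsq_top _ (tendsto_abs_atTop_atTop.comp
    (tendsto_atTop_add_const_right _ t tendsto_id)))
  have s2 := hside (fun R => -R) (hsq_top _ (tendsto_abs_atBot_atTop.comp
    (tendsto_atBot_add_const_right _ t tendsto_neg_atTop_atBot)))
  have i1 := intervalIntegral_tendsto_integral (hint 0 left_mem_uIcc) tendsto_neg_atTop_atBot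
    tendsto_id
  have i2 := intervalIntegral_tendsto_integral (hint β right_mem_uIcc) tendsto_neg_atTop_atBot
    tendsto_id
  -- Cauchy's theorem for the rectangle with opposite corners `-R` and `R + iβ`; the unordered
  -- intervals cover `β < 0` and `β = 0` as well.
  have hrect : ∀ R : ℝ, ((∫ x in (-R)..R, H (x + (0 : ℝ) * Complex.I)) -
      ∫ x in (-R)..R, H (x + β * Complex.I)) +
      Complex.I • (∫ y in (0 : ℝ)..β, H (R + y * Complex.I)) -
      Complex.I • (∫ y in (0 : ℝ)..β, H ((-R : ℝ) + y * Complex.I)) = 0 := fun R => by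
    have hsub : ∀ z : ℂ, z.im ∈ Ioo (min 0 β) (max 0 β) → z ∈ interior (kmsStrip β) := by
      intro z hz
      refine mem_interior.2 ⟨Complex.im ⁻¹' Ioo (min 0 β) (max 0 β), fun w hw => ?_,
        isOpen_Ioo.preimage Complex.continuous_im, hz⟩
      exact Ioo_subset_Icc_self hw
    exact Complex.integral_boundary_rect_eq_zero_of_continuousOn_of_differentiableOn H
      ⟨-R, 0⟩ ⟨R, β⟩ (hHc.mono fun z hz => hz.2)
      (hkd.differentiableOn.mul (hd.mono fun z hz => hsub z hz.2))
  have hlim := ((i1.sub i2).add (s1.const_smul Complex.I)).sub (s2.const_smul Complex.I)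
  have h0 := tendsto_nhds_unique (hlim.congr hrect) tendsto_const_nhds
  rw [smul_zero, add_zero, sub_zero, sub_eq_zero] at h0
  have e1 : ∀ s : ℝ, Complex.exp (-((s : ℂ) + t) ^ 2) * F (s + Complex.I * β) =
      H (s + β * Complex.I) := fun s => by
    simp only [H, k]
    congr 3 <;> ring
  have e2 : ∀ s : ℝ, Complex.exp (-((s : ℂ) + t - Complex.I * β) ^ 2) * F s =
      H (s + (0 : ℝ) * Complex.I) := fun s => by
    simp [H, k]
  simp_rw [e1, e2]
  exact h0.symm

/-- The imaginary shift multiplies the modulus by `e^{β²}`, which is where the constant in the KMS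
estimate comes from. The bound is uniform in `t`. -/
theorem integral_norm_gaussian_shift (t β : ℝ) :
    ∫ s : ℝ, ‖Complex.exp (-((s : ℂ) + t - Complex.I * β) ^ 2)‖ =
      √Real.pi * Real.exp (β ^ 2) := by
  have : ∀ s : ℝ, ‖Complex.exp (-((s : ℂ) + t - Complex.I * β) ^ 2)‖ =
      Real.exp (β ^ 2) * Real.exp (-1 * (s + t) ^ 2) := fun s => by
    have := norm_cexp_neg_sq (s + t) (-β)
    rw [neg_sq, ← neg_one_mul ((s + t) ^ 2)] at this
    rw [← this]
    congr 3
    push_cast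
    ring
  simp_rw [this]
  rw [integral_const_mul, integral_add_right_eq_self (fun s => Real.exp (-1 * s ^ 2)) t,
    integral_gaussian, div_one, mul_comm]

/-- A bound for the Gaussian average along one edge of a strip, in terms of the other edge. -/
theorem norm_integral_gaussian_strip_le {β : ℝ} {F : ℂ → ℂ} (hc : ContinuousOn F (kmsStrip β))
    (hb : ∃ C : ℝ, ∀ z ∈ kmsStrip β, ‖F z‖ ≤ C)
    (hd : DifferentiableOn ℂ F (interior (kmsStrip β))) (t : ℝ) {M : ℝ}
    (hM : ∀ s : ℝ, ‖F s‖ ≤ M) :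
    ‖∫ s : ℝ, Complex.exp (-((s : ℂ) + t) ^ 2) * F (s + Complex.I * β)‖ ≤
      √Real.pi * Real.exp (β ^ 2) * M := by
  rw [integral_gaussian_mul_strip hc hb hd, ← integral_norm_gaussian_shift t β,
    ← integral_mul_const]
  refine norm_integral_le_of_norm_le (Integrable.mul_const ?_ M)
    (Eventually.of_forall fun s => ?_)
  -- A non-integrable function has integral zero by convention, so the positive value just computed
  -- proves integrability.
  · refine Integrable.of_integral_ne_zero ?_
    rw [integral_norm_gaussian_shift]
    positivity
  · rw [norm_mul]
    exact mul_le_mul_of_nonneg_left (hM s) (norm_nonneg _)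

/-- A bounded holomorphic function on a strip that is constant along each of the two edges takes
the same value on both. -/
theorem strip_const_eq {β : ℝ} {F : ℂ → ℂ} (hc : ContinuousOn F (kmsStrip β))
    (hb : ∃ C : ℝ, ∀ z ∈ kmsStrip β, ‖F z‖ ≤ C)
    (hd : DifferentiableOn ℂ F (interior (kmsStrip β))) {v w : ℂ}
    (hv : ∀ s : ℝ, F s = v) (hw : ∀ s : ℝ, F (s + Complex.I * β) = w) : v = w := by
  have h1 := integral_gaussian_mul_strip hc hb hd 0
  -- Comparison with the constant function identifies the two Gaussian integrals; their common value
  -- is non-zero and cancels.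
  have h2 := integral_gaussian_mul_strip (β := β) (F := fun _ => 1) continuousOn_const
    ⟨1, by simp⟩ (differentiableOn_const _) 0
  simp only [hv, hw, mul_one, integral_mul_const, Complex.ofReal_zero, add_zero] at h1 h2
  rw [← h2] at h1
  refine (mul_left_cancel₀ ?_ h1).symm
  have : ∀ s : ℝ, Complex.exp (-(s : ℂ) ^ 2) = ((Real.exp (-1 * s ^ 2) : ℝ) : ℂ) := fun s => by
    push_cast; ring_nf
  simp_rw [this]
  rw [integral_complex_ofReal, integral_gaussian]
  simp
  positivity

end CStarWeight

/-! ### Gaussian averages over a one-parameter group -/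

namespace OneParameterGroup

variable {A : Type*} [NonUnitalCStarAlgebra A]

/-- The normal distribution on the line with density proportional to `exp(-s²)`. -/
noncomputable def gaussMeasure : Measure ℝ := ProbabilityTheory.gaussianReal 0 (1 / 2)

instance : IsProbabilityMeasure gaussMeasure := by
  unfold gaussMeasure; infer_instance

theorem integral_gaussMeasure (f : ℝ → ℂ) :
    ∫ s, f s ∂gaussMeasure = (√Real.pi : ℂ)⁻¹ * ∫ s : ℝ, Complex.exp (-(s : ℂ) ^ 2) * f s := by
  rw [gaussMeasure, ProbabilityTheory.integral_gaussianReal_eq_integral_smul (by norm_num),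
    ← integral_const_mul]
  refine integral_congr_ae (Eventually.of_forall fun s => ?_)
  simp only [ProbabilityTheory.gaussianPDFReal]
  rw [show 2 * Real.pi * ((1 / 2 : ℝ≥0) : ℝ) = Real.pi by push_cast; ring,
    show -(s - 0) ^ 2 / (2 * ((1 / 2 : ℝ≥0) : ℝ)) = -s ^ 2 by push_cast; ring,
    ← Complex.coe_smul, smul_eq_mul]
  push_cast
  ring

theorem norm_apply (α : OneParameterGroup A) (t : ℝ) (a : A) : ‖α t a‖ = ‖a‖ :=
  NonUnitalStarAlgHom.norm_map (α t) (α t).injective a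

theorem integrable_apply (α : OneParameterGroup A) (a : A) :
    Integrable (fun s => α s a) gaussMeasure :=
  (integrable_const ‖a‖).mono' (α.continuous' a).aestronglyMeasurable
    (Eventually.of_forall fun s => (α.norm_apply s a).le)

/-- The average of `s ↦ α_s(a)` for the Gaussian measure. -/
noncomputable def gaussAvg (α : OneParameterGroup A) (a : A) : A := ∫ s, α s a ∂gaussMeasure

theorem gaussAvg_sub (α : OneParameterGroup A) (a b : A) :
    α.gaussAvg (a - b) = α.gaussAvg a - α.gaussAvg b := by
  simp only [gaussAvg, map_sub]
  exact integral_sub (α.integrable_apply a) (α.integrable_apply b)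

theorem norm_gaussAvg_le (α : OneParameterGroup A) (a : A) : ‖α.gaussAvg a‖ ≤ ‖a‖ := by
  have := norm_integral_le_of_norm_le_const (μ := gaussMeasure) (f := fun s => α s a) (C := ‖a‖)
    (Eventually.of_forall fun s => (α.norm_apply s a).le)
  simpa [gaussAvg] using this

theorem tendsto_gaussAvg (α : OneParameterGroup A) {ι : Type*} {l : Filter ι} {x : ι → A} {y : A}
    (h : Tendsto x l (𝓝 y)) : Tendsto (fun i => α.gaussAvg (x i)) l (𝓝 (α.gaussAvg y)) := by
  rw [tendsto_iff_norm_sub_tendsto_zero] at h ⊢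
  refine squeeze_zero (fun _ => norm_nonneg _) (fun i => ?_) h
  rw [← gaussAvg_sub]
  exact α.norm_gaussAvg_le _

theorem gaussAvg_of_fixed (α : OneParameterGroup A) {a : A} (h : ∀ t, α t a = a) :
    α.gaussAvg a = a := by
  simp [gaussAvg, h]

/-- A fixed factor comes out of the integral, since right multiplication by it is continuous and
linear. -/
theorem gaussAvg_mul_of_fixed (α : OneParameterGroup A) (a : A) {g : A} (h : ∀ t, α t g = g) :
    α.gaussAvg (a * g) = α.gaussAvg a * g := by
  simp only [gaussAvg, map_mul, h]
  exact ((ContinuousLinearMap.mul ℂ A).flip g).integral_comp_comm (α.integrable_apply a)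

end OneParameterGroup

/-- Turns an average into a finite combination, to which the possibly discontinuous `Ψ` can be
applied term by term. -/
theorem MeasureTheory.SimpleFunc.integral_comp_eq_sum {E : Type*} [NormedAddCommGroup E]
    [NormedSpace ℝ E] [CompleteSpace E] (s : SimpleFunc ℝ ℝ) (g : ℝ → E) (μ : Measure ℝ)
    [IsFiniteMeasure μ] :
    ∫ t, g (s t) ∂μ = ∑ r ∈ s.range, μ.real (s ⁻¹' {r}) • g r := by
  classical
  have h : ∀ t, g (s t) = ∑ r ∈ s.range, (s ⁻¹' {r}).indicator (fun _ => g r) t := fun t => by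
    simp only [indicator, mem_preimage, mem_singleton_iff]
    rw [Finset.sum_ite_eq, if_pos (s.mem_range_self t)]
  simp_rw [h]
  rw [integral_finsetSum]
  · exact Finset.sum_congr rfl fun r _ => integral_indicator_const _ (s.measurableSet_fiber r)
  · exact fun r _ => (integrable_const _).indicator (s.measurableSet_fiber r)

/-! ### Consequences of the KMS condition: centralizer, smoothing estimate, finiteness -/

namespace CStarWeight

open OneParameterGroup

variable {A : Type*} [NonUnitalCStarAlgebra A] [PartialOrder A] [StarOrderedRing A]
  {ψ : CStarWeight A} {α : OneParameterGroup A} {β : ℝ}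

/-- The function in the KMS condition, in terms of the functional `Ψ`. -/
theorem IsKMS.exists_strip (hK : ψ.IsKMS α β) {a b : A} (ha : a ∈ ψ.leftIdeal)
    (ha' : star a ∈ ψ.leftIdeal) (hb : b ∈ ψ.leftIdeal) (hb' : star b ∈ ψ.leftIdeal) :
    ∃ F : ℂ → ℂ, ContinuousOn F (kmsStrip β) ∧ (∃ C : ℝ, ∀ z ∈ kmsStrip β, ‖F z‖ ≤ C) ∧
      DifferentiableOn ℂ F (interior (kmsStrip β)) ∧
      (∀ t : ℝ, F t = ψ.functional hK.proper (a * α t b)) ∧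
      ∀ t : ℝ, F (t + Complex.I * β) = ψ.functional hK.proper (α t b * a) := by
  obtain ⟨F, h1, h2, h3, h4⟩ := hK.kms a b ha ha' hb hb'
  exact ⟨F, h1, h2, h3, fun t => by rw [(h4 t).1, functional_eq],
    fun t => by rw [(h4 t).2, functional_eq]⟩

/-- Elements fixed by the one-parameter group are in the centralizer of a KMS weight. -/
theorem IsKMS.functional_mul_comm (hK : ψ.IsKMS α β) {a d : A} (ha : a ∈ ψ.leftIdeal)
    (ha' : star a ∈ ψ.leftIdeal) (hd : d ∈ ψ.leftIdeal) (hd' : star d ∈ ψ.leftIdeal)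
    (hfix : ∀ t, α t d = d) :
    ψ.functional hK.proper (a * d) = ψ.functional hK.proper (d * a) := by
  obtain ⟨F, h1, h2, h3, h4, h5⟩ := hK.exists_strip ha ha' hd hd'
  exact strip_const_eq h1 h2 h3 (fun s => by rw [h4, hfix]) (fun s => by rw [h5, hfix])

/-- `ψ(y⋆y) ≤ e^{β²} ψ(xx⋆)` for the Gaussian average `y` of `x`. -/
theorem IsKMS.normSq_gaussAvg_le (hK : ψ.IsKMS α β) {x : A} (hx : x ∈ ψ.leftIdeal) {s : ℝ}
    (hs : 0 ≤ s) (hx' : ψ.normSq (star x) ≤ ENNReal.ofReal (s ^ 2)) :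
    ψ.normSq (α.gaussAvg x) ≤ ENNReal.ofReal (Real.exp (β ^ 2) * s ^ 2) := by
  have hP := hK.proper
  have hxs : star x ∈ ψ.leftIdeal := hx'.trans_lt ENNReal.ofReal_lt_top
  -- For the pair `(x, x⋆)` one edge carries `Ψ(x α_t(x⋆))`, which Cauchy–Schwarz bounds by `s²`,
  -- while the other carries `Ψ(α_t(x⋆) x)`, the coefficients of the quantity to be estimated.
  obtain ⟨F, hF1, hF2, hF3, hF4, hF5⟩ := hK.exists_strip hx hxs hxs (by rwa [star_star])
  have hbound : ∀ t : ℝ, ‖F t‖ ≤ s * s := fun t => by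
    rw [hF4]
    have := norm_functional_star_mul_le hP hs hs hx'
      (b := α t (star x)) (by rwa [normSq_map (hK.invariant t)])
    rwa [star_star] at this
  obtain ⟨C, hC⟩ := hF2
  let E : ℝ → ℂ := fun t => F (t + Complex.I * β)
  have hmem : ∀ t : ℝ, (t : ℂ) + Complex.I * β ∈ kmsStrip β := fun t => by simp [kmsStrip]
  have hE : Continuous E := hF1.comp_continuous (by fun_prop) hmem
  have hEC : ∀ t, ‖E t‖ ≤ C := fun t => hC _ (hmem t)
  have hcoef : ∀ r q : ℝ, ψ.functional hP (star (α r x) * α q x) = E (r - q) := fun r q => by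
    have hdom : α (r - q) (star x) * x ∈ ψ.defDomain := mul_mem_defDomain
      (by rw [← map_star, star_star]; exact (hK.invariant _).mem_leftIdeal hx) hx
    have h1 : α q (α (r - q) (star x) * x) = star (α r x) * α q x := by
      rw [map_mul, ← α.map_add', add_sub_cancel, map_star]
    rw [← h1, functional_map hP (hK.invariant q) hdom]
    exact (hF5 _).symm
  -- `Ψ` cannot be moved through the integral defining the average. Instead the parameter is
  -- discretized: the finite sums `Y n` lie in `𝒩_ψ`, converge in norm to the average, and have
  -- `Ψ(Yₙ⋆Yₙ)` equal to a double integral of `E` that converges by dominated convergence.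
  let u : ℕ → SimpleFunc ℝ ℝ := (stronglyMeasurable_id (α := ℝ)).approx
  have hu : ∀ t, Tendsto (fun n => u n t) atTop (𝓝 t) :=
    fun t => stronglyMeasurable_id.tendsto_approx t
  let Y : ℕ → A := fun n => ∫ t, α (u n t) x ∂gaussMeasure
  have hYsum : ∀ n, Y n = ∑ r ∈ (u n).range, gaussMeasure.real (u n ⁻¹' {r}) • α r x :=
    fun n => (u n).integral_comp_eq_sum (fun t => α t x) gaussMeasure
  have hsm : ∀ n, StronglyMeasurable (u n) := fun n => (u n).stronglyMeasurable
  have hYlim : Tendsto Y atTop (𝓝 (α.gaussAvg x)) :=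
    tendsto_integral_of_dominated_convergence (fun _ => ‖x‖)
      (fun n => ((α.continuous' x).comp_stronglyMeasurable (hsm n)).aestronglyMeasurable)
      (integrable_const _) (fun n => Eventually.of_forall fun t => (α.norm_apply _ x).le)
      (Eventually.of_forall fun t => ((α.continuous' x).tendsto t).comp (hu t))
  have hYmem : ∀ n, Y n ∈ ψ.leftIdeal := fun n => by
    rw [hYsum]
    refine (ψ.leftIdealSubmodule hP).sum_mem fun r _ => ?_
    rw [← Complex.coe_smul]
    exact (ψ.leftIdealSubmodule hP).smul_mem _ ((hK.invariant r).mem_leftIdeal hx)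
  have hYval : ∀ n, ψ.functional hP (star (Y n) * Y n) =
      ∫ t, ∫ r, E (u n r - u n t) ∂gaussMeasure ∂gaussMeasure := fun n => by
    rw [(u n).integral_comp_eq_sum (fun q => ∫ r, E (u n r - q) ∂gaussMeasure)]
    have : ∀ q, ∫ r, E (u n r - q) ∂gaussMeasure =
        ∑ r ∈ (u n).range, gaussMeasure.real (u n ⁻¹' {r}) • E (r - q) := fun q =>
      (u n).integral_comp_eq_sum (fun r => E (r - q)) gaussMeasure
    simp_rw [this]
    rw [hYsum, star_sum, Finset.sum_mul_sum, Finset.sum_comm, map_sum]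
    refine Finset.sum_congr rfl fun q _ => ?_
    rw [map_sum, Finset.smul_sum]
    refine Finset.sum_congr rfl fun r _ => ?_
    rw [← hcoef, ← Complex.coe_smul, ← Complex.coe_smul, ← Complex.coe_smul, ← Complex.coe_smul,
      star_smul, smul_mul_smul_comm, map_smul, smul_smul, mul_comm]
    simp
  have hinner : ∀ t, Tendsto (fun n => ∫ r, E (u n r - u n t) ∂gaussMeasure) atTop
      (𝓝 (∫ r, E (r - t) ∂gaussMeasure)) := fun t =>
    tendsto_integral_of_dominated_convergence (fun _ => C)
      (fun n => (hE.comp_stronglyMeasurable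
        ((hsm n).sub stronglyMeasurable_const)).aestronglyMeasurable)
      (integrable_const _) (fun n => Eventually.of_forall fun r => hEC _)
      (Eventually.of_forall fun r => (hE.tendsto _).comp ((hu r).sub (hu t)))
  have hnorm : ∀ g : ℝ → ℂ, ∀ D : ℝ, (∀ t, ‖g t‖ ≤ D) → ‖∫ t, g t ∂gaussMeasure‖ ≤ D :=
    fun g D hg => by
      simpa using norm_integral_le_of_norm_le_const (μ := gaussMeasure) (Eventually.of_forall hg)
  have houter : Tendsto (fun n => ψ.functional hP (star (Y n) * Y n)) atTop
      (𝓝 (∫ t, ∫ r, E (r - t) ∂gaussMeasure ∂gaussMeasure)) := by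
    simp_rw [hYval]
    refine tendsto_integral_of_dominated_convergence (fun _ => C) (fun n => ?_)
      (integrable_const _) (fun n => Eventually.of_forall fun t => hnorm _ _ fun r => hEC _)
      (Eventually.of_forall hinner)
    exact (((u n).map fun q => ∫ r, E (u n r - q) ∂gaussMeasure).stronglyMeasurable
      ).aestronglyMeasurable
  refine (normSq_le_of_tendsto_toReal hP hYlim hYmem houter).trans (ENNReal.ofReal_le_ofReal ?_)
  refine hnorm _ _ fun t => ?_
  -- Translating the inner variable by `t` puts the shift into the Gaussian. The strip estimate then
  -- applies with a bound independent of `t`, and `√π` cancels against the normalization.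
  rw [integral_gaussMeasure, norm_mul, ← integral_add_right_eq_self _ t]
  have hb := norm_integral_gaussian_strip_le hF1 ⟨C, hC⟩ hF3 t hbound
  have hpi : (0 : ℝ) < √Real.pi := Real.sqrt_pos.2 Real.pi_pos
  simp only [E, add_sub_cancel_right, Complex.ofReal_add]
  rw [norm_inv, Complex.norm_real, Real.norm_of_nonneg hpi.le, inv_mul_le_iff₀ hpi]
  refine hb.trans_eq ?_
  ring

/-- A KMS weight is finite on the squares of those fixed elements that have a local unit among
the fixed elements. -/
theorem IsKMS.mem_leftIdeal_of_local_unit (hK : ψ.IsKMS α β) {g h : A} (hg : IsSelfAdjoint g)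
    (hh : 0 ≤ h) (hgfix : ∀ t, α t g = g) (hhfix : ∀ t, α t h = h) (hgh : g * h = g)
    (hhg : h * g = g) : g ∈ ψ.leftIdeal := by
  have hP := hK.proper
  -- Positive elements of finite weight approximate the local unit `h`, although `ψ(h)` itself may
  -- be infinite.
  obtain ⟨b, hbfin, hblim⟩ := mem_closure_iff_seq_limit.1 (hP.dense ⟨h, hh⟩)
  have hblim' : Tendsto (fun n => (b n : A)) atTop (𝓝 h) :=
    (continuous_subtype_val.tendsto _).comp hblim
  have hbmem : ∀ n, (b n : A) ∈ ψ.leftIdeal := fun n => mem_leftIdeal_of_lt_top hP _ (hbfin n)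
  have hbsa : ∀ n, star (b n : A) = b n := fun n => (IsSelfAdjoint.of_nonneg (b n).2).star_eq
  -- Averaging is contractive and fixes `h`, so the averages still tend to `h`. Any constant below
  -- one would do here.
  have hclose : ∀ᶠ n in atTop, ‖h * h - star (α.gaussAvg (b n)) * α.gaussAvg (b n)‖ ≤ 1 / 2 := by
    have h1 := α.tendsto_gaussAvg hblim'
    rw [α.gaussAvg_of_fixed hhfix] at h1
    have h2 := (h1.star.mul h1).const_sub (h * h) |>.norm
    rw [(IsSelfAdjoint.of_nonneg hh).star_eq, sub_self, norm_zero] at h2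
    exact (h2.eventually (eventually_lt_nhds (by norm_num : (0 : ℝ) < 1 / 2))).mono
      fun n hn => hn.le
  obtain ⟨N, hN⟩ := hclose.exists
  obtain ⟨s, hs0, hs⟩ := exists_normSq_le (hbmem N)
  -- The right factor `b n` puts `x n` in `𝒩_ψ`. The adjoint is `(b n * g) * b N`, so `ψ(xₙxₙ⋆)` is
  -- controlled by `ψ(b_N²)` uniformly in `n`, while `x n` tends to `b N * g * h = b N * g`.
  let x : ℕ → A := fun n => b N * g * b n
  have hxmem : ∀ n, x n ∈ ψ.leftIdeal := fun n => mul_mem_leftIdeal hP _ (hbmem n)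
  have hxlim : Tendsto x atTop (𝓝 (b N * g)) := by
    have := hblim'.const_mul ((b N : A) * g)
    rwa [mul_assoc, hgh] at this
  have hxstar : ∀ n, star (x n) = (b n * g) * b N := fun n => by
    simp only [x, star_mul, hbsa, hg.star_eq, mul_assoc]
  have hnb : ∀ᶠ n in atTop, ‖(b n : A) * g‖ ≤ ‖g‖ + 1 := by
    have h1 := (hblim'.mul_const g).norm
    rw [hhg] at h1
    exact (h1.eventually (eventually_lt_nhds (lt_add_one _))).mono fun n hn => hn.le
  -- The smoothing estimate bounds the averages of the `x n` uniformly, and lower semi-continuity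
  -- carries the bound to the average of `b N * g`.
  have hS : α.gaussAvg (b N) * g ∈ ψ.leftIdeal := by
    have h1 := α.tendsto_gaussAvg hxlim
    rw [α.gaussAvg_mul_of_fixed _ hgfix] at h1
    refine (normSq_le_of_tendsto hP h1
      (r := ENNReal.ofReal (Real.exp (β ^ 2) * ((‖g‖ + 1) * s) ^ 2)) ?_).trans_lt
      ENNReal.ofReal_lt_top
    filter_upwards [hnb] with n hn
    refine hK.normSq_gaussAvg_le (hxmem n) (by positivity) ?_
    rw [hxstar]
    exact normSq_mul_le_ofReal hP _ hn hs
  set S := α.gaussAvg (b N : A)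
  -- Since `gh = g = hg`, conjugating `h² - S⋆S`, of norm at most `1/2`, by `g` gives `g² -
  -- (Sg)⋆(Sg) ≤ g²/2`.
  have hle : star g * g ≤ (2 : ℝ) • (star (S * g) * (S * g)) := by
    have hsa : IsSelfAdjoint (h * h - star S * S) :=
      ((IsSelfAdjoint.of_nonneg hh).commute_iff (.of_nonneg hh) |>.1 (Commute.refl h)).sub
        (.star_mul_self S)
    have h1 := CStarAlgebra.star_left_conjugate_le_norm_smul (a := g) (b := h * h - star S * S) hsa
    have h2 : ‖h * h - star S * S‖ • (star g * g) ≤ (1 / 2 : ℝ) • (star g * g) :=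
      smul_le_smul_of_nonneg_right hN (star_mul_self_nonneg g)
    have h3 : star g * (h * h - star S * S) * g = star g * g - star (S * g) * (S * g) := by
      rw [hg.star_eq, star_mul, hg.star_eq, mul_sub, sub_mul, ← mul_assoc, hgh, mul_assoc g h g,
        hhg]
      simp only [mul_assoc]
    rw [h3] at h1
    have h4 := smul_le_smul_of_nonneg_left (h1.trans h2) (zero_le_two (α := ℝ))
    rwa [smul_smul, smul_sub, show (2 : ℝ) * (1 / 2) = 1 by norm_num, one_smul,
      two_smul ℝ (star g * g), sub_le_iff_le_add, add_le_add_iff_left] at h4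
  rw [mem_leftIdeal_iff, normSq]
  refine lt_of_le_of_lt (ψ.mono hle (b := ⟨_, smul_nonneg zero_le_two (star_mul_self_nonneg _)⟩)) ?_
  rw [apply_smul hP 2 zero_le_two ⟨_, star_mul_self_nonneg (S * g)⟩]
  exact ENNReal.mul_lt_top ENNReal.ofReal_lt_top hS

end CStarWeight

namespace EtaleGroupoid

variable {G : Type*} [TopologicalSpace G] [EtaleGroupoid G]

/-! ### Functions supported on the unit space -/

theorem range_mem_unitSpace (g : G) : range g ∈ unitSpace G := range_range g

theorem source_mem_unitSpace (g : G) : source g ∈ unitSpace G := range_source g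

/-- For `g` near a unit, `g` and `range g` lie in a common set on which the range map is injective;
both have range `range g`, so they coincide. -/
theorem isOpen_unitSpace : IsOpen (unitSpace G) := by
  refine isOpen_iff_mem_nhds.2 fun x hx => ?_
  obtain ⟨V, hV, hxV, hr, -⟩ := exists_bisection x
  have h1 : ∀ᶠ g in 𝓝 x, range g ∈ V :=
    continuous_range.continuousAt.eventually (hV.mem_nhds (by rwa [show range x = x from hx]))
  filter_upwards [h1, hV.mem_nhds hxV] with g h2 h3
  exact hr h2 h3 (range_range g)

theorem inv_unit {x : G} (hx : x ∈ unitSpace G) : inv x = x := by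
  have hx' : range x = x := hx
  have h := range_mul_self (inv x)
  rw [range_inv, source_unit hx'] at h
  rw [← h, mul_inv, hx']

theorem inv_mem_unitSpace {g : G} : inv g ∈ unitSpace G ↔ g ∈ unitSpace G := by
  refine ⟨fun h => ?_, fun h => by rwa [inv_unit h]⟩
  have := inv_unit h
  rw [inv_inv] at this
  rwa [this]

theorem RealHom.map_unit (c : RealHom G) {x : G} (hx : x ∈ unitSpace G) : c x = 0 := by
  have hx' : range x = x := hx
  have h := c.map_mul' x x ((source_unit hx').trans hx'.symm)
  have h1 := range_mul_self x
  rw [hx'] at h1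
  rw [h1] at h
  linarith

theorem convFun_of_left_diag {d f : G → ℂ} (hd : ∀ g, g ∉ unitSpace G → d g = 0) (g : G) :
    convFun d f g = d (range g) * f g := by
  unfold convFun
  rw [tsum_eq_single (⟨range g, range_range g⟩ : {h : G // range h = range g})]
  · simp only
    rw [inv_unit (range_mem_unitSpace g), range_mul_self]
  · intro h hne
    by_cases hh : (h : G) ∈ unitSpace G
    · exact absurd (Subtype.ext (hh.symm.trans h.2)) hne
    · rw [hd _ hh, zero_mul]

/-- If `h⁻¹g` is a unit then `h = g`, so a single term survives. Left and right multiplication thus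
see the range and the source respectively, and commutators detect their difference. -/
theorem convFun_of_right_diag {d f : G → ℂ} (hd : ∀ g, g ∉ unitSpace G → d g = 0) (g : G) :
    convFun f d g = f g * d (source g) := by
  unfold convFun
  rw [tsum_eq_single (⟨g, rfl⟩ : {h : G // range h = range g})]
  · simp only
    rw [inv_mul]
  · intro h hne
    by_cases hh : mul (inv (h : G)) g ∈ unitSpace G
    · refine absurd (Subtype.ext ?_) hne
      have h1 : range (mul (inv (h : G)) g) = mul (inv (h : G)) g := hh
      rw [range_mul _ _ ((source_inv _).trans h.2), range_inv] at h1
      have h2 := mul_inv_cancel_left h.2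
      rwa [← h1, self_mul_source] at h2
    · rw [hd _ hh, mul_zero]

open Classical in
/-- The extension by zero of a function on the unit space. -/
noncomputable def extendUnits (u : C_c(unitSpace G, ℝ)) (g : G) : ℂ :=
  if h : g ∈ unitSpace G then (u ⟨g, h⟩ : ℂ) else 0

theorem extendUnits_unit (u : C_c(unitSpace G, ℝ)) (x : unitSpace G) :
    extendUnits u (x : G) = u x := by
  simp [extendUnits]

theorem extendUnits_of_notMem (u : C_c(unitSpace G, ℝ)) (g : G) (hg : g ∉ unitSpace G) :
    extendUnits u g = 0 := by
  simp [extendUnits, hg]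

/-- The unit space is both open and closed, so extending by zero creates no discontinuity. -/
theorem continuous_extendUnits [T2Space G] (u : C_c(unitSpace G, ℝ)) :
    Continuous (extendUnits u) := by
  rw [continuous_iff_continuousAt]
  intro g
  by_cases hg : g ∈ unitSpace G
  · refine (isOpen_unitSpace.isOpenEmbedding_subtypeVal.continuousAt_iff (x := ⟨g, hg⟩)).1 ?_
    have : extendUnits u ∘ Subtype.val = fun x : unitSpace G => (u x : ℂ) :=
      funext fun x => extendUnits_unit u x
    rw [this]
    exact (Complex.continuous_ofReal.comp u.continuous).continuousAt
  · refine continuousAt_const.congr (f := fun _ => (0 : ℂ)) ?_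
    filter_upwards [isClosed_unitSpace.isOpen_compl.mem_nhds hg] with k hk
    exact (extendUnits_of_notMem u k hk).symm

/-- The extension by zero of a function on the unit space, as an element of `C_c(G)`. -/
noncomputable def diagCc [T2Space G] (u : C_c(unitSpace G, ℝ)) : C_c(G, ℂ) :=
  ⟨⟨extendUnits u, continuous_extendUnits u⟩,
    HasCompactSupport.intro (u.hasCompactSupport.isCompact.image continuous_subtype_val)
      fun g hg => by
        by_cases h : g ∈ unitSpace G
        · have : u ⟨g, h⟩ = 0 := image_eq_zero_of_notMem_tsupport
            fun h' => hg ⟨⟨g, h⟩, h', rfl⟩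
          exact (extendUnits_unit u ⟨g, h⟩).trans (by rw [this, Complex.ofReal_zero])
        · exact extendUnits_of_notMem u g h⟩

/-- The range of an arrow, as a point of the unit space. -/
def rangeUnit (g : G) : unitSpace G := ⟨range g, range_range g⟩

/-- The source of an arrow, as a point of the unit space. -/
def sourceUnit (g : G) : unitSpace G := ⟨source g, range_source g⟩

theorem continuous_rangeUnit : Continuous (rangeUnit : G → unitSpace G) :=
  continuous_range.subtype_mk _

theorem continuous_sourceUnit : Continuous (sourceUnit : G → unitSpace G) :=
  continuous_source.subtype_mk _

theorem rangeUnit_coe (x : unitSpace G) : rangeUnit (x : G) = x := Subtype.ext x.2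

theorem sourceUnit_coe (x : unitSpace G) : sourceUnit (x : G) = x := Subtype.ext (source_unit x.2)

/-! ### Convolution with functions on the unit space -/

section

variable [T2Space G]

theorem diagCc_unit (u : C_c(unitSpace G, ℝ)) (x : unitSpace G) : diagCc u (x : G) = u x :=
  extendUnits_unit u x

theorem diagCc_of_notMem (u : C_c(unitSpace G, ℝ)) {g : G} (hg : g ∉ unitSpace G) :
    diagCc u g = 0 := extendUnits_of_notMem u g hg

theorem diagCc_ext {u : C_c(unitSpace G, ℝ)} {f : C_c(G, ℂ)}
    (h1 : ∀ x : unitSpace G, f (x : G) = u x) (h2 : ∀ g, g ∉ unitSpace G → f g = 0) :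
    f = diagCc u := by
  ext g
  by_cases hg : g ∈ unitSpace G
  · rw [h1 ⟨g, hg⟩, diagCc_unit u ⟨g, hg⟩]
  · rw [h2 g hg, diagCc_of_notMem u hg]

theorem twist_diagCc (c : RealHom G) (t : ℝ) (u : C_c(unitSpace G, ℝ)) :
    c.twist t (diagCc u) = diagCc u := by
  refine diagCc_ext (fun x => ?_) (fun g hg => ?_)
  · change Complex.exp (Complex.I * t * c x) * diagCc u x = _
    rw [c.map_unit x.2, diagCc_unit]
    simp
  · change Complex.exp (Complex.I * t * c g) * diagCc u g = _
    rw [diagCc_of_notMem u hg, mul_zero]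

theorem invol_diagCc (u : C_c(unitSpace G, ℝ)) : invol (diagCc u) = diagCc u := by
  refine diagCc_ext (fun x => ?_) (fun g hg => ?_)
  · change star (diagCc u (inv (x : G))) = _
    rw [inv_unit x.2, diagCc_unit]
    simp
  · change star (diagCc u (inv g)) = _
    rw [diagCc_of_notMem u fun h => hg (inv_mem_unitSpace.1 h), star_zero]

variable [LocallyCompactSpace G]

theorem conv_diagCc_left (u : C_c(unitSpace G, ℝ)) (f : C_c(G, ℂ)) (g : G) :
    conv (diagCc u) f g = u (rangeUnit g) * f g := by
  rw [← diagCc_unit]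
  exact convFun_of_left_diag (fun g hg => diagCc_of_notMem u hg) g

theorem conv_diagCc_right (u : C_c(unitSpace G, ℝ)) (f : C_c(G, ℂ)) (g : G) :
    conv f (diagCc u) g = f g * u (sourceUnit g) := by
  rw [← diagCc_unit]
  exact convFun_of_right_diag (fun g hg => diagCc_of_notMem u hg) g

theorem conv_diagCc_diagCc (u v : C_c(unitSpace G, ℝ)) :
    conv (diagCc u) (diagCc v) = diagCc (u * v) := by
  refine diagCc_ext (fun x => ?_) (fun g hg => ?_)
  · rw [conv_diagCc_left, rangeUnit_coe, diagCc_unit]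
    simp
  · rw [conv_diagCc_left, diagCc_of_notMem v hg, mul_zero]

end

/-! ### Cut-off functions on the unit space -/

instance [T2Space G] [LocallyCompactSpace G] : LocallyCompactSpace (unitSpace G) :=
  isClosed_unitSpace.isClosedEmbedding_subtypeVal.locallyCompactSpace

section Cutoff

variable [T2Space G] [LocallyCompactSpace G]

theorem exists_cutoff {K L : Set (unitSpace G)} (hK : IsCompact K) (hL : IsClosed L)
    (hKL : Disjoint K L) : ∃ u : C_c(unitSpace G, ℝ), (∀ x ∈ K, u x = 1) ∧ (∀ x ∈ L, u x = 0) ∧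
      ∀ x, u x ∈ Icc (0 : ℝ) 1 := by
  obtain ⟨u, h1, h2, h3, h4⟩ := exists_continuous_one_zero_of_isCompact hK hL hKL
  exact ⟨⟨u, h3⟩, h1, h2, h4⟩

theorem exists_local_unit (u : C_c(unitSpace G, ℝ)) :
    ∃ v : C_c(unitSpace G, ℝ), (∀ x, v x ∈ Icc (0 : ℝ) 1) ∧ v * u = u := by
  obtain ⟨v, h1, -, h2⟩ := exists_cutoff u.hasCompactSupport.isCompact isClosed_empty
    (disjoint_empty _)
  refine ⟨v, h2, ?_⟩
  ext x
  by_cases hx : u x = 0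
  · simp [hx]
  · simp [h1 x (subset_tsupport _ hx)]

theorem exists_local_unit_conv (f : C_c(G, ℂ)) :
    ∃ v : C_c(unitSpace G, ℝ), (∀ x, v x ∈ Icc (0 : ℝ) 1) ∧ conv (diagCc v) f = f ∧
      conv f (diagCc v) = f := by
  have hK := f.hasCompactSupport.isCompact
  obtain ⟨v, h1, -, h2⟩ := exists_cutoff
    ((hK.image continuous_rangeUnit).union (hK.image continuous_sourceUnit)) isClosed_empty
    (disjoint_empty _)
  refine ⟨v, h2, ?_, ?_⟩
  · ext g
    rw [conv_diagCc_left]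
    by_cases hg : f g = 0
    · rw [hg, mul_zero]
    · rw [h1 _ (Or.inl ⟨g, subset_tsupport _ hg, rfl⟩), Complex.ofReal_one, one_mul]
  · ext g
    rw [conv_diagCc_right]
    by_cases hg : f g = 0
    · rw [hg, zero_mul]
    · rw [h1 _ (Or.inr ⟨g, subset_tsupport _ hg, rfl⟩), Complex.ofReal_one, mul_one]

/-- Second countability yields an exhaustion by a sequence of compact sets. A sequence rather than a
net is needed for Fatou's lemma. -/
theorem exists_cutoff_seq [SecondCountableTopology G] :
    ∃ u : ℕ → C_c(unitSpace G, ℝ), (∀ n x, u n x ∈ Icc (0 : ℝ) 1) ∧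
      ∀ K : Set (unitSpace G), IsCompact K → ∀ᶠ n in atTop, ∀ x ∈ K, u n x = 1 := by
  let E : CompactExhaustion (unitSpace G) := default
  choose u h1 _ h2 using fun n => exists_cutoff (E.isCompact n) isClosed_empty (disjoint_empty _)
  refine ⟨u, h2, fun K hK => ?_⟩
  obtain ⟨N, hN⟩ := E.exists_superset_of_isCompact hK
  filter_upwards [eventually_ge_atTop N] with n hn x hx
  exact h1 n x (E.subset hn (hN hx))

end Cutoff

/-! ### The diagonal elements of the reduced C*-algebra -/

namespace ReducedCStarAlgebra

variable [T2Space G] [LocallyCompactSpace G]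

theorem ofCc_mul (f₁ f₂ : C_c(G, ℂ)) : ofCc f₁ * ofCc f₂ = ofCc (conv f₁ f₂) :=
  incl_injective (regRep_conv f₁ f₂).symm

theorem star_ofCc (f : C_c(G, ℂ)) : star (ofCc f) = ofCc (invol f) :=
  incl_injective (regRep_invol f).symm

theorem ofCc_add (f₁ f₂ : C_c(G, ℂ)) : ofCc (f₁ + f₂) = ofCc f₁ + ofCc f₂ :=
  incl_injective (regRep_add f₁ f₂)

theorem ofCc_smul (z : ℂ) (f : C_c(G, ℂ)) : ofCc (z • f) = z • ofCc f :=
  incl_injective (regRep_smul z f)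

/-- The canonical map `C_c(G) → C*_r(G)`, as a linear map. -/
noncomputable def ofCcLinear : C_c(G, ℂ) →ₗ[ℂ] ReducedCStarAlgebra G where
  toFun := ofCc
  map_add' := ofCc_add
  map_smul' := ofCc_smul

theorem denseRange_ofCc : DenseRange (ofCc (G := G)) := by
  refine Metric.dense_iff.2 fun a ε hε => ?_
  obtain ⟨f, hf⟩ := exists_approx a hε
  exact ⟨ofCc f, by rwa [Metric.mem_ball, dist_comm, dist_eq_norm], f, rfl⟩

/-- The element of `C*_r(G)` given by a real function on the unit space. -/
noncomputable def ofUnits (u : C_c(unitSpace G, ℝ)) : ReducedCStarAlgebra G := ofCc (diagCc u)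

theorem ofUnits_mul (u v : C_c(unitSpace G, ℝ)) : ofUnits u * ofUnits v = ofUnits (u * v) := by
  rw [ofUnits, ofUnits, ofCc_mul, conv_diagCc_diagCc, ofUnits]

theorem star_ofUnits (u : C_c(unitSpace G, ℝ)) : star (ofUnits u) = ofUnits u := by
  rw [ofUnits, star_ofCc, invol_diagCc]

theorem sigma_ofUnits (c : RealHom G) (t : ℝ) (u : C_c(unitSpace G, ℝ)) :
    sigma c t (ofUnits u) = ofUnits u := by
  change sigmaAut c t (ofCc _) = _
  rw [sigmaAut_ofCc, twist_diagCc, ofUnits]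

theorem ofUnits_nonneg {u : C_c(unitSpace G, ℝ)} (hu : ∀ x, 0 ≤ u x) : 0 ≤ ofUnits u := by
  let v : C_c(unitSpace G, ℝ) := ⟨⟨fun x => √(u x), u.continuous.sqrt⟩,
    u.hasCompactSupport.comp_left Real.sqrt_zero⟩
  have : u = v * v := by
    ext x
    exact (Real.mul_self_sqrt (hu x)).symm
  rw [this, ← ofUnits_mul]
  nth_rw 1 [← star_ofUnits v]
  exact star_mul_self_nonneg _

/-- In every regular representation a function on the unit space is the diagonal operator with
entries `u(r(g))`; the Schur test with one entry per row and column gives the sup bound. -/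
theorem norm_ofUnits_le (u : C_c(unitSpace G, ℝ)) {M : ℝ} (hM0 : 0 ≤ M) (hM : ∀ x, |u x| ≤ M) :
    ‖ofUnits u‖ ≤ M := by
  classical
  refine FiberOperators.norm_le _ hM0 fun x => ?_
  obtain ⟨T, hT, hTn⟩ := exists_matrix_operator (ι := {g : G // source g = (x : G)})
    (fun g k => if g = k then (u (rangeUnit (g : G)) : ℂ) else 0) 1 M hM0
    (fun g k => by
      split_ifs
      · simpa using hM _
      · simpa using hM0)
    (fun _ _ => 0)
    (fun g k k' h1 h2 _ => by
      simp only [ne_eq, ite_eq_right_iff, not_forall] at h1 h2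
      exact h1.1.symm.trans h2.1)
    (fun g g' k h1 h2 _ => by
      simp only [ne_eq, ite_eq_right_iff, not_forall] at h1 h2
      exact h1.1.trans h2.1.symm)
  have hTe : fiberRep x (diagCc u) = T := by
    ext ξ g
    rw [fiberRep_apply', hT]
    refine tsum_congr fun k => ?_
    congr 1
    split_ifs with hgk
    · subst hgk
      rw [mul_inv, ← diagCc_unit]
      rfl
    · refine diagCc_of_notMem u fun h => hgk (Subtype.ext ?_)
      have e : source (g : G) = range (inv (k : G)) := by rw [range_inv, g.2, k.2]
      have h1 : range (mul (g : G) (inv k)) = mul (g : G) (inv k) := h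
      rw [range_mul _ _ e] at h1
      have h2 := inv_mul_cancel_right (g := (g : G)) (h := k) (by rw [g.2, k.2])
      have h3 : source (range (g : G)) = range (k : G) := by
        rw [h1, source_mul _ _ e, source_inv]
      rw [← h1] at h2
      rw [source_range] at h3
      rw [← h2, h3, range_mul_self]
  change ‖fiberRep x (diagCc u)‖ ≤ M
  rw [hTe]
  simpa using hTn

theorem norm_ofUnits_le_one {u : C_c(unitSpace G, ℝ)} (hu : ∀ x, u x ∈ Icc (0 : ℝ) 1) :
    ‖ofUnits u‖ ≤ 1 :=
  norm_ofUnits_le u zero_le_one fun x => abs_le.2 ⟨by linarith [(hu x).1], (hu x).2⟩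

/-- The cut-off functions on the unit space form an approximate unit. -/
theorem tendsto_cutoff_conj {u : ℕ → C_c(unitSpace G, ℝ)}
    (hu : ∀ n x, u n x ∈ Icc (0 : ℝ) 1)
    (hK : ∀ K : Set (unitSpace G), IsCompact K → ∀ᶠ n in atTop, ∀ x ∈ K, u n x = 1)
    (a : ReducedCStarAlgebra G) :
    Tendsto (fun n => ofUnits (u n) * a * ofUnits (u n)) atTop (𝓝 a) := by
  rw [tendsto_iff_norm_sub_tendsto_zero, Metric.tendsto_atTop]
  intro ε hε
  obtain ⟨f, hf⟩ := exists_approx a (ε := ε / 2) (by positivity)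
  have hc := f.hasCompactSupport.isCompact
  obtain ⟨N, hN⟩ := eventually_atTop.1
    ((hK _ (hc.image continuous_rangeUnit)).and (hK _ (hc.image continuous_sourceUnit)))
  refine ⟨N, fun n hn => ?_⟩
  obtain ⟨h1, h2⟩ := hN n hn
  have hfix : ofUnits (u n) * ofCc f * ofUnits (u n) = ofCc f := by
    rw [ofUnits, ofCc_mul, ofCc_mul]
    congr 1
    ext g
    rw [conv_diagCc_right, conv_diagCc_left]
    by_cases hg : f g = 0
    · rw [hg]; simp
    · rw [h1 _ ⟨g, subset_tsupport _ hg, rfl⟩, h2 _ ⟨g, subset_tsupport _ hg, rfl⟩]; simp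
  have hn1 := norm_ofUnits_le_one (hu n)
  -- The cut-off fixes `f` for large `n`, and is a contraction, so the error is at most `2‖a - f‖`.
  have e : ofUnits (u n) * a * ofUnits (u n) - a =
      ofUnits (u n) * (a - ofCc f) * ofUnits (u n) - (a - ofCc f) := by
    rw [mul_sub, sub_mul, hfix]; abel
  have hle : ‖ofUnits (u n) * (a - ofCc f) * ofUnits (u n)‖ ≤ ‖a - ofCc f‖ := by
    calc _ ≤ ‖ofUnits (u n)‖ * ‖a - ofCc f‖ * ‖ofUnits (u n)‖ :=
          (norm_mul_le _ _).trans (by gcongr; exact norm_mul_le _ _)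
      _ ≤ 1 * ‖a - ofCc f‖ * 1 := by gcongr
      _ = _ := by ring
  rw [Real.dist_eq, sub_zero, abs_norm, e]
  linarith [norm_sub_le (ofUnits (u n) * (a - ofCc f) * ofUnits (u n)) (a - ofCc f)]

end ReducedCStarAlgebra

end EtaleGroupoid

namespace EtaleGroupoid

variable {G : Type*} [TopologicalSpace G] [EtaleGroupoid G]

/-! ### Invariant central functionals on `C_c(G)` live on the unit space -/

/-- The product of a compactly supported function with the indicator function of a clopen set. -/
noncomputable def restrictClopen {X : Type*} [TopologicalSpace X] {S : Set X} (hS : IsClopen S) (f : C_c(X, ℂ)) : C_c(X, ℂ) :=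
  ⟨⟨S.indicator f, f.continuous.indicator (by simp [hS.frontier_eq])⟩,
    f.hasCompactSupport.mono (by
      rw [support_indicator]
      exact inter_subset_right)⟩

theorem RealHom.isClopen_ker {c : RealHom G} (hopen : IsOpen c.ker) : IsClopen c.ker :=
  ⟨isClosed_eq c.continuous' continuous_const, hopen⟩

/-- A function supported off the open kernel of `c` is a coboundary for the twisting by `c`. -/
theorem RealHom.exists_twist_sub {c : RealHom G} (hopen : IsOpen c.ker) {f : C_c(G, ℂ)}
    (hf : ∀ g, f g ≠ 0 → c g ≠ 0) : ∃ (t : ℝ) (k : C_c(G, ℂ)), f = c.twist t k - k := by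
  obtain ⟨B, hB⟩ := f.hasCompactSupport.isCompact.exists_bound_of_continuousOn
    c.continuous'.continuousOn
  -- Openness of the kernel is used here: even the closed support stays away from it, so division by
  -- `e^{itc} - 1` is continuous there.
  have hts : tsupport f ⊆ c.kerᶜ :=
    closure_minimal (fun g hg => hf g hg) hopen.isClosed_compl
  set M : ℝ := max B 0 + 1
  have hM : 0 < M := by positivity
  -- With `|c| ≤ M` on the support one gets `|tc| ≤ π < 2π`, so `e^{itc} = 1` only where `c = 0`.
  -- The added one in `M` keeps it positive.
  set t : ℝ := Real.pi / M
  have ht : 0 < t := div_pos Real.pi_pos hM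
  have hne : ∀ g ∈ tsupport f, Complex.exp (Complex.I * t * c g) - 1 ≠ 0 := by
    intro g hg h
    obtain ⟨n, hn⟩ := Complex.exp_eq_one_iff.1 (sub_eq_zero.1 h)
    have h1 : t * c g = n * (2 * Real.pi) := by
      have h2 : Complex.I * ((t * c g : ℝ) : ℂ) = Complex.I * ((n * (2 * Real.pi) : ℝ) : ℂ) := by
        push_cast
        rw [← _root_.mul_assoc, hn]
        ring
      exact_mod_cast mul_left_cancel₀ Complex.I_ne_zero h2
    have h2 : |t * c g| < 2 * Real.pi := by
      rw [abs_mul, abs_of_pos ht]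
      have h3 : |c g| ≤ M := (hB g hg).trans ((le_max_left _ _).trans (le_add_of_nonneg_right
        zero_le_one))
      calc t * |c g| ≤ t * M := by gcongr
        _ = Real.pi := div_mul_cancel₀ _ hM.ne'
        _ < 2 * Real.pi := by linarith [Real.pi_pos]
    have h3 : n = 0 := by
      rw [h1, abs_mul, abs_of_pos (by positivity : (0 : ℝ) < 2 * Real.pi)] at h2
      have h4 : |(n : ℝ)| < 1 := lt_of_mul_lt_mul_right (h2.trans_eq (one_mul _).symm) (by positivity)
      exact Int.abs_lt_one_iff.1 (by exact_mod_cast h4)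
    rw [h3, Int.cast_zero, zero_mul] at h1
    exact hts hg ((mul_eq_zero.1 h1).resolve_left ht.ne')
  have hcont : Continuous fun g => f g * (Complex.exp (Complex.I * t * c g) - 1)⁻¹ := by
    rw [continuous_iff_continuousAt]
    intro g
    by_cases hg : g ∈ tsupport f
    · refine f.continuous.continuousAt.mul (ContinuousAt.inv₀ ?_ (hne g hg))
      have : Continuous fun g => Complex.exp (Complex.I * t * c g) - 1 :=
        (Complex.continuous_exp.comp (continuous_const.mul
          (Complex.continuous_ofReal.comp c.continuous'))).sub continuous_const
      exact this.continuousAt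
    · refine continuousAt_const.congr (f := fun _ => (0 : ℂ)) ?_
      filter_upwards [(isClosed_tsupport f).isOpen_compl.mem_nhds hg] with k hk
      rw [image_eq_zero_of_notMem_tsupport hk, zero_mul]
  -- The witness is `k = f / (e^{itc} - 1)`.
  refine ⟨t, ⟨⟨_, hcont⟩, f.hasCompactSupport.mul_right⟩, ?_⟩
  ext g
  change f g = Complex.exp (Complex.I * t * c g) * (f g * _) - f g * _
  by_cases hg : f g = 0
  · simp [hg]
  · have := hne g (subset_tsupport _ hg)
    field_simp

variable [T2Space G]

theorem exists_separating_nhd {g : G} (hg : range g ≠ source g) :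
    ∃ V : Set G, IsOpen V ∧ g ∈ V ∧ ∀ a ∈ V, ∀ b ∈ V, range a ≠ source b := by
  obtain ⟨U, W, hU, hW, h1, h2, hd⟩ := t2_separation hg
  refine ⟨range ⁻¹' U ∩ source ⁻¹' W, (hU.preimage continuous_range).inter
    (hW.preimage continuous_source), ⟨h1, h2⟩, fun a ha b hb e => ?_⟩
  exact disjoint_left.1 hd ha.1 (e ▸ hb.2)

theorem exists_separating_cover {K : Set G} (hK : IsCompact K)
    (h : ∀ g ∈ K, range g ≠ source g) :
    ∃ (n : ℕ) (V : Fin n → Set G), (∀ i, IsOpen (V i)) ∧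
      (∀ i, ∀ a ∈ V i, ∀ b ∈ V i, range a ≠ source b) ∧ K ⊆ ⋃ i, V i := by
  choose V hV hgV hs using fun g : K => exists_separating_nhd (h g g.2)
  obtain ⟨t, ht⟩ := hK.elim_finite_subcover V hV (fun g hg => mem_iUnion.2 ⟨⟨g, hg⟩, hgV _⟩)
  refine ⟨t.card, fun i => V (t.equivFin.symm i), fun i => hV _, fun i => hs _, ?_⟩
  intro g hg
  obtain ⟨j, hj, hgj⟩ := mem_iUnion₂.1 (ht hg)
  exact mem_iUnion.2 ⟨t.equivFin ⟨j, hj⟩, by simpa using hgj⟩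

theorem isClopen_unitSpace : IsClopen (unitSpace G) := ⟨isClosed_unitSpace, isOpen_unitSpace⟩

variable [LocallyCompactSpace G]

/-- A functional which has the functions on the unit space in its centralizer vanishes on the
functions supported on arrows whose range and source differ. -/
theorem eq_zero_of_range_ne_source {Φ : C_c(G, ℂ) →ₗ[ℂ] ℂ}
    (hcomm : ∀ u f, Φ (conv (diagCc u) f) = Φ (conv f (diagCc u))) {f : C_c(G, ℂ)}
    (hf : ∀ g ∈ tsupport f, range g ≠ source g) : Φ f = 0 := by
  have hK := f.hasCompactSupport.isCompact
  obtain ⟨n, V, hV, hs, hc⟩ := exists_separating_cover hK hf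
  obtain ⟨p, hp, hp1, -, -⟩ := exists_continuous_sum_one_of_isOpen_isCompact hV hK hc
  let q : Fin n → C_c(G, ℂ) := fun i =>
    ⟨⟨fun g => (p i g : ℂ) * f g,
      (Complex.continuous_ofReal.comp (p i).continuous).mul f.continuous⟩,
      f.hasCompactSupport.mul_left⟩
  have hq : ∀ i, tsupport (q i) ⊆ V i := fun i => by
    refine subset_trans (closure_mono fun g hg => ?_) (hp i)
    intro h
    apply hg
    change ((p i g : ℝ) : ℂ) * f g = 0
    rw [h, Complex.ofReal_zero, zero_mul]
  have hsum : f = ∑ i, q i := by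
    ext g
    have e : (∑ i, q i) g = ∑ i, q i g := by simp
    rw [e]
    change f g = ∑ i, (p i g : ℂ) * f g
    by_cases hg : f g = 0
    · simp [hg]
    · have := hp1 (subset_tsupport _ hg)
      simp only [Finset.sum_apply, Pi.one_apply] at this
      rw [← Finset.sum_mul, ← Complex.ofReal_sum, this, Complex.ofReal_one, one_mul]
  rw [hsum, map_sum]
  refine Finset.sum_eq_zero fun i _ => ?_
  have hc := (q i).hasCompactSupport.isCompact
  -- The ranges and the sources of the support of a piece are disjoint compact sets. With `u` one on
  -- the ranges and zero on the sources, left multiplication by `u` keeps the piece and right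
  -- multiplication annihilates it.
  obtain ⟨u, h1, h0, -⟩ := exists_cutoff (hc.image continuous_rangeUnit)
    (hc.image continuous_sourceUnit).isClosed (disjoint_left.2 (by
      rintro _ ⟨a, ha, rfl⟩ ⟨b, hb, hab⟩
      exact hs i a (hq i ha) b (hq i hb) (congrArg Subtype.val hab).symm))
  have e1 : conv (diagCc u) (q i) = q i := by
    ext g
    rw [conv_diagCc_left]
    by_cases hg : q i g = 0
    · rw [hg, mul_zero]
    · rw [h1 _ ⟨g, subset_tsupport _ hg, rfl⟩, Complex.ofReal_one, one_mul]
  have e2 : conv (q i) (diagCc u) = 0 := by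
    ext g
    rw [conv_diagCc_right]
    by_cases hg : q i g = 0
    · rw [hg, zero_mul]; rfl
    · rw [h0 _ ⟨g, subset_tsupport _ hg, rfl⟩, Complex.ofReal_zero, mul_zero]; rfl
  rw [← e1, hcomm, e2, map_zero]

/-- A functional on `C_c(G)` that is invariant under the twisting by `c₀` and has the functions on
the unit space in its centralizer only depends on the restriction to the unit space, when the
kernel of `c₀` is open and has trivial isotropy. -/
theorem eq_restrict_unitSpace {c₀ : RealHom G}
    (hiso : ∀ x ∈ unitSpace G, isotropy x ∩ c₀.ker = {x}) (hopen : IsOpen c₀.ker)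
    {Φ : C_c(G, ℂ) →ₗ[ℂ] ℂ}
    (hcomm : ∀ u f, Φ (conv (diagCc u) f) = Φ (conv f (diagCc u)))
    (hinv : ∀ t f, Φ (c₀.twist t f) = Φ f) (f : C_c(G, ℂ)) :
    Φ f = Φ (restrictClopen isClopen_unitSpace f) := by
  have hker := RealHom.isClopen_ker hopen
  -- Three clopen pieces: off the kernel (killed by invariance), in the kernel off the units (killed
  -- by commutation), and the units.
  let f₁ := restrictClopen hker.compl f
  let f₂ := restrictClopen isClopen_unitSpace.compl (restrictClopen hker f)
  have hsum : f = f₁ + f₂ + restrictClopen isClopen_unitSpace f := by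
    ext g
    change f g = c₀.kerᶜ.indicator f g + (unitSpace G)ᶜ.indicator (c₀.ker.indicator f) g +
      (unitSpace G).indicator f g
    by_cases h1 : g ∈ unitSpace G
    · have h2 : g ∈ c₀.ker := c₀.map_unit h1
      simp [h1, h2]
    · by_cases h2 : g ∈ c₀.ker <;> simp [h1, h2]
  have hf₁ : Φ f₁ = 0 := by
    obtain ⟨t, k, hk⟩ := RealHom.exists_twist_sub hopen (f := f₁) fun g hg =>
      (mem_of_indicator_ne_zero (s := c₀.kerᶜ) (f := f) hg)
    rw [hk, map_sub, hinv, sub_self]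
  have hf₂ : Φ f₂ = 0 := by
    refine eq_zero_of_range_ne_source hcomm fun g hg => ?_
    have hsub : tsupport f₂ ⊆ c₀.ker ∩ (unitSpace G)ᶜ := by
      refine closure_minimal (fun g hg => ?_) (hker.isClosed.inter isClopen_unitSpace.compl.isClosed)
      have h1 : g ∈ (unitSpace G)ᶜ :=
        mem_of_indicator_ne_zero (f := c₀.ker.indicator f) hg
      refine ⟨mem_of_indicator_ne_zero (f := f) (s := c₀.ker) fun h => hg ?_, h1⟩
      change (unitSpace G)ᶜ.indicator (c₀.ker.indicator f) g = 0
      rw [indicator_of_mem h1, h]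
    obtain ⟨h1, h2⟩ := hsub hg
    intro e
    -- Trivial isotropy in the kernel: equal range and source would make `g` a unit, against the
    -- support condition.
    have h3 : g ∈ isotropy (source g) ∩ c₀.ker := ⟨⟨e, rfl⟩, h1⟩
    rw [hiso _ (source_mem_unitSpace g)] at h3
    exact h2 (h3 ▸ source_mem_unitSpace g)
  conv_lhs => rw [hsum]
  rw [map_add, map_add, hf₁, hf₂, zero_add, zero_add]

end EtaleGroupoid

namespace EtaleGroupoid

variable {G : Type*} [TopologicalSpace G] [EtaleGroupoid G] [T2Space G] [LocallyCompactSpace G]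

namespace ReducedCStarAlgebra

open CStarWeight

variable {ψ : CStarWeight (ReducedCStarAlgebra G)} {c : RealHom G} {β : ℝ}

/-! ### KMS weights on `C_c(G)` -/

/-- A homomorphism vanishes on units, so `σ^c` fixes `u` and a local unit for it, and the finiteness
criterion for fixed elements applies. -/
theorem ofUnits_mem_leftIdeal (hK : ψ.IsKMS (sigma c) β) (u : C_c(unitSpace G, ℝ)) :
    ofUnits u ∈ ψ.leftIdeal := by
  obtain ⟨v, hv, hvu⟩ := exists_local_unit u
  refine hK.mem_leftIdeal_of_local_unit (star_ofUnits u) (ofUnits_nonneg fun x => (hv x).1)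
    (fun t => sigma_ofUnits c t u) (fun t => sigma_ofUnits c t v) ?_ ?_
  · rw [ofUnits_mul, _root_.mul_comm, hvu]
  · rw [ofUnits_mul, hvu]

theorem ofCc_mem_leftIdeal (hK : ψ.IsKMS (sigma c) β) (f : C_c(G, ℂ)) :
    ofCc f ∈ ψ.leftIdeal := by
  obtain ⟨v, -, -, hv⟩ := exists_local_unit_conv f
  rw [← hv, ← ofCc_mul]
  exact mul_mem_leftIdeal hK.proper _ (ofUnits_mem_leftIdeal hK v)

theorem ofCc_mem_defDomain (hK : ψ.IsKMS (sigma c) β) (f : C_c(G, ℂ)) :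
    ofCc f ∈ ψ.defDomain := by
  obtain ⟨v, -, hv, -⟩ := exists_local_unit_conv f
  rw [← hv, ← ofCc_mul]
  refine mul_mem_defDomain ?_ (ofCc_mem_leftIdeal hK f)
  rw [star_ofCc]
  exact ofCc_mem_leftIdeal hK _

theorem functional_ofUnits (hK : ψ.IsKMS (sigma c) β) (u : C_c(unitSpace G, ℝ)) :
    ψ.functional hK.proper (ofUnits u) = ((ψ.functional hK.proper (ofUnits u)).re : ℂ) := by
  have h := functional_star hK.proper (ofCc_mem_defDomain hK (diagCc u))
  rw [star_ofCc, invol_diagCc] at h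
  exact (Complex.conj_eq_iff_re.1 h.symm).symm

theorem ofUnits_add (u v : C_c(unitSpace G, ℝ)) : ofUnits (u + v) = ofUnits u + ofUnits v := by
  rw [ofUnits, ofUnits, ofUnits, ← ofCc_add]
  congr 1
  refine (diagCc_ext (fun x => ?_) (fun g hg => ?_)).symm
  · simp [diagCc_unit]
  · simp [diagCc_of_notMem _ hg]

theorem ofUnits_smul (r : ℝ) (u : C_c(unitSpace G, ℝ)) :
    ofUnits (r • u) = (r : ℂ) • ofUnits u := by
  rw [ofUnits, ofUnits, ← ofCc_smul]
  congr 1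
  refine (diagCc_ext (fun x => ?_) (fun g hg => ?_)).symm
  · simp [diagCc_unit]
  · simp [diagCc_of_notMem _ hg]

/-- The positive linear functional on `C_c(G⁽⁰⁾)` defined by a KMS weight. -/
noncomputable def unitFunctional (hK : ψ.IsKMS (sigma c) β) : C_c(unitSpace G, ℝ) →ₚ[ℝ] ℝ :=
  PositiveLinearMap.mk₀
    { toFun := fun u => (ψ.functional hK.proper (ofUnits u)).re
      map_add' := fun u v => by rw [ofUnits_add, map_add, Complex.add_re]
      map_smul' := fun r u => by rw [ofUnits_smul, map_smul]; simp }
    fun u hu => by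
      let w : C_c(unitSpace G, ℝ) := ⟨⟨fun x => √(u x), u.continuous.sqrt⟩,
        u.hasCompactSupport.comp_left Real.sqrt_zero⟩
      have : ofUnits u = star (ofUnits w) * ofUnits w := by
        rw [star_ofUnits, ofUnits_mul]
        congr 1
        ext x
        exact (Real.mul_self_sqrt (hu x)).symm
      change 0 ≤ (ψ.functional hK.proper (ofUnits u)).re
      rw [this, functional_star_mul_self hK.proper (ofUnits_mem_leftIdeal hK w)]
      simp

/-! ### Compressions by functions on the unit space -/

/-- `Ψ` need not be bounded, but Cauchy–Schwarz applied to `d` and `ad` bounds its compression by a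
multiple of `‖a‖`. -/
theorem continuous_functional_conj (h : ψ.IsProper) {d : ReducedCStarAlgebra G}
    (hd : d ∈ ψ.leftIdeal) (hsa : star d = d) :
    Continuous fun a => ψ.functional h (d * a * d) := by
  obtain ⟨s, hs0, hs⟩ := exists_normSq_le hd
  let L : ReducedCStarAlgebra G →ₗ[ℂ] ℂ :=
    { toFun := fun a => ψ.functional h (d * a * d)
      map_add' := fun a b => by rw [mul_add, add_mul, map_add]
      map_smul' := fun z a => by rw [mul_smul_comm, smul_mul_assoc, map_smul, RingHom.id_apply] }
  refine (L.mkContinuous (s * s) fun a => ?_).continuous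
  have h1 := norm_functional_star_mul_le h hs0 (by positivity) hs
    (normSq_mul_le_ofReal h a le_rfl hs)
  rw [hsa, ← _root_.mul_assoc] at h1
  calc ‖L a‖ ≤ s * (‖a‖ * s) := h1
    _ = s * s * ‖a‖ := by ring

theorem conj_nonneg (u : C_c(unitSpace G, ℝ)) {a : ReducedCStarAlgebra G} (ha : 0 ≤ a) :
    0 ≤ ofUnits u * a * ofUnits u := by
  have := star_left_conjugate_nonneg ha (ofUnits u)
  rwa [star_ofUnits] at this

theorem apply_conj_eq_normSq (u : C_c(unitSpace G, ℝ)) {a : ReducedCStarAlgebra G} (ha : 0 ≤ a) :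
    ψ ⟨ofUnits u * a * ofUnits u, conj_nonneg u ha⟩ = ψ.normSq (CFC.sqrt a * ofUnits u) := by
  refine apply_congr ?_ _ _
  rw [star_mul, star_ofUnits, (IsSelfAdjoint.of_nonneg (CFC.sqrt_nonneg a)).star_eq]
  nth_rw 1 [← CFC.sqrt_mul_sqrt_self a ha]
  simp only [_root_.mul_assoc]

theorem apply_conj_lt_top (hK : ψ.IsKMS (sigma c) β) (u : C_c(unitSpace G, ℝ))
    {a : ReducedCStarAlgebra G} (ha : 0 ≤ a) :
    ψ ⟨ofUnits u * a * ofUnits u, conj_nonneg u ha⟩ < ∞ := by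
  rw [apply_conj_eq_normSq u ha]
  exact mul_mem_leftIdeal hK.proper _ (ofUnits_mem_leftIdeal hK u)

/-! ### The measure of a KMS weight -/

variable [MeasurableSpace G] [BorelSpace G]

/-- The regular Borel measure on `G⁽⁰⁾` that represents a KMS weight on `C_c(G⁽⁰⁾)`. -/
noncomputable def kmsMeasure (hK : ψ.IsKMS (sigma c) β) : Measure (unitSpace G) :=
  RealRMK.rieszMeasure (unitFunctional hK)

instance (hK : ψ.IsKMS (sigma c) β) : (kmsMeasure hK).Regular :=
  RealRMK.regular_rieszMeasure _

theorem integrable_sq_mul {X : Type*} [TopologicalSpace X] [T2Space X] [MeasurableSpace X]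
    [OpensMeasurableSpace X] (m : Measure X) [IsFiniteMeasureOnCompacts m] (u : C_c(X, ℝ))
    {k : X → ℂ} (hk : Continuous k) : Integrable (fun x => (u x : ℂ) ^ 2 * k x) m := by
  refine Continuous.integrable_of_hasCompactSupport ?_ ?_
  · exact ((Complex.continuous_ofReal.comp u.continuous).pow 2).mul hk
  · exact (u.hasCompactSupport.comp_left (g := fun r : ℝ => (r : ℂ) ^ 2) (by simp)).mul_right

theorem functional_ofUnits_eq_integral (hK : ψ.IsKMS (sigma c) β) (u : C_c(unitSpace G, ℝ)) :
    ψ.functional hK.proper (ofUnits u) = ∫ x, (u x : ℂ) ∂(kmsMeasure hK) := by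
  rw [functional_ofUnits hK, integral_complex_ofReal, kmsMeasure, RealRMK.integral_rieszMeasure]
  rfl

/-- The centralizer property and invariance under `σ^{c₀}` reduce `Ψ` to the unit space, where the
Riesz measure computes it. -/
theorem functional_ofCc_eq_integral {c₀ : RealHom G}
    (hiso : ∀ x ∈ unitSpace G, isotropy x ∩ c₀.ker = {x}) (hopen : IsOpen c₀.ker)
    (hK : ψ.IsKMS (sigma c) β) (hinv : ∀ t : ℝ, ψ.IsInvariantUnder (sigma c₀ t))
    (f : C_c(G, ℂ)) :
    ψ.functional hK.proper (ofCc f) = ∫ x : unitSpace G, f x ∂(kmsMeasure hK) := by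
  have h := eq_restrict_unitSpace hiso hopen (Φ := ψ.functional hK.proper ∘ₗ ofCcLinear)
    (fun u f => by
      change ψ.functional hK.proper (ofCc _) = ψ.functional hK.proper (ofCc _)
      rw [← ofCc_mul, ← ofCc_mul]
      refine (hK.functional_mul_comm (ofCc_mem_leftIdeal hK f) ?_ (ofUnits_mem_leftIdeal hK u) ?_
        (fun t => sigma_ofUnits c t u)).symm
      · rw [star_ofCc]; exact ofCc_mem_leftIdeal hK _
      · rw [star_ofUnits]; exact ofUnits_mem_leftIdeal hK _)
    (fun t f => by
      change ψ.functional hK.proper (ofCc _) = ψ.functional hK.proper (ofCc _)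
      rw [← sigmaAut_ofCc]
      exact functional_map hK.proper (hinv t) (ofCc_mem_defDomain hK f)) f
  have hcl := (isClosed_unitSpace (G := G)).isClosedEmbedding_subtypeVal
  let v : C_c(unitSpace G, ℂ) := ⟨⟨fun x => f x, f.continuous.comp continuous_subtype_val⟩,
    f.hasCompactSupport.comp_isClosedEmbedding hcl⟩
  let p : C_c(unitSpace G, ℝ) := ⟨⟨fun x => (v x).re, Complex.continuous_re.comp v.continuous⟩,
    v.hasCompactSupport.comp_left Complex.zero_re⟩
  let q : C_c(unitSpace G, ℝ) := ⟨⟨fun x => (v x).im, Complex.continuous_im.comp v.continuous⟩,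
    v.hasCompactSupport.comp_left Complex.zero_im⟩
  -- The measure represents a functional on real functions, hence the split into real and imaginary
  -- parts.
  have e : restrictClopen isClopen_unitSpace f = diagCc p + Complex.I • diagCc q := by
    ext g
    change (unitSpace G).indicator f g = diagCc p g + Complex.I * diagCc q g
    by_cases hg : g ∈ unitSpace G
    · rw [indicator_of_mem hg, diagCc_unit p ⟨g, hg⟩, diagCc_unit q ⟨g, hg⟩,
        _root_.mul_comm Complex.I]
      exact (Complex.re_add_im _).symm
    · rw [indicator_of_notMem hg, diagCc_of_notMem p hg, diagCc_of_notMem q hg]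
      simp
  have hint : ∀ u : C_c(unitSpace G, ℝ), Integrable (fun x => (u x : ℂ)) (kmsMeasure hK) :=
    fun u => (u.continuous.integrable_of_hasCompactSupport u.hasCompactSupport).ofReal
  change ψ.functional hK.proper (ofCc f) = ψ.functional hK.proper (ofCc _) at h
  rw [h, e, ofCc_add, ofCc_smul, map_add, map_smul]
  change ψ.functional hK.proper (ofUnits p) + Complex.I • ψ.functional hK.proper (ofUnits q) = _
  rw [functional_ofUnits_eq_integral hK, functional_ofUnits_eq_integral hK, smul_eq_mul,
    ← integral_const_mul, ← integral_add (hint p) ((hint q).const_mul _)]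
  refine integral_congr_ae (Eventually.of_forall fun x => ?_)
  change ((f x).re : ℂ) + Complex.I * ((f x).im : ℂ) = f x
  rw [_root_.mul_comm Complex.I]
  exact Complex.re_add_im _

theorem continuous_integral_condExp (m : Measure (unitSpace G)) [m.Regular]
    (u : C_c(unitSpace G, ℝ)) :
    Continuous fun a : ReducedCStarAlgebra G => ∫ x, (u x : ℂ) ^ 2 * condExp a x ∂m := by
  have hint : ∀ a : ReducedCStarAlgebra G,
      Integrable (fun x => (u x : ℂ) ^ 2 * condExp a x) m := fun a =>
    integrable_sq_mul m u (condExp a).continuous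
  let L : ReducedCStarAlgebra G →ₗ[ℂ] ℂ :=
    { toFun := fun a => ∫ x, (u x : ℂ) ^ 2 * condExp a x ∂m
      map_add' := fun a b => by
        rw [← integral_add (hint a) (hint b)]
        refine integral_congr_ae (Eventually.of_forall fun x => ?_)
        simp only [map_add, ZeroAtInftyContinuousMap.add_apply, mul_add]
      map_smul' := fun z a => by
        rw [RingHom.id_apply, smul_eq_mul, ← integral_const_mul]
        refine integral_congr_ae (Eventually.of_forall fun x => ?_)
        simp only [map_smul, ZeroAtInftyContinuousMap.smul_apply, smul_eq_mul]
        ring }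
  refine (L.mkContinuous (∫ x, ‖(u x : ℂ) ^ 2‖ ∂m) fun a => ?_).continuous
  rw [← integral_mul_const]
  have h1 := (integrable_sq_mul m u (continuous_const (y := (1 : ℂ)))).norm
  simp only [mul_one] at h1
  refine norm_integral_le_of_norm_le (h1.mul_const _) (Eventually.of_forall fun x => ?_)
  rw [norm_mul]
  exact mul_le_mul_of_nonneg_left (norm_diag_le a x) (norm_nonneg _)

/-- Both sides are norm continuous in `a` and agree on the dense image of `C_c(G)`. The compression
by `u` is what makes them continuous. -/
theorem functional_conj_eq_integral {c₀ : RealHom G}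
    (hiso : ∀ x ∈ unitSpace G, isotropy x ∩ c₀.ker = {x}) (hopen : IsOpen c₀.ker)
    (hK : ψ.IsKMS (sigma c) β) (hinv : ∀ t : ℝ, ψ.IsInvariantUnder (sigma c₀ t))
    (u : C_c(unitSpace G, ℝ)) (a : ReducedCStarAlgebra G) :
    ψ.functional hK.proper (ofUnits u * a * ofUnits u) =
      ∫ x, (u x : ℂ) ^ 2 * condExp a x ∂(kmsMeasure hK) := by
  have h : (fun a => ψ.functional hK.proper (ofUnits u * a * ofUnits u)) =
      fun a => ∫ x, (u x : ℂ) ^ 2 * condExp a x ∂(kmsMeasure hK) := by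
    refine Continuous.ext_on denseRange_ofCc
      (continuous_functional_conj hK.proper (ofUnits_mem_leftIdeal hK u) (star_ofUnits u))
      (continuous_integral_condExp _ u) ?_
    rintro _ ⟨f, rfl⟩
    simp only
    rw [ofUnits, ofCc_mul, ofCc_mul, functional_ofCc_eq_integral hiso hopen hK hinv]
    refine integral_congr_ae (Eventually.of_forall fun x => ?_)
    simp only
    rw [condExp_ofCc, conv_diagCc_right, conv_diagCc_left, rangeUnit_coe, sourceUnit_coe]
    ring
  exact congrFun h a

theorem apply_conj_eq_lintegral {c₀ : RealHom G}
    (hiso : ∀ x ∈ unitSpace G, isotropy x ∩ c₀.ker = {x}) (hopen : IsOpen c₀.ker)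
    (hK : ψ.IsKMS (sigma c) β) (hinv : ∀ t : ℝ, ψ.IsInvariantUnder (sigma c₀ t))
    (u : C_c(unitSpace G, ℝ)) {a : ReducedCStarAlgebra G} (ha : 0 ≤ a) :
    ψ ⟨ofUnits u * a * ofUnits u, conj_nonneg u ha⟩ =
      ∫⁻ x, ENNReal.ofReal (u x ^ 2 * (condExp a x).re) ∂(kmsMeasure hK) := by
  have hfin := apply_conj_lt_top hK u ha
  have h1 := functional_of_nonneg hK.proper (conj_nonneg u ha) hfin
  rw [functional_conj_eq_integral hiso hopen hK hinv] at h1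
  have hre : ∀ x, (condExp a x).im = 0 ∧ 0 ≤ (condExp a x).re := fun x => by
    obtain ⟨r, hr, e⟩ := condExp_nonneg a ha x
    rw [e]
    exact ⟨Complex.ofReal_im r, hr⟩
  have hval : ∀ x, (u x : ℂ) ^ 2 * condExp a x = ((u x ^ 2 * (condExp a x).re : ℝ) : ℂ) :=
    fun x => by
    push_cast
    congr 1
    exact Complex.ext rfl (by simp [(hre x).1])
  simp_rw [hval] at h1
  rw [integral_complex_ofReal, Complex.ofReal_inj] at h1
  rw [← ENNReal.ofReal_toReal hfin.ne, ← h1]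
  refine ofReal_integral_eq_lintegral_ofReal ?_
    (Eventually.of_forall fun x => mul_nonneg (sq_nonneg _) (hre x).2)
  have hint : Integrable (fun x => (u x : ℂ) ^ 2 * condExp a x) (kmsMeasure hK) :=
    integrable_sq_mul (kmsMeasure hK) u (condExp a).continuous
  simp_rw [hval] at hint
  exact hint.re

/-! ### Comparison of the weight with integration of the conditional expectation -/

/-- Compressing by a cut-off function on the unit space does not increase a KMS weight. -/
theorem apply_conj_le {c₀ : RealHom G}
    (hiso : ∀ x ∈ unitSpace G, isotropy x ∩ c₀.ker = {x}) (hopen : IsOpen c₀.ker)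
    (hK : ψ.IsKMS (sigma c) β) (hinv : ∀ t : ℝ, ψ.IsInvariantUnder (sigma c₀ t))
    {u : C_c(unitSpace G, ℝ)} (hu : ∀ x, u x ∈ Icc (0 : ℝ) 1) {a : ReducedCStarAlgebra G}
    (ha : 0 ≤ a) : ψ ⟨ofUnits u * a * ofUnits u, conj_nonneg u ha⟩ ≤ ψ ⟨a, ha⟩ := by
  rcases eq_or_ne (ψ ⟨a, ha⟩) ∞ with htop | hfin
  · rw [htop]; exact le_top
  have hP := hK.proper
  have hfin' : ψ ⟨a, ha⟩ < ∞ := hfin.lt_top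
  set b := CFC.sqrt a
  have hbsa : star b = b := (IsSelfAdjoint.of_nonneg (CFC.sqrt_nonneg a)).star_eq
  have hbb : b * b = a := CFC.sqrt_mul_sqrt_self a ha
  have hbmem : b ∈ ψ.leftIdeal := sqrt_mem_leftIdeal ha hfin'
  have hamem : a ∈ ψ.leftIdeal := mem_leftIdeal_of_lt_top hP ha hfin'
  have humem := ofUnits_mem_leftIdeal hK u
  have hasa : star a = a := (IsSelfAdjoint.of_nonneg ha).star_eq
  -- The fixed element `u` moves from the left of `au` to its right, so `Ψ(uau) = Ψ(au²)`, which is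
  -- the form of `√a` against `√a u²`.
  have hc : ψ.functional hP (ofUnits u * a * ofUnits u) =
      ψ.functional hP (star b * (b * ofUnits (u * u))) := by
    have h1 := hK.functional_mul_comm (a := a * ofUnits u) (d := ofUnits u)
      (mul_mem_leftIdeal hP _ humem)
      (by rw [star_mul, hasa]; exact mul_mem_leftIdeal hP _ hamem) humem
      (by rwa [star_ofUnits]) (fun t => sigma_ofUnits c t u)
    rw [_root_.mul_assoc, ← h1, hbsa, ← _root_.mul_assoc b, hbb, _root_.mul_assoc, ofUnits_mul]
  -- Both values are already known as integrals, and `u⁴ ≤ u²` pointwise since `0 ≤ u ≤ 1`.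
  have hmono : ψ.normSq (b * ofUnits (u * u)) ≤ ψ.normSq (b * ofUnits u) := by
    rw [← apply_conj_eq_normSq _ ha, ← apply_conj_eq_normSq _ ha,
      apply_conj_eq_lintegral hiso hopen hK hinv _ ha,
      apply_conj_eq_lintegral hiso hopen hK hinv _ ha]
    refine lintegral_mono fun x => ENNReal.ofReal_le_ofReal ?_
    obtain ⟨r, hr, e⟩ := condExp_nonneg a ha x
    rw [e, Complex.ofReal_re]
    refine mul_le_mul_of_nonneg_right ?_ hr
    have : (u * u) x = u x * u x := rfl
    rw [this]
    exact pow_le_pow_left₀ (mul_nonneg (hu x).1 (hu x).1)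
      (mul_le_of_le_one_left (hu x).1 (hu x).2) 2
  have hmem1 : b * ofUnits u ∈ ψ.leftIdeal := mul_mem_leftIdeal hP _ humem
  have hmem2 : b * ofUnits (u * u) ∈ ψ.leftIdeal :=
    mul_mem_leftIdeal hP _ (ofUnits_mem_leftIdeal hK _)
  have hcs := functional_cauchySchwarz hP hbmem hmem2
  rw [← hc, functional_of_nonneg hP (conj_nonneg u ha) (apply_conj_lt_top hK u ha),
    Complex.norm_real, Real.norm_of_nonneg ENNReal.toReal_nonneg, apply_conj_eq_normSq u ha] at hcs
  rw [apply_conj_eq_normSq u ha]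
  have hbn : ψ.normSq b = ψ ⟨a, ha⟩ := apply_congr (by rw [hbsa, hbb]) _ _
  rw [hbn] at hcs
  have h2 := ENNReal.toReal_mono (mem_leftIdeal_iff.1 hmem1).ne hmono
  refine (ENNReal.toReal_le_toReal (mem_leftIdeal_iff.1 hmem1).ne hfin).1 ?_
  have h3 : (0 : ℝ) ≤ (ψ ⟨a, ha⟩).toReal := ENNReal.toReal_nonneg
  have h4 : (0 : ℝ) ≤ (ψ.normSq (b * ofUnits u)).toReal := ENNReal.toReal_nonneg
  change (ψ.normSq (b * ofUnits u)).toReal ≤ _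
  change (ψ.normSq (b * ofUnits u)).toReal ^ 2 ≤ _ at hcs
  -- Cauchy–Schwarz has become `p² ≤ ψ(a) p` with `p = ψ(uau)`; a non-zero `p` cancels.
  rcases h4.eq_or_lt with h5 | h5
  · rw [← h5]; exact h3
  · refine le_of_mul_le_mul_right ?_ h5
    rw [← pow_two]
    exact hcs.trans (mul_le_mul_of_nonneg_left h2 h3)

theorem apply_eq_phi [SecondCountableTopology G] {c₀ : RealHom G}
    (hiso : ∀ x ∈ unitSpace G, isotropy x ∩ c₀.ker = {x}) (hopen : IsOpen c₀.ker)
    (hK : ψ.IsKMS (sigma c) β) (hinv : ∀ t : ℝ, ψ.IsInvariantUnder (sigma c₀ t))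
    (a : {a : ReducedCStarAlgebra G // 0 ≤ a}) : ψ a = phi (kmsMeasure hK) a := by
  obtain ⟨a, ha⟩ := a
  obtain ⟨u, hu, huK⟩ := exists_cutoff_seq (G := G)
  have hpos : ∀ x, 0 ≤ (condExp a x).re := fun x => by
    obtain ⟨r, hr, e⟩ := condExp_nonneg a ha x
    rw [e]
    exact hr
  have hval := fun n => apply_conj_eq_lintegral hiso hopen hK hinv (u n) ha
  refine le_antisymm ?_ ?_
  -- The compressions converge to `a` in norm, and each has weight at most `∫ P(a) dm`.
  · refine apply_le_of_tendsto hK.proper ha (fun n => conj_nonneg (u n) ha)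
      (tendsto_cutoff_conj hu huK a) (Eventually.of_forall fun n => ?_)
    rw [hval]
    refine lintegral_mono fun x => ENNReal.ofReal_le_ofReal ?_
    exact mul_le_of_le_one_left (hpos x) (pow_le_one₀ (hu n x).1 (hu n x).2)
  -- Fatou's lemma suits this direction: `P(a)` need not be integrable and the cut-offs are not
  -- required to be monotone.
  · have hlim : ∀ x, liminf (fun n => ENNReal.ofReal (u n x ^ 2 * (condExp a x).re)) atTop =
        ENNReal.ofReal (condExp a x).re := fun x => by
      refine (tendsto_const_nhds.congr' ?_).liminf_eq
      filter_upwards [huK {x} isCompact_singleton] with n hn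
      rw [hn x rfl, one_pow, one_mul]
    calc phi (kmsMeasure hK) ⟨a, ha⟩
        = ∫⁻ x, liminf (fun n => ENNReal.ofReal (u n x ^ 2 * (condExp a x).re)) atTop
            ∂(kmsMeasure hK) := by simp_rw [hlim]; rfl
      _ ≤ liminf (fun n => ∫⁻ x, ENNReal.ofReal (u n x ^ 2 * (condExp a x).re) ∂(kmsMeasure hK))
            atTop := by
          refine lintegral_liminf_le fun n => ?_
          exact (((u n).continuous.pow 2).mul
            (Complex.continuous_re.comp (condExp a).continuous)).measurable.ennreal_ofReal
      _ ≤ ψ ⟨a, ha⟩ := by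
          refine liminf_le_of_frequently_le' (Eventually.frequently
            (Eventually.of_forall fun n => ?_))
          rw [← hval]
          exact apply_conj_le hiso hopen hK hinv (hu n) ha

end ReducedCStarAlgebra

end EtaleGroupoid

theorem theorem2p2 {G : Type*} [TopologicalSpace G] [EtaleGroupoid G] [T2Space G]
    [LocallyCompactSpace G] [SecondCountableTopology G] [MeasurableSpace G] [BorelSpace G]
    (c₀ c : EtaleGroupoid.RealHom G)
    (hiso : ∀ x ∈ EtaleGroupoid.unitSpace G, EtaleGroupoid.isotropy x ∩ c₀.ker = {x})
    (hopen : IsOpen c₀.ker)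
    (β : ℝ) (ψ : CStarWeight (EtaleGroupoid.ReducedCStarAlgebra G))
    (hKMS : ψ.IsKMS (EtaleGroupoid.ReducedCStarAlgebra.sigma c) β)
    (hinv : ∀ t : ℝ, ψ.IsInvariantUnder (EtaleGroupoid.ReducedCStarAlgebra.sigma c₀ t)) :
    ∃ m : MeasureTheory.Measure (EtaleGroupoid.unitSpace G), m.Regular ∧ m ≠ 0 ∧
      ∀ a : {a : EtaleGroupoid.ReducedCStarAlgebra G // 0 ≤ a},
        ψ a = EtaleGroupoid.ReducedCStarAlgebra.phi m a := by
  have h := EtaleGroupoid.ReducedCStarAlgebra.apply_eq_phi hiso hopen hKMS hinv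
  refine ⟨EtaleGroupoid.ReducedCStarAlgebra.kmsMeasure hKMS, inferInstance, fun h0 => ?_, h⟩
  -- A zero measure would force `ψ = 0`, against properness. Finiteness on compact sets is part of
  -- `Regular`.
  obtain ⟨a, ha⟩ := hKMS.proper.ne_zero
  apply ha
  rw [h, h0, EtaleGroupoid.ReducedCStarAlgebra.phi, MeasureTheory.lintegral_zero_measure]
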